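/- Let $l_1,l_2,l_3^+,l_3^->0$, $l_3:=l_3^++l_3^-$, $I_1=(0,l_1)$, $I_2=(0,l_2)$, $I_3=(-l_3^-,l_3^+)$, $\Omega=I_1\times I_2\times I_3$, $\Gamma=I_1\times I_2\times\{0\}$, $U=I_2\times I_3$, and let $\varepsilon,\mu,\omega>0$. For $L_1,L_2,L_3>0$ set $$\sigma(L_1,L_2,L_3)=\Big\{\tfrac{4\pi^2}{\varepsilon\mu}\Big(\tfrac{k_1^2}{L_1^2}+\tfrac{k_2^2}{L_2^2}+\tfrac{k_3^2}{4L_3^2}\Big)\ \Big|\ k_1,k_2,k_3\in\mathbb N_0\Big\},\qquad \sigma_M=\sigma(l_1,l_2,l_3)\cup\sigma(l_1,l_2,l_3^+)\cup\sigma(l_1,l_2,l_3^-).$$ *Spaces* (complex-valued functions, weak derivatives). Let $\Omega_\#=\mathbb R^2\times I_3$, $\Gamma_\#=\mathbb R^2\times\{0\}$; for $u$ on $\Omega$ let $\tilde u$ be its extension to $\Omega_\#$ that is $l_1$-periodic in $x_1$ and $l_2$-periodic in $x_2$; for $u$ on $I_1$ let $\tilde u$ be its $l_1$-periodic extension to $\mathbb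 R$. Set $H^1_\#(I_1)=\{u\in H^1(I_1)\mid\tilde u\in H^1_{\rm loc}(\mathbb R)\}$, $H^1_\#(\Omega)=\{u\in H^1(\Omega)\mid\tilde u\in H^1_{\rm loc}(\Omega_\#)\}$, $H^1_\#(\Omega\setminus\Gamma)=\{u\in H^1(\Omega\setminus\Gamma)\mid\tilde u\in H^1_{\rm loc}(\Omega_\#\setminus\Gamma_\#)\}$, $$H^1_{0,\#}(\Omega\setminus\Gamma)=\Big\{u\in H^1_\#(\Omega)\ \Big|\ \int_\Omega\nabla u\cdot\psi=-\int_\Omega u\,\mathrm{div}\,\psi\ \ \forall\psi\in H^1_\#(\Omega\setminus\Gamma)^3\Big\},$$ where $\mathrm{div}\,\psi$ is the weak divergence in $\Omega\setminus\Gamma$ (so $u$ vanishes on $\Gamma$ and on the top and bottom boundaries). Let $W=L^2(U,H^1_\#(I_1))$ and $$X_H=\{E\in L^2(\Omega,\mathbb C^3)\mid E_1\in H^1_{0,\#}(\Omega\setminus\Gamma),\ E_2,E_3\in W\},\qquad Y_H=\{H\in L^2(\Omega,\mathbb C^3)\mid H_1\in H^1_\#(\Omega),\ H_2,H_3\in W\}.$$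 *Weak solutions.* Let $f_h,f_e\in L^2(\Omega,\mathbb C^3)$. A pair $(E,H)\in X_H\times Y_H$ is a weak solution of the Helmholtz-type system if for all $\phi\in X_H$ and $\psi\in Y_H$ (with $\mathrm{curl}(e_1\varphi)=(0,\partial_3\varphi,-\partial_2\varphi)$) $$\begin{aligned} \int_\Omega\nabla E_1\cdot\nabla\phi_1-\omega^2\varepsilon\mu E_1\phi_1&=\int_\Omega i\omega\mu(f_e)_1\phi_1+f_h\cdot\mathrm{curl}(e_1\phi_1),\\ \int_\Omega\nabla H_1\cdot\nabla\psi_1-\omega^2\varepsilon\mu H_1\psi_1&=\int_\Omega-i\omega\varepsilon(f_h)_1\psi_1+f_e\cdot\mathrm{curl}(e_1\psi_1),\\ \int_\Omega\partial_1E_2\,\partial_1\phi_2-\omega^2\varepsilon\mu E_2\phi_2&=\int_\Omega\partial_2E_1\,\partial_1\phi_2-i\omega\mu\,\partial_3H_1\,\phi_2+(f_h)_3\partial_1\phi_2+i\omega\mu(f_e)_2\phi_2,\\ \int_\Omega\partial_1H_2\,\partial_1\psi_2-\omega^2\varepsilon\mu H_2\psi_2&=\int_\Omega\partial_2H_1\,\partial_1\psi_2+i\omega\varepsilon\,\partial_3E_1\,\psi_2+(f_e)_3\partial_1\psi_2-i\omega\varepsilon(f_h)_2\psi_2,\\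 \int_\Omega\partial_1E_3\,\partial_1\phi_3-\omega^2\varepsilon\mu E_3\phi_3&=\int_\Omega\partial_3E_1\,\partial_1\phi_3+i\omega\mu\,\partial_2H_1\,\phi_3-(f_h)_2\partial_1\phi_3+i\omega\mu(f_e)_3\phi_3,\\ \int_\Omega\partial_1H_3\,\partial_1\psi_3-\omega^2\varepsilon\mu H_3\psi_3&=\int_\Omega\partial_3H_1\,\partial_1\psi_3-i\omega\varepsilon\,\partial_2E_1\,\psi_3-(f_e)_2\partial_1\psi_3-i\omega\varepsilon(f_h)_3\psi_3. \end{aligned}$$ **Proposition.** If $\omega^2\notin\sigma_M$, then for arbitrary $(f_h,f_e)\in L^2(\Omega,\mathbb C^3)^2$ the Helmholtz-type system has a unique weak solution $(E,H)\in X_H\times Y_H$. -/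

import Mathlib

open MeasureTheory Set

noncomputable section

namespace PolarizationInterface

/-! ### Weak derivatives and first order Sobolev spaces -/

section Sobolev

open scoped ContDiff

variable {V : Type*} [NormedAddCommGroup V] [NormedSpace ℝ V] [MeasureSpace V]

/-- `g` is the weak derivative of `u` in direction `v` in the open set `O`: for all
`φ ∈ C_c^∞(O)` there holds `∫_O u ∂_v φ = - ∫_O g φ`.
It is only used for `u` and `g` that are locally square integrable in `O`. -/
def IsWeakDeriv (O : Set V) (v : V) (u g : V → ℂ) : Prop :=
  ∀ φ : V → ℂ, ContDiff ℝ ∞ φ → HasCompactSupport φ → tsupport φ ⊆ O →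
    ∫ x in O, u x * fderiv ℝ φ x v = - ∫ x in O, g x * φ x

/-- `u ∈ L²_loc(O)`. -/
def MemL2loc (O : Set V) (u : V → ℂ) : Prop :=
  ∀ K : Set V, IsCompact K → K ⊆ O → MemLp u 2 (volume.restrict K)

/-- `u ∈ H¹(O)`: `u` and its weak directional derivatives are in `L²(O)`. -/
def MemH1 (O : Set V) (u : V → ℂ) : Prop :=
  MemLp u 2 (volume.restrict O) ∧
    ∀ v : V, ∃ g : V → ℂ, MemLp g 2 (volume.restrict O) ∧ IsWeakDeriv O v u g

/-- `u ∈ H¹_loc(O)`: `u` and its weak directional derivatives are in `L²_loc(O)`. -/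
def MemH1loc (O : Set V) (u : V → ℂ) : Prop :=
  MemL2loc O u ∧ ∀ v : V, ∃ g : V → ℂ, MemL2loc O g ∧ IsWeakDeriv O v u g

open Classical in
/-- The weak derivative of `u` in direction `v`, as a function in `L²(O)`. It is unique up to
null sets of `O`, see `weakDeriv_ae_eq`. (It is set to zero if there is none in `L²(O)`.) -/
def weakDeriv (O : Set V) (v : V) (u : V → ℂ) : V → ℂ :=
  if h : ∃ g : V → ℂ, MemLp g 2 (volume.restrict O) ∧ IsWeakDeriv O v u g
  then h.choose else 0

/-- `weakDeriv` is almost everywhere equal to every weak derivative in `L²(O)`. -/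
theorem weakDeriv_ae_eq [FiniteDimensional ℝ V] [BorelSpace V] [IsLocallyFiniteMeasure (volume : Measure V)]
    {O : Set V} (hO : IsOpen O) {v : V} {u g : V → ℂ}
    (hg : MemLp g 2 (volume.restrict O)) (h : IsWeakDeriv O v u g) :
    weakDeriv O v u =ᵐ[volume.restrict O] g := by
  have hex : ∃ g : V → ℂ, MemLp g 2 (volume.restrict O) ∧ IsWeakDeriv O v u g := ⟨g, hg, h⟩
  have hw : weakDeriv O v u = hex.choose := by
    unfold weakDeriv
    rw [dif_pos hex]
  obtain ⟨hm, hd⟩ := hex.choose_spec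
  rw [← hw] at hm hd
  have hloc : ∀ k : V → ℂ, MemLp k 2 (volume.restrict O) → LocallyIntegrableOn k O volume := by
    intro k hk
    have h1 : LocallyIntegrable k (volume.restrict O) := hk.locallyIntegrable (by norm_num)
    exact locallyIntegrableOn_of_locallyIntegrable_restrict h1
  have hz := hO.ae_eq_zero_of_integral_contDiff_smul_eq_zero (μ := volume)
    (f := fun x => weakDeriv O v u x - g x)
    ((hloc _ hm).sub (hloc _ hg)) (by
      intro φ hφ hc hs
      have hφ' : ContDiff ℝ ∞ (fun x => (φ x : ℂ)) := Complex.ofRealCLM.contDiff.comp hφ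
      have hc' : HasCompactSupport (fun x => (φ x : ℂ)) :=
        hc.comp_left (g := fun t : ℝ => (t : ℂ)) (by simp)
      have hs' : tsupport (fun x => (φ x : ℂ)) ⊆ O :=
        (tsupport_comp_subset (g := fun t : ℝ => (t : ℂ)) (by simp) φ).trans hs
      have e := (hd _ hφ' hc' hs').symm.trans (h _ hφ' hc' hs')
      have hb : MemLp (fun x => (φ x : ℂ)) 2 (volume.restrict O) :=
        (hφ'.continuous.memLp_of_hasCompactSupport hc').restrict O
      have i1 := hm.integrable_mul hb
      have i2 := hg.integrable_mul hb
      have h0 : ∫ x, φ x • (weakDeriv O v u x - g x) =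
          ∫ x in O, φ x • (weakDeriv O v u x - g x) := by
        rw [setIntegral_eq_integral_of_forall_compl_eq_zero]
        intro x hx
        have : φ x = 0 := image_eq_zero_of_notMem_tsupport (fun hx' => hx (hs hx'))
        simp [this]
      have h1 : ∫ x in O, φ x • (weakDeriv O v u x - g x) =
          ∫ x in O, (weakDeriv O v u x * (φ x : ℂ) - g x * (φ x : ℂ)) := by
        congr 1
        funext x
        simp only [Complex.real_smul]
        ring
      rw [h0, h1]
      have h2 := integral_sub i1 i2
      simp only [Pi.mul_apply] at h2
      rw [h2, neg_injective e, sub_self])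
  filter_upwards [(ae_restrict_iff' hO.measurableSet).2 hz] with x hx
  exact sub_eq_zero.1 hx

end Sobolev

/-! ### Geometry -/

/-- The lengths `l₁, l₂, l₃⁺, l₃⁻ > 0` that describe the cuboid and the position of the
interface. -/
structure Cuboid where
  l₁ : ℝ
  l₂ : ℝ
  l₃p : ℝ
  l₃m : ℝ
  l₁_pos : 0 < l₁
  l₂_pos : 0 < l₂
  l₃p_pos : 0 < l₃p
  l₃m_pos : 0 < l₃m

/-- Points of the three-dimensional space, `x = (x₁, x₂, x₃) = (x₁, (x₂, x₃))`, with Lebesgue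
measure `volume`. The norm of this type is used nowhere, except through its topology and the
notion of smoothness, which do not depend on the choice of a norm. -/
abbrev R3 : Type := ℝ × ℝ × ℝ

/-- The coordinate directions. Indices `0, 1, 2` stand for the directions `1, 2, 3`, and
similarly for components of vector fields. -/
def dir : Fin 3 → R3 := ![(1, 0, 0), (0, 1, 0), (0, 0, 1)]

namespace Cuboid

variable (D : Cuboid)

/-- `I₁ = (0, l₁)`. -/
def I₁ : Set ℝ := Ioo 0 D.l₁

/-- `I₂ = (0, l₂)`. -/
def I₂ : Set ℝ := Ioo 0 D.l₂

/-- `I₃ = (-l₃⁻, l₃⁺)`. -/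
def I₃ : Set ℝ := Ioo (-D.l₃m) D.l₃p

/-- The total height `l₃ = l₃⁺ + l₃⁻`. -/
def l₃ : ℝ := D.l₃p + D.l₃m

/-- The cross section `U = I₂ × I₃`. -/
def U : Set (ℝ × ℝ) := D.I₂ ×ˢ D.I₃

/-- The domain `Ω = I₁ × I₂ × I₃`. -/
def Omega : Set R3 := D.I₁ ×ˢ (D.I₂ ×ˢ D.I₃)

/-- The interface `Γ = I₁ × I₂ × {0}`. -/
def Gamma : Set R3 := D.I₁ ×ˢ (D.I₂ ×ˢ {0})

/-- The laterally periodic extension `Ω_# = ℝ² × (-l₃⁻, l₃⁺)` of `Ω`. -/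
def OmegaPer : Set R3 := univ ×ˢ (univ ×ˢ D.I₃)

/-- The laterally periodic extension `Γ_# = ℝ² × {0}` of `Γ`. -/
def GammaPer : Set R3 := univ ×ˢ (univ ×ˢ {0})

/-! ### Periodic functions -/

/-- The `l₁`-periodic extension to `ℝ` of a function on `I₁`. -/
def perExt₁ (u : ℝ → ℂ) : ℝ → ℂ :=
  fun t => u (D.l₁ * Int.fract (t / D.l₁))

/-- The extension to `Ω_#` of a function on `Ω`, `l₁`-periodic in `x₁` and `l₂`-periodic
in `x₂`. -/
def perExt (u : R3 → ℂ) : R3 → ℂ :=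
  fun x => u (D.l₁ * Int.fract (x.1 / D.l₁), D.l₂ * Int.fract (x.2.1 / D.l₂), x.2.2)

/-- `H¹_#(I₁)`. -/
def H1perI₁ : Set (ℝ → ℂ) :=
  {u | MemH1 D.I₁ u ∧ MemH1loc univ (D.perExt₁ u)}

/-- `H¹_#(Ω)`. -/
def H1per : Set (R3 → ℂ) :=
  {u | MemH1 D.Omega u ∧ MemH1loc D.OmegaPer (D.perExt u)}

/-- `H¹_#(Ω ∖ Γ)`: periodic functions that may jump across `Γ`. -/
def H1perJump : Set (R3 → ℂ) :=
  {u | MemH1 (D.Omega \ D.Gamma) u ∧ MemH1loc (D.OmegaPer \ GammaPer) (D.perExt u)}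

/-- `H¹_{0,#}(Ω ∖ Γ)`: functions in `H¹_#(Ω)` that vanish along the horizontal boundaries and
along `Γ`, encoded by `∫_Ω ∇u · ψ = - ∫_Ω u div ψ` for all `ψ ∈ H¹_#(Ω ∖ Γ, ℂ³)`. -/
def H1perZero : Set (R3 → ℂ) :=
  {u | u ∈ D.H1per ∧ ∀ ψ : Fin 3 → R3 → ℂ, (∀ i, ψ i ∈ D.H1perJump) →
    ∫ x in D.Omega, ∑ i, weakDeriv D.Omega (dir i) u x * ψ i x =
      - ∫ x in D.Omega, u x * ∑ i, weakDeriv (D.Omega \ D.Gamma) (dir i) (ψ i) x}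

/-- `L²(Ω) = L²(Ω, ℂ)`. -/
abbrev L2 : Type := Lp ℂ 2 (volume.restrict D.Omega)

/-- `L²(Ω, ℂ³)`, by components. -/
abbrev L2vec : Type := Fin 3 → D.L2

/-- `W = L²(U, H¹_#(I₁))`, where `L²(U, L²(I₁))` is identified with `L²(Ω)`: for almost every
`(x₂, x₃) ∈ U` the function `u(·, x₂, x₃)` is in `H¹_#(I₁)`, and its weak derivative
`g(·, x₂, x₃)` is square integrable also with respect to `(x₂, x₃)`. -/
def W : Set D.L2 :=
  {u | ∃ g : D.L2, ∀ᵐ y ∂(volume.restrict D.U),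
    (fun t => u (t, y)) ∈ D.H1perI₁ ∧
      IsWeakDeriv D.I₁ (1 : ℝ) (fun t => u (t, y)) (fun t => g (t, y))}

/-- `X_H`. -/
def XH : Set D.L2vec :=
  {E | (E 0 : R3 → ℂ) ∈ D.H1perZero ∧ E 1 ∈ D.W ∧ E 2 ∈ D.W}

/-- `Y_H`. -/
def YH : Set D.L2vec :=
  {H | (H 0 : R3 → ℂ) ∈ D.H1per ∧ H 1 ∈ D.W ∧ H 2 ∈ D.W}

/-! ### The Helmholtz-type system -/

/-- The partial derivative `∂_i` in `Ω`, in the weak sense. -/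
def pd (i : Fin 3) (u : R3 → ℂ) : R3 → ℂ := weakDeriv D.Omega (dir i) u

/-- `curl (e₁ φ) = (0, ∂₃ φ, - ∂₂ φ)`. -/
def curlE₁ (φ : R3 → ℂ) : Fin 3 → R3 → ℂ :=
  ![0, D.pd 2 φ, fun x => - D.pd 1 φ x]

variable (ε μ ω : ℝ) (fh fe : D.L2vec)

def FE₁ (φ : D.L2) : ℂ :=
  ∫ x in D.Omega, (Complex.I * ω * μ * fe 0 x * φ x + ∑ i, fh i x * D.curlE₁ φ i x)

def FH₁ (ψ : D.L2) : ℂ :=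
  ∫ x in D.Omega, (-Complex.I * ω * ε * fh 0 x * ψ x + ∑ i, fe i x * D.curlE₁ ψ i x)

def FE₂ (φ : D.L2) : ℂ :=
  ∫ x in D.Omega, (fh 2 x * D.pd 0 φ x + Complex.I * ω * μ * fe 1 x * φ x)

def FH₂ (ψ : D.L2) : ℂ :=
  ∫ x in D.Omega, (fe 2 x * D.pd 0 ψ x - Complex.I * ω * ε * fh 1 x * ψ x)

def FE₃ (φ : D.L2) : ℂ :=
  ∫ x in D.Omega, (-(fh 1 x) * D.pd 0 φ x + Complex.I * ω * μ * fe 2 x * φ x)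

def FH₃ (ψ : D.L2) : ℂ :=
  ∫ x in D.Omega, (-(fe 1 x) * D.pd 0 ψ x - Complex.I * ω * ε * fh 2 x * ψ x)

/-- `(E, H) ∈ X_H × Y_H` is a weak solution of the Helmholtz-type system with right-hand side
`(f_h, f_e)`. In strong form, the equations are
* `Δ E₁ + ω²εμ E₁ = - iωμ (f_e)₁ - (curl f_h)₁`,
* `Δ H₁ + ω²εμ H₁ = iωε (f_h)₁ - (curl f_e)₁`,
* `∂₁² E₂ + ω²εμ E₂ = ∂₂ ∂₁ E₁ + iωμ ∂₃ H₁ + ∂₁ (f_h)₃ - iωμ (f_e)₂`,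
* `∂₁² H₂ + ω²εμ H₂ = ∂₂ ∂₁ H₁ - iωε ∂₃ E₁ + ∂₁ (f_e)₃ + iωε (f_h)₂`,
* `∂₁² E₃ + ω²εμ E₃ = ∂₃ ∂₁ E₁ - iωμ ∂₂ H₁ - ∂₁ (f_h)₂ - iωμ (f_e)₃`,
* `∂₁² H₃ + ω²εμ H₃ = ∂₃ ∂₁ H₁ + iωε ∂₂ E₁ - ∂₁ (f_e)₂ + iωε (f_h)₃`. -/
structure IsWeakSolution (E H : D.L2vec) : Prop where
  mem_XH : E ∈ D.XH
  mem_YH : H ∈ D.YH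
  eqE₁ : ∀ φ ∈ D.XH,
    ∫ x in D.Omega, ((∑ i, D.pd i (E 0) x * D.pd i (φ 0) x) - ω ^ 2 * ε * μ * E 0 x * φ 0 x) =
      D.FE₁ μ ω fh fe (φ 0)
  eqH₁ : ∀ ψ ∈ D.YH,
    ∫ x in D.Omega, ((∑ i, D.pd i (H 0) x * D.pd i (ψ 0) x) - ω ^ 2 * ε * μ * H 0 x * ψ 0 x) =
      D.FH₁ ε ω fh fe (ψ 0)
  eqE₂ : ∀ φ ∈ D.XH,
    ∫ x in D.Omega, (D.pd 0 (E 1) x * D.pd 0 (φ 1) x - ω ^ 2 * ε * μ * E 1 x * φ 1 x) =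
      (∫ x in D.Omega, (D.pd 1 (E 0) x * D.pd 0 (φ 1) x
        - Complex.I * ω * μ * D.pd 2 (H 0) x * φ 1 x)) + D.FE₂ μ ω fh fe (φ 1)
  eqH₂ : ∀ ψ ∈ D.YH,
    ∫ x in D.Omega, (D.pd 0 (H 1) x * D.pd 0 (ψ 1) x - ω ^ 2 * ε * μ * H 1 x * ψ 1 x) =
      (∫ x in D.Omega, (D.pd 1 (H 0) x * D.pd 0 (ψ 1) x
        + Complex.I * ω * ε * D.pd 2 (E 0) x * ψ 1 x)) + D.FH₂ ε ω fh fe (ψ 1)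
  eqE₃ : ∀ φ ∈ D.XH,
    ∫ x in D.Omega, (D.pd 0 (E 2) x * D.pd 0 (φ 2) x - ω ^ 2 * ε * μ * E 2 x * φ 2 x) =
      (∫ x in D.Omega, (D.pd 2 (E 0) x * D.pd 0 (φ 2) x
        + Complex.I * ω * μ * D.pd 1 (H 0) x * φ 2 x)) + D.FE₃ μ ω fh fe (φ 2)
  eqH₃ : ∀ ψ ∈ D.YH,
    ∫ x in D.Omega, (D.pd 0 (H 2) x * D.pd 0 (ψ 2) x - ω ^ 2 * ε * μ * H 2 x * ψ 2 x) =
      (∫ x in D.Omega, (D.pd 2 (H 0) x * D.pd 0 (ψ 2) x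
        - Complex.I * ω * ε * D.pd 1 (E 0) x * ψ 2 x)) + D.FH₃ ε ω fh fe (ψ 2)

end Cuboid

/-! ### The spectrum -/

/-- `σ(L₁, L₂, L₃)`. -/
def sigma (ε μ L₁ L₂ L₃ : ℝ) : Set ℝ :=
  {s | ∃ k₁ k₂ k₃ : ℕ, s = 4 * Real.pi ^ 2 / (ε * μ) *
    ((k₁ : ℝ) ^ 2 / L₁ ^ 2 + (k₂ : ℝ) ^ 2 / L₂ ^ 2 + (k₃ : ℝ) ^ 2 / (4 * L₃ ^ 2))}

/-- `σ_M = σ(l₁, l₂, l₃) ∪ σ(l₁, l₂, l₃⁺) ∪ σ(l₁, l₂, l₃⁻)`. -/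
def sigmaM (D : Cuboid) (ε μ : ℝ) : Set ℝ :=
  sigma ε μ D.l₁ D.l₂ D.l₃ ∪ sigma ε μ D.l₁ D.l₂ D.l₃p ∪ sigma ε μ D.l₁ D.l₂ D.l₃m

end PolarizationInterface

end

/-! The system is triangular. The equations for `E₁` and `H₁` involve the data only, and once these
two functions are known, the other four equations are independent Helmholtz problems in the variable
`x₁` alone, with `x₂`, `x₃` as parameters. It suffices to solve three scalar problems uniquely for
arbitrary right-hand sides (`existsUnique_H1perZero`, `existsUnique_H1per`, `existsUnique_W`) and to
substitute forward (`isWeakSolution_iff`, `existsUnique_system`).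

Each scalar problem is diagonal in a complete orthogonal system of modes `e^{iαx₁} e^{iβx₂} s(x₃)`.
For `H₁` no condition is imposed on the horizontal boundaries, which is the Neumann problem: `s`
runs through the cosines on `I₃`, and the eigenvalues belong to `σ(l₁, l₂, l₃)`. For `E₁` the trace
vanishes also on `Γ`, so the two sides of `Γ` decouple: `s` runs through the Dirichlet sines of
`(-l₃⁻, 0)` and of `(0, l₃⁺)`, with eigenvalues from `σ(l₁, l₂, l₃⁻)` and `σ(l₁, l₂, l₃⁺)`. In `W`
only `x₁` is differentiated, the eigenvalue is `α²`, and it occurs in the Neumann family as well. As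
the eigenvalues tend to infinity, `ω² ∉ σ_M` keeps `κ = ω²εμ` at a positive distance from all of
them (`exists_gap`), and Fourier coefficients may be divided by `λ - κ`.

To make this rigorous, a function is replaced by the tuple of itself and its derivatives in a power
of `L²(Ω)`; these tuples form a closed subspace `V`. The one analytic input is Green's formula `⟨∇e,
∇u⟩ = λ ⟨e, u⟩` for every mode `e` and every `u` in the space. It turns the orthogonality and
completeness of the modes in `L²(Ω)` into the same properties in `V` (`existsUnique_helmholtz`).
Green's formula requires modes as test functions. Periodicity is handled by folding (`IsTiling`) and
a partition of unity, the horizontal boundaries and `Γ` by approximating `s` with functions of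
compact support (`IsTestLimit`, `IsTestLimit₁`). -/

noncomputable section

namespace PolarizationInterface

/-! ### Variational problems that are diagonal in an orthogonal system -/

section Hilbert

variable {K : Type*} [NormedAddCommGroup K] [InnerProductSpace ℂ K] [CompleteSpace K] {ι : Type*}

/-- A vector of a closed subspace `V` is determined by its pairings with an orthogonal system that
is total in `V`. -/
theorem inner_eq_of_total {V : Submodule ℂ K} (hV : IsClosed (V : Set K)) {e : ι → K}
    (htot : ∀ p ∈ V, (∀ k, inner ℂ (e k) p = 0) → p = 0) (he : ∀ k, e k ∈ V)
    {a b : K} (h : ∀ k, inner ℂ (e k) a = inner ℂ (e k) b) :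
    ∀ q ∈ V, inner ℂ q a = inner ℂ q b := by
  have : CompleteSpace V := hV.completeSpace_coe
  intro q hq
  have h1 : ∀ q ∈ V, inner ℂ q ((V.starProjection (a - b)) : K) = inner ℂ q (a - b) := by
    intro q hq
    have := V.inner_starProjection_left_eq_right q (a - b)
    rw [← this, Submodule.starProjection_eq_self_iff.2 hq]
  -- Totality is available for vectors of `V` only, so it is applied to the projection of `a - b`,
  -- which has the same pairings with `V` as `a - b`.
  have h2 : V.starProjection (a - b) = 0 := by
    apply htot _ (Submodule.starProjection_apply_mem _ _)
    intro k
    rw [h1 _ (he k), inner_sub_right, h k, sub_self]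
  have h3 := h1 q hq
  rw [h2, inner_zero_right, inner_sub_right] at h3
  exact sub_eq_zero.1 h3.symm

/-- A variational problem on a closed subspace that is diagonal in a total orthogonal system, with
diagonal entries bounded away from zero, is uniquely solvable. -/
theorem existsUnique_of_diagonal {V : Submodule ℂ K} (hV : IsClosed (V : Set K)) (M : K →L[ℂ] K)
    {e : ι → K} (he : ∀ k, e k ∈ V) (h0 : ∀ k, e k ≠ 0)
    (ho : Pairwise fun k l => inner ℂ (e k) (e l) = 0)
    (htot : ∀ p ∈ V, (∀ k, inner ℂ (e k) p = 0) → p = 0) {τ : ι → ℂ}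
    (hM : ∀ k, ∀ p ∈ V, inner ℂ (e k) (M p) = τ k * inner ℂ (e k) p) {c : ℝ} (hc : 0 < c)
    (hτ : ∀ k, c ≤ ‖τ k‖) (F : K) :
    ∃! p, p ∈ V ∧ ∀ q ∈ V, inner ℂ q (M p) = inner ℂ q F := by
  have : CompleteSpace V := hV.completeSpace_coe
  have hτ0 : ∀ k, τ k ≠ 0 := fun k h => by
    have := hτ k
    rw [h, norm_zero] at this
    linarith
  refine existsUnique_of_exists_of_unique ?_ ?_
  · let v : ι → V := fun k => ((‖e k‖⁻¹ : ℝ) : ℂ) • (⟨e k, he k⟩ : V)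
    have hvn : ∀ k, ((‖e k‖⁻¹ : ℝ) : ℂ) ≠ 0 := fun k => by simpa using h0 k
    have hv : Orthonormal ℂ v := by
      constructor
      · intro k
        simp only [v, norm_smul, Complex.norm_real, Submodule.coe_norm, norm_inv, norm_norm]
        exact inv_mul_cancel₀ (norm_ne_zero_iff.2 (h0 k))
      · intro k l hkl
        simp only [v, inner_smul_left, inner_smul_right, Submodule.coe_inner, ho hkl, mul_zero]
    have hsp : (Submodule.span ℂ (Set.range v))ᗮ = ⊥ := by
      rw [Submodule.eq_bot_iff]
      intro p hp
      rw [Submodule.mem_orthogonal] at hp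
      have := htot p p.2 fun k => by
        have := hp (v k) (Submodule.subset_span ⟨k, rfl⟩)
        simp only [v, inner_smul_left, Submodule.coe_inner, mul_eq_zero, map_eq_zero] at this
        exact this.resolve_left (hvn k)
      exact Subtype.ext this
    let b := HilbertBasis.mkOfOrthogonalEqBot hv hsp
    have hb : ∀ k, b k = v k := fun k => by
      rw [HilbertBasis.coe_mkOfOrthogonalEqBot hv hsp]
    let F' : V := V.orthogonalProjectionOnto F
    -- The coefficients of the solution. They are square summable because division by `τ k` costs at
    -- most the factor `c⁻¹`.
    have hmem : Memℓp (fun k => (b.repr F') k / τ k) 2 := by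
      have h2 : Memℓp (fun k => c⁻¹ • (b.repr F') k) 2 := (lp.memℓp (b.repr F')).const_smul c⁻¹
      refine h2.mono' fun k => ?_
      rw [norm_div, norm_smul, norm_inv, Real.norm_of_nonneg hc.le, div_eq_inv_mul]
      gcongr
      exact hτ k
    let p : V := b.repr.symm ⟨_, hmem⟩
    refine ⟨p, p.2, inner_eq_of_total hV htot he fun k => ?_⟩
    have hp : inner ℂ (v k) p = inner ℂ (v k) F' / τ k := by
      rw [← hb, ← b.repr_apply_apply, ← b.repr_apply_apply]
      simp [p]
    have hp' : inner ℂ (e k) (p : K) = inner ℂ (e k) F / τ k := by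
      simp only [v, inner_smul_left, Submodule.coe_inner] at hp
      rw [mul_div_assoc] at hp
      have := mul_left_cancel₀ ((map_ne_zero _).2 (hvn k)) hp
      rw [this]
      congr 1
      have h3 := V.inner_starProjection_left_eq_right (e k) F
      rw [Submodule.starProjection_eq_self_iff.2 (he k)] at h3
      exact h3.symm
    rw [hM k p p.2, hp', mul_div_cancel₀ _ (hτ0 k)]
  · rintro p p' ⟨hp, h⟩ ⟨hp', h'⟩
    refine sub_eq_zero.1 (htot _ (V.sub_mem hp hp') fun k => ?_)
    have h1 := (h _ (he k)).trans (h' _ (he k)).symm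
    rw [hM k p hp, hM k p' hp'] at h1
    rw [inner_sub_right, mul_left_cancel₀ (hτ0 k) h1, sub_self]

/-- A closed subspace is stable under a conjugation `C` if a total orthogonal system is mapped into
the subspace. -/
theorem conj_mem_of_total {V : Submodule ℂ K} (hV : IsClosed (V : Set K)) {C : K → K}
    (hCc : Continuous C) (hCadd : ∀ x y, C (x + y) = C x + C y)
    (hC : ∀ (c : ℂ) x, C (c • x) = (starRingEnd ℂ c) • C x) {e : ι → K} (he : ∀ k, e k ∈ V)
    (htot : ∀ p ∈ V, (∀ k, inner ℂ (e k) p = 0) → p = 0) (hCe : ∀ k, C (e k) ∈ V)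
    {p : K} (hp : p ∈ V) : C p ∈ V := by
  -- Although `C` is antilinear, this is a complex subspace; it is closed and contains every `e k`.
  -- A vector of `V` orthogonal to it vanishes by totality, so it is all of `V`.
  let V' : Submodule ℂ K :=
    { carrier := {p | p ∈ V ∧ C p ∈ V}
      add_mem' := fun {a b} ha hb => ⟨V.add_mem ha.1 hb.1, by
        rw [hCadd]
        exact V.add_mem ha.2 hb.2⟩
      zero_mem' := ⟨V.zero_mem, by
        have h := hC 0 0
        rw [zero_smul, map_zero, zero_smul] at h
        rw [h]
        exact V.zero_mem⟩
      smul_mem' := fun c x hx => ⟨V.smul_mem c hx.1, by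
        rw [hC]
        exact V.smul_mem _ hx.2⟩ }
  have hV' : IsClosed (V' : Set K) := hV.inter (hV.preimage hCc)
  have : CompleteSpace V' := hV'.completeSpace_coe
  have h1 : V' ⊔ V'ᗮ ⊓ V = V :=
    Submodule.sup_orthogonal_inf_of_hasOrthogonalProjection fun x hx => hx.1
  have h2 : V'ᗮ ⊓ V = ⊥ := by
    rw [Submodule.eq_bot_iff]
    rintro x ⟨hx, hxV⟩
    exact htot x hxV fun k => (Submodule.mem_orthogonal _ _).1 hx _ ⟨he k, hCe k⟩
  rw [h2, sup_bot_eq] at h1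
  rw [← h1] at hp
  exact hp.2

end Hilbert

set_option linter.unusedSectionVars false

/-! ### Weak derivatives -/

section WeakDeriv

open scoped ContDiff

variable {E : Type*} [NormedAddCommGroup E] [NormedSpace ℝ E] [MeasureSpace E]

theorem fderiv_apply_eq_zero_of_notMem_tsupport {φ : E → ℂ} {x : E} (hx : x ∉ tsupport φ) (v : E) :
    fderiv ℝ φ x v = 0 := by
  have : fderiv ℝ φ x = 0 :=
    image_eq_zero_of_notMem_tsupport fun h => hx (tsupport_fderiv_subset ℝ h)
  rw [this, zero_apply]

theorem tsupport_fderiv_apply_subset' (φ : E → ℂ) (v : E) :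
    tsupport (fun x => fderiv ℝ φ x v) ⊆ tsupport φ := by
  refine closure_minimal (fun x hx => ?_) (isClosed_tsupport φ)
  by_contra h
  exact hx (fderiv_apply_eq_zero_of_notMem_tsupport h v)

theorem hasCompactSupport_fderiv_apply {φ : E → ℂ} (hc : HasCompactSupport φ) (v : E) :
    HasCompactSupport (fun x => fderiv ℝ φ x v) :=
  hc.of_isClosed_subset (isClosed_tsupport _) (tsupport_fderiv_apply_subset' φ v)

theorem continuous_fderiv_apply_const {φ : E → ℂ} (hφ : ContDiff ℝ ∞ φ) (v : E) :
    Continuous (fun x => fderiv ℝ φ x v) :=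
  (hφ.continuous_fderiv (by simp)).clm_apply continuous_const

/-- Products with functions that are supported in `O` may be integrated over the whole space. -/
theorem setIntegral_mul_of_tsupport_subset {O : Set E} (u : E → ℂ) {φ : E → ℂ}
    (hs : tsupport φ ⊆ O) : ∫ x in O, u x * φ x = ∫ x, u x * φ x := by
  refine setIntegral_eq_integral_of_forall_compl_eq_zero fun x hx => ?_
  rw [image_eq_zero_of_notMem_tsupport fun h => hx (hs h), mul_zero]

theorem IsWeakDeriv.mono {O O' : Set E} {v : E} {u g : E → ℂ} (h : IsWeakDeriv O v u g)
    (hO : O' ⊆ O) : IsWeakDeriv O' v u g := by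
  intro φ hφ hc hs
  have := h φ hφ hc (hs.trans hO)
  have hs' := (tsupport_fderiv_apply_subset' φ v).trans hs
  rwa [setIntegral_mul_of_tsupport_subset u (hs'.trans hO),
    setIntegral_mul_of_tsupport_subset g (hs.trans hO), ← setIntegral_mul_of_tsupport_subset u hs',
    ← setIntegral_mul_of_tsupport_subset g hs] at this

theorem IsWeakDeriv.congr {O : Set E} {v : E} {u g u' g' : E → ℂ} (h : IsWeakDeriv O v u g)
    (hu : u =ᵐ[volume.restrict O] u') (hg : g =ᵐ[volume.restrict O] g') :
    IsWeakDeriv O v u' g' := by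
  intro φ hφ hc hs
  have e1 : ∫ x in O, u' x * fderiv ℝ φ x v = ∫ x in O, u x * fderiv ℝ φ x v :=
    integral_congr_ae (by filter_upwards [hu] with x hx; rw [hx])
  have e2 : ∫ x in O, g' x * φ x = ∫ x in O, g x * φ x :=
    integral_congr_ae (by filter_upwards [hg] with x hx; rw [hx])
  rw [e1, e2]
  exact h φ hφ hc hs

variable [BorelSpace E]

theorem integrableOn_mul_of_tsupport_subset {O : Set E} {g φ : E → ℂ}
    (hg : LocallyIntegrableOn g O) (hφ : Continuous φ) (hc : HasCompactSupport φ)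
    (hs : tsupport φ ⊆ O) : IntegrableOn (fun x => g x * φ x) O := by
  have h1 : IntegrableOn (fun x => g x * φ x) (tsupport φ) :=
    (hg.integrableOn_compact_subset hs hc).mul_continuousOn hφ.continuousOn hc
  refine ((integrableOn_iff_integrable_of_support_subset fun x hx => ?_).1 h1).integrableOn
  exact subset_tsupport φ (right_ne_zero_of_mul hx)

variable [FiniteDimensional ℝ E]

theorem MemL2loc.locallyIntegrableOn [IsLocallyFiniteMeasure (volume : Measure E)] {O : Set E}
    (hO : IsOpen O) {u : E → ℂ} (hu : MemL2loc O u) : LocallyIntegrableOn u O := by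
  have : ProperSpace E := FiniteDimensional.proper ℝ E
  rw [locallyIntegrableOn_iff hO.isLocallyClosed]
  intro K hKO hK
  have : IsFiniteMeasure (volume.restrict K) := ⟨by simpa using hK.measure_lt_top⟩
  exact (hu K hK hKO).integrable (by norm_num)

theorem _root_.MeasureTheory.MemLp.locallyIntegrableOn_two {O : Set E}
    [IsLocallyFiniteMeasure (volume : Measure E)] {u : E → ℂ}
    (hu : MemLp u 2 (volume.restrict O)) : LocallyIntegrableOn u O :=
  locallyIntegrableOn_of_locallyIntegrable_restrict (hu.locallyIntegrable (by norm_num))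

/-- The difference integrates to zero against all test functions, and real ones already force it to
vanish. Local integrability is enough, which makes this applicable to derivatives of periodic
extensions; these are only locally square integrable. -/
theorem IsWeakDeriv.ae_eq [IsLocallyFiniteMeasure (volume : Measure E)] {O : Set E}
    (hO : IsOpen O) {v : E} {u g g' : E → ℂ} (hg : LocallyIntegrableOn g O)
    (hg' : LocallyIntegrableOn g' O) (h : IsWeakDeriv O v u g) (h' : IsWeakDeriv O v u g') :
    g =ᵐ[volume.restrict O] g' := by
  have hz := hO.ae_eq_zero_of_integral_contDiff_smul_eq_zero (μ := volume)
    (f := fun x => g x - g' x) (hg.sub hg') (by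
      intro φ hφ hc hs
      have hφ' : ContDiff ℝ ∞ (fun x => (φ x : ℂ)) := Complex.ofRealCLM.contDiff.comp hφ
      have hc' : HasCompactSupport (fun x => (φ x : ℂ)) :=
        hc.comp_left (g := fun t : ℝ => (t : ℂ)) (by simp)
      have hs' : tsupport (fun x => (φ x : ℂ)) ⊆ O :=
        (tsupport_comp_subset (g := fun t : ℝ => (t : ℂ)) (by simp) φ).trans hs
      have e := (h _ hφ' hc' hs').symm.trans (h' _ hφ' hc' hs')
      have i1 := integrableOn_mul_of_tsupport_subset hg hφ'.continuous hc' hs'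
      have i2 := integrableOn_mul_of_tsupport_subset hg' hφ'.continuous hc' hs'
      have h0 : ∫ x, φ x • (g x - g' x) = ∫ x, (g x - g' x) * (φ x : ℂ) :=
        integral_congr_ae (.of_forall fun x => by simp only [Complex.real_smul]; ring)
      rw [h0, ← setIntegral_mul_of_tsupport_subset (fun x => g x - g' x) hs']
      simp only [sub_mul]
      rw [integral_sub i1 i2, neg_injective e, sub_self])
  filter_upwards [(ae_restrict_iff' hO.measurableSet).2 hz] with x hx
  exact sub_eq_zero.1 hx

theorem IsWeakDeriv.add_dir {O : Set E} {v w : E} {u g k : E → ℂ} (hu : LocallyIntegrableOn u O)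
    (hg : LocallyIntegrableOn g O) (hk : LocallyIntegrableOn k O)
    (h : IsWeakDeriv O v u g) (h' : IsWeakDeriv O w u k) :
    IsWeakDeriv O (v + w) u (fun x => g x + k x) := by
  intro φ hφ hc hs
  simp only [map_add, mul_add, add_mul]
  have i := fun v => integrableOn_mul_of_tsupport_subset hu (continuous_fderiv_apply_const hφ v)
    (hasCompactSupport_fderiv_apply hc v) ((tsupport_fderiv_apply_subset' φ v).trans hs)
  rw [integral_add (i v) (i w), integral_add
    (integrableOn_mul_of_tsupport_subset hg hφ.continuous hc hs)
    (integrableOn_mul_of_tsupport_subset hk hφ.continuous hc hs), h φ hφ hc hs, h' φ hφ hc hs,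
    neg_add]

theorem IsWeakDeriv.smul_dir {O : Set E} {v : E} {u g : E → ℂ} (c : ℝ)
    (h : IsWeakDeriv O v u g) : IsWeakDeriv O (c • v) u (fun x => c * g x) := by
  intro φ hφ hc hs
  have e := fun a b : ℂ => mul_left_comm a (c : ℂ) b
  simp only [map_smul, Complex.real_smul, e, mul_assoc, integral_const_mul]
  rw [h φ hφ hc hs, mul_neg]

/-- Integration by parts over the whole space, with differentiability of `f` required only on the
support of `φ`. Outside of `O` the function may jump, as the truncated trigonometric functions do at
the ends of their intervals. -/
theorem isWeakDeriv_of_contDiffOn [(volume : Measure E).IsAddHaarMeasure] {O : Set E}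
    (hO : IsOpen O) {f : E → ℂ} (hf : ContDiffOn ℝ 1 f O) (v : E) :
    IsWeakDeriv O v f (fun x => fderiv ℝ f x v) := by
  intro φ hφ hc hs
  have hs' := (tsupport_fderiv_apply_subset' φ v).trans hs
  have hfd : ∀ x ∈ O, DifferentiableAt ℝ f x := fun x hx =>
    (hf.differentiableOn (by simp)).differentiableAt (hO.mem_nhds hx)
  have h1 : LocallyIntegrableOn f O := hf.continuousOn.locallyIntegrableOn hO.measurableSet
  have h2 : LocallyIntegrableOn (fun x => fderiv ℝ f x v) O :=
    ((hf.continuousOn_fderiv_of_isOpen hO le_rfl).clm_apply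
      continuousOn_const).locallyIntegrableOn hO.measurableSet
  have key : ∀ {g ψ : E → ℂ}, tsupport ψ ⊆ O → IntegrableOn (fun x => g x * ψ x) O →
      Integrable (fun x => g x * ψ x) := fun hψ h =>
    (integrableOn_iff_integrable_of_support_subset fun x hx =>
      hψ (subset_tsupport _ (right_ne_zero_of_mul hx))).1 h
  rw [setIntegral_mul_of_tsupport_subset _ hs', setIntegral_mul_of_tsupport_subset _ hs]
  exact integral_mul_fderiv_eq_neg_fderiv_mul_of_integrable
    (key hs (integrableOn_mul_of_tsupport_subset h2 hφ.continuous hc hs))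
    (key hs' (integrableOn_mul_of_tsupport_subset h1 (continuous_fderiv_apply_const hφ v)
      (hasCompactSupport_fderiv_apply hc v) hs'))
    (key hs (integrableOn_mul_of_tsupport_subset h1 hφ.continuous hc hs))
    (fun x hx => hfd x (hs hx)) (fun x _ => (hφ.differentiable (by simp)) x)

end WeakDeriv

set_option linter.unusedSectionVars false

/-! ### Periodic extensions -/

section Tiling

open scoped ContDiff

variable {E : Type*} [NormedAddCommGroup E] [NormedSpace ℝ E] [FiniteDimensional ℝ E]
  [MeasureSpace E] [BorelSpace E] [(volume : Measure E).IsAddHaarMeasure] {ι : Type*} [Countable ι]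

/-- The translates of the open cell `O` by the vectors `τ m` tile the open set `P` up to a null
set, and `q` is the map that folds `P` onto the cell, so that `u ∘ q` is the periodic extension
of a function `u` on `O`. -/
structure IsTiling (O P : Set E) (τ : ι → E) (q : E → E) : Prop where
  isOpen_cell : IsOpen O
  isOpen : IsOpen P
  fold_add : ∀ m, ∀ x ∈ O, q (x + τ m) = x
  add_mem : ∀ m, ∀ x ∈ O, x + τ m ∈ P
  injective : Function.Injective τ
  cover : ∀ᵐ x : E, x ∈ P → ∃ m, x - τ m ∈ O
  locallyFinite : ∀ K : Set E, IsCompact K → {m | ∃ x ∈ K, x - τ m ∈ O}.Finite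
  exists_zero : ∃ m, τ m = 0

namespace IsTiling

variable {O P : Set E} {τ : ι → E} {q : E → E}

/-- The translate of the cell by `τ m`. -/
def cell (O : Set E) (τ : ι → E) (m : ι) : Set E := {x | x - τ m ∈ O}

theorem measurableSet_cell (h : IsTiling O P τ q) (m : ι) : MeasurableSet (cell O τ m) :=
  (h.isOpen_cell.preimage (continuous_id.sub continuous_const)).measurableSet

theorem cell_subset (h : IsTiling O P τ q) (m : ι) : cell O τ m ⊆ P := fun x hx => by
  simpa using h.add_mem m _ hx

theorem cell_subset' (h : IsTiling O P τ q) : O ⊆ P := fun x hx => by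
  obtain ⟨m, hm⟩ := h.exists_zero
  simpa [hm] using h.add_mem m _ hx

theorem fold_eq_of_mem_cell (h : IsTiling O P τ q) {m : ι} {x : E} (hx : x ∈ cell O τ m) :
    q x = x - τ m := by
  simpa using h.fold_add m _ hx

theorem fold_eq (h : IsTiling O P τ q) {x : E} (hx : x ∈ O) : q x = x := by
  obtain ⟨m, hm⟩ := h.exists_zero
  simpa [hm] using h.fold_add m _ hx

theorem disjoint_cell (h : IsTiling O P τ q) {m n : ι} (hmn : m ≠ n) :
    Disjoint (cell O τ m) (cell O τ n) := by
  rw [Set.disjoint_left]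
  intro x hm hn
  have := (h.fold_eq_of_mem_cell hm).symm.trans (h.fold_eq_of_mem_cell hn)
  exact hmn (h.injective (sub_right_injective this))

theorem preimage_cell (O : Set E) (τ : ι → E) (m : ι) : (fun x => x + τ m) ⁻¹' cell O τ m = O := by
  ext x
  simp [cell]

theorem setIntegral_cell (F : E → ℂ) (m : ι) :
    ∫ x in cell O τ m, F x = ∫ x in O, F (x + τ m) := by
  have := (measurePreserving_add_right (volume : Measure E) (τ m)).setIntegral_preimage_emb
    (measurableEmbedding_addRight (τ m)) F (cell O τ m)
  rw [preimage_cell] at this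
  exact this.symm

theorem measurePreserving_cell (m : ι) :
    MeasurePreserving (fun x => x + τ m) (volume.restrict O) (volume.restrict (cell O τ m)) := by
  have := (measurePreserving_add_right (volume : Measure E) (τ m)).restrict_preimage_emb
    (measurableEmbedding_addRight (τ m)) (cell O τ m)
  rwa [preimage_cell] at this

/-- On each of the countably many cells `q` is a translation, so preimages of null sets are null.
This allows a change of representative inside a periodic extension. -/
theorem ae_fold (h : IsTiling O P τ q) {p : E → Prop} (hp : ∀ᵐ x ∂volume.restrict O, p x) :
    ∀ᵐ x ∂volume.restrict P, p (q x) := by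
  rw [ae_restrict_iff' h.isOpen_cell.measurableSet] at hp
  rw [ae_restrict_iff' h.isOpen.measurableSet]
  have h1 : ∀ m, ∀ᵐ x : E, x - τ m ∈ O → p (x - τ m) := fun m =>
    (measurePreserving_sub_right (volume : Measure E) (τ m)).quasiMeasurePreserving.tendsto_ae hp
  filter_upwards [ae_all_iff.2 h1, h.cover] with x hx hc hxP
  obtain ⟨m, hm⟩ := hc hxP
  rw [h.fold_eq_of_mem_cell hm]
  exact hx m hm

theorem integrableOn_cell_iff {F : E → ℂ} {m : ι} :
    IntegrableOn F (cell O τ m) ↔ IntegrableOn (fun x => F (x + τ m)) O :=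
  ((measurePreserving_cell (O := O) (τ := τ) m).integrable_comp_emb
    (measurableEmbedding_addRight (τ m))).symm

/-- Unfolding: integrals of a periodic extension against functions with compact support. -/
theorem setIntegral_fold (h : IsTiling O P τ q) {f : E → ℂ} (hf : IntegrableOn f O) {φ : E → ℂ}
    (hφ : Continuous φ) (hc : HasCompactSupport φ) (M : Finset ι)
    (hM : ∀ m, ∀ x ∈ O, φ (x + τ m) ≠ 0 → m ∈ M) :
    ∫ x in P, f (q x) * φ x = ∑ m ∈ M, ∫ x in O, f x * φ (x + τ m) := by
  obtain ⟨C, hC⟩ := hc.exists_bound_of_continuous hφ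
  have hsub : ⋃ m ∈ M, cell O τ m ⊆ P := iUnion₂_subset fun m _ => h.cell_subset m
  have hmeas : MeasurableSet (⋃ m ∈ M, cell O τ m) :=
    M.measurableSet_biUnion fun m _ => h.measurableSet_cell m
  have hcell : ∀ m, ∀ x ∈ O, f (q (x + τ m)) * φ (x + τ m) = f x * φ (x + τ m) :=
    fun m x hx => by rw [h.fold_add m x hx]
  rw [setIntegral_eq_of_subset_of_ae_sdiff_eq_zero (s := ⋃ m ∈ M, cell O τ m)
    h.isOpen.measurableSet.nullMeasurableSet hsub, integral_biUnion_finset]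
  · refine Finset.sum_congr rfl fun m _ => ?_
    rw [setIntegral_cell]
    exact setIntegral_congr_fun h.isOpen_cell.measurableSet (hcell m)
  · exact fun m _ => h.measurableSet_cell m
  · exact fun m _ n _ hmn => h.disjoint_cell hmn
  · intro m _
    rw [integrableOn_cell_iff]
    refine IntegrableOn.congr_fun ?_ (fun x hx => (hcell m x hx).symm) h.isOpen_cell.measurableSet
    exact hf.mul_bdd (c := C)
      (hφ.comp (continuous_id.add continuous_const)).aestronglyMeasurable (.of_forall fun x => hC _)
  -- Almost every point outside of the listed cells lies in a cell with index not in `M`, and there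
  -- `φ` vanishes.
  · filter_upwards [h.cover] with x hx hxP
    obtain ⟨m, hm⟩ := hx hxP.1
    by_contra hne
    refine hxP.2 (mem_iUnion₂.2 ⟨m, hM m _ hm ?_, hm⟩)
    rw [sub_add_cancel]
    exact right_ne_zero_of_mul hne

theorem exists_finset (h : IsTiling O P τ q) {φ : E → ℂ} (hc : HasCompactSupport φ) :
    ∃ M : Finset ι, ∀ m, ∀ x ∈ O, x + τ m ∈ tsupport φ → m ∈ M := by
  refine ⟨(h.locallyFinite _ hc).toFinset, fun m x hx hx' => ?_⟩
  rw [Set.Finite.mem_toFinset]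
  exact ⟨x + τ m, hx', by simpa using hx⟩

/-- A compact set meets finitely many cells, and on each of them the extension is a translate of
`f`. -/
theorem memL2loc_fold (h : IsTiling O P τ q) {f : E → ℂ} (hf : MemLp f 2 (volume.restrict O)) :
    MemL2loc P (f ∘ q) := by
  intro K hK hKP
  let M := (h.locallyFinite K hK).toFinset
  have h1 : ∀ m, MemLp (f ∘ q) 2 (volume.restrict (cell O τ m)) := fun m => by
    have h2 : MemLp ((f ∘ q) ∘ fun x => x + τ m) 2 (volume.restrict O) := by
      refine (memLp_congr_ae ?_).1 hf
      filter_upwards [ae_restrict_mem h.isOpen_cell.measurableSet] with x hx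
      simp [h.fold_add m x hx]
    rw [← (measurePreserving_cell (O := O) (τ := τ) m).map_eq]
    exact ((measurableEmbedding_addRight (τ m)).memLp_map_measure_iff).2 h2
  have h3 : AEStronglyMeasurable (f ∘ q) (volume.restrict (⋃ m : M, cell O τ m)) :=
    aestronglyMeasurable_iUnion_iff.2 fun m => (h1 m).1
  have h4 : MemLp (f ∘ q) 2 (volume.restrict (⋃ m : M, cell O τ m)) := by
    rw [memLp_two_iff_integrable_sq_norm h3]
    exact integrableOn_finite_iUnion.2 fun m =>
      (memLp_two_iff_integrable_sq_norm (h1 m).1).1 (h1 m)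
  refine h4.mono_measure (Measure.restrict_mono' ?_ le_rfl)
  filter_upwards [h.cover] with x hx hxK
  obtain ⟨m, hm⟩ := hx (hKP hxK)
  exact mem_iUnion.2 ⟨⟨m, (Set.Finite.mem_toFinset _).2 ⟨x, hxK, hm⟩⟩, hm⟩

/-- The weak derivative of a periodic extension is the periodic extension of the weak derivative. -/
theorem isWeakDeriv_fold (h : IsTiling O P τ q) {v : E} {u g : E → ℂ}
    (hg : MemLp g 2 (volume.restrict O)) (hu : MemH1loc P (u ∘ q)) (hd : IsWeakDeriv O v u g) :
    IsWeakDeriv P v (u ∘ q) (g ∘ q) := by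
  obtain ⟨G, hG, hdG⟩ := hu.2 v
  have hcont : ∀ m, Continuous fun x => x + τ m := fun m => continuous_id.add continuous_const
  -- The assumption that `u ∘ q` is in `H¹_loc` excludes jumps across the seams between cells. It
  -- provides some derivative `G` on all of `P`, and uniqueness inside each cell identifies `G` with
  -- the extension of `g`.
  have h1 : ∀ m, g =ᵐ[volume.restrict O] fun x => G (x + τ m) := by
    intro m
    have hloc : MemL2loc O fun x => G (x + τ m) := by
      intro K hK hKO
      have hK' := hG _ (hK.image (hcont m)) (by
        rintro _ ⟨x, hx, rfl⟩
        exact h.add_mem m x (hKO hx))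
      have hmp := (measurePreserving_add_right (volume : Measure E) (τ m)).restrict_preimage_emb
        (measurableEmbedding_addRight (τ m)) ((fun x => x + τ m) '' K)
      rw [preimage_image_eq _ (add_left_injective (τ m))] at hmp
      exact hK'.comp_measurePreserving hmp
    refine IsWeakDeriv.ae_eq h.isOpen_cell hg.locallyIntegrableOn_two
      (hloc.locallyIntegrableOn h.isOpen_cell) hd ?_
    intro φ hφ hc hs
    have hψ : ContDiff ℝ ∞ fun x => φ (x - τ m) := hφ.comp (contDiff_id.sub contDiff_const)
    have hψc : HasCompactSupport fun x => φ (x - τ m) := by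
      have := hc.comp_homeomorph (Homeomorph.subRight (τ m))
      exact this
    have hψs : tsupport (fun x => φ (x - τ m)) ⊆ cell O τ m := by
      have : tsupport (fun x => φ (x - τ m)) ⊆ (fun x => x - τ m) ⁻¹' tsupport φ :=
        tsupport_comp_subset_preimage φ (f := fun x => x - τ m)
          (continuous_id.sub continuous_const)
      exact this.trans fun x hx => hs hx
    have hψs' := hψs.trans (h.cell_subset m)
    have key := hdG _ hψ hψc hψs'
    rw [setIntegral_mul_of_tsupport_subset _ hψs',
      setIntegral_mul_of_tsupport_subset _ ((tsupport_fderiv_apply_subset' _ v).trans hψs'),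
      ← setIntegral_mul_of_tsupport_subset _ hψs,
      ← setIntegral_mul_of_tsupport_subset _ ((tsupport_fderiv_apply_subset' _ v).trans hψs),
      setIntegral_cell, setIntegral_cell] at key
    have hfd : ∀ x, fderiv ℝ (fun x => φ (x - τ m)) (x + τ m) v = fderiv ℝ φ x v := fun x => by
      rw [fderiv_comp_sub, add_sub_cancel_right]
    simp only [hfd, add_sub_cancel_right, Function.comp_apply] at key
    rw [← key]
    refine setIntegral_congr_fun h.isOpen_cell.measurableSet fun x hx => ?_
    simp only [h.fold_add m x hx]
  refine hdG.congr (.of_forall fun _ => rfl) ?_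
  have h2 : ∀ m, ∀ᵐ x : E, x - τ m ∈ O → g (x - τ m) = G (x - τ m + τ m) := fun m =>
    (measurePreserving_sub_right (volume : Measure E) (τ m)).quasiMeasurePreserving.tendsto_ae
      ((ae_restrict_iff' h.isOpen_cell.measurableSet).1 (h1 m))
  rw [Filter.EventuallyEq, ae_restrict_iff' h.isOpen.measurableSet]
  filter_upwards [ae_all_iff.2 h2, h.cover] with x hx hxc hxP
  obtain ⟨m, hm⟩ := hxc hxP
  rw [Function.comp_apply, h.fold_eq_of_mem_cell hm, hx m hm, sub_add_cancel]

theorem isWeakDeriv_of_fold (h : IsTiling O P τ q) {v : E} {u g : E → ℂ}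
    (hd : IsWeakDeriv P v (u ∘ q) (g ∘ q)) : IsWeakDeriv O v u g := by
  refine (hd.mono h.cell_subset').congr ?_ ?_ <;>
  · filter_upwards [ae_restrict_mem h.isOpen_cell.measurableSet] with x hx
    rw [Function.comp_apply, h.fold_eq hx]

/-- A periodic function `Φ` may be used as a test function, if it is the periodization of a test
function `φ`. -/
theorem setIntegral_periodic (h : IsTiling O P τ q) {v : E} {u g : E → ℂ} (hu : IntegrableOn u O)
    (hg : IntegrableOn g O) (hd : IsWeakDeriv P v (u ∘ q) (g ∘ q)) {φ Φ : E → ℂ}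
    (hφ : ContDiff ℝ ∞ φ) (hc : HasCompactSupport φ) (hs : tsupport φ ⊆ P) (M : Finset ι)
    (hM : ∀ m, ∀ x ∈ O, x + τ m ∈ tsupport φ → m ∈ M)
    (hΦ : ∀ x ∈ O, ∑ m ∈ M, φ (x + τ m) = Φ x) :
    ∫ x in O, u x * fderiv ℝ Φ x v = - ∫ x in O, g x * Φ x := by
  have key := hd φ hφ hc hs
  simp only [Function.comp_apply] at key
  have hc' := hasCompactSupport_fderiv_apply hc v
  have hφ' := continuous_fderiv_apply_const hφ v
  rw [h.setIntegral_fold hu hφ' hc' M fun m x hx hne => hM m x hx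
      (tsupport_fderiv_apply_subset' φ v (subset_tsupport _ hne)),
    h.setIntegral_fold hg hφ.continuous hc M fun m x hx hne => hM m x hx
      (subset_tsupport _ hne)] at key
  have hi : ∀ {f ψ : E → ℂ}, IntegrableOn f O → Continuous ψ → HasCompactSupport ψ → ∀ m,
      IntegrableOn (fun x => f x * ψ (x + τ m)) O := fun hf hψ hψc m => by
    obtain ⟨C, hC⟩ := hψc.exists_bound_of_continuous hψ
    exact hf.mul_bdd (c := C)
      (hψ.comp (continuous_id.add continuous_const)).aestronglyMeasurable (.of_forall fun x => hC _)
  rw [← integral_finsetSum _ fun m _ => hi hu hφ' hc' m,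
    ← integral_finsetSum _ fun m _ => hi hg hφ.continuous hc m] at key
  simp only [← Finset.mul_sum] at key
  have e1 : ∫ x in O, u x * fderiv ℝ Φ x v =
      ∫ x in O, u x * ∑ m ∈ M, fderiv ℝ φ (x + τ m) v := by
    refine setIntegral_congr_fun h.isOpen_cell.measurableSet fun x hx => ?_
    have : Φ =ᶠ[nhds x] fun y => ∑ m ∈ M, φ (y + τ m) := by
      filter_upwards [h.isOpen_cell.mem_nhds hx] with y hy using (hΦ y hy).symm
    have hsum : fderiv ℝ (fun y => ∑ m ∈ M, φ (y + τ m)) x =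
        ∑ m ∈ M, fderiv ℝ φ (x + τ m) := by
      rw [fderiv_fun_sum (A := fun m y => φ (y + τ m)) fun m _ =>
        ((hφ.differentiable (by simp)).comp (differentiable_id.add_const (τ m))) x]
      exact Finset.sum_congr rfl fun m _ => fderiv_comp_add_right (τ m)
    rw [this.fderiv_eq, hsum, sum_apply]
  have e2 : ∫ x in O, g x * Φ x = ∫ x in O, g x * ∑ m ∈ M, φ (x + τ m) :=
    setIntegral_congr_fun h.isOpen_cell.measurableSet fun x hx => by simp only [hΦ x hx]
  rw [e1, e2, key]

end IsTiling

end Tiling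

/-! ### Continuity of integrals with respect to functions in `L²` -/

section Continuity

variable {X : Type*} [MeasurableSpace X] {ν : Measure X}

/-- The linear functional `f ↦ ∫ f χ` on `L²`. -/
theorem exists_clm_integral_mul {χ : X → ℂ} (hχ : MemLp χ 2 ν) :
    ∃ Λ : Lp ℂ 2 ν →L[ℂ] ℂ, ∀ f, Λ f = ∫ x, f x * χ x ∂ν := by
  have hχ' : MemLp (fun x => (starRingEnd ℂ) (χ x)) 2 ν := hχ.star
  refine ⟨innerSL ℂ hχ'.toLp, fun f => ?_⟩
  rw [innerSL_apply_apply, L2.inner_def]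
  refine integral_congr_ae ?_
  filter_upwards [hχ'.coeFn_toLp] with x hx
  rw [hx]
  simp

end Continuity

section Tiling

open scoped ContDiff

variable {E : Type*} [NormedAddCommGroup E] [NormedSpace ℝ E] [FiniteDimensional ℝ E]
  [MeasureSpace E] [BorelSpace E] [(volume : Measure E).IsAddHaarMeasure] {ι : Type*} [Countable ι]
  {O P : Set E} {τ : ι → E} {q : E → E}

/-- Unfolding leaves finitely many pairings over `O` with translates of `φ`, and these are bounded
on a set of finite measure. Each test function thus imposes a continuous linear condition on
`L²(O)`, so the conditions for weak derivatives define closed subspaces. -/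
theorem IsTiling.exists_clm (h : IsTiling O P τ q) [IsFiniteMeasure (volume.restrict O)]
    {φ : E → ℂ} (hφ : Continuous φ) (hc : HasCompactSupport φ) :
    ∃ Λ : Lp ℂ 2 (volume.restrict O) →L[ℂ] ℂ, ∀ f, Λ f = ∫ x in P, f (q x) * φ x := by
  obtain ⟨M, hM⟩ := h.exists_finset hc
  obtain ⟨C, hC⟩ := hc.exists_bound_of_continuous hφ
  have h1 : ∀ m, MemLp (fun x => φ (x + τ m)) 2 (volume.restrict O) := fun m =>
    MemLp.of_bound (hφ.comp (continuous_id.add continuous_const)).aestronglyMeasurable C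
      (.of_forall fun x => hC _)
  choose Λ hΛ using fun m => exists_clm_integral_mul (h1 m)
  refine ⟨∑ m ∈ M, Λ m, fun f => ?_⟩
  rw [sum_apply, h.setIntegral_fold ((Lp.memLp f).integrable (by norm_num)) hφ hc M
    fun m x hx hne => hM m x hx (subset_tsupport _ hne)]
  exact Finset.sum_congr rfl fun m _ => hΛ m f

/-- The pairs `(u, g)` in `L²(O)²` for which the periodic extension of `g` is the weak derivative of
the periodic extension of `u` form a closed subspace. -/
theorem IsTiling.exists_submodule (h : IsTiling O P τ q) [IsFiniteMeasure (volume.restrict O)]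
    (v : E) : ∃ S : Submodule ℂ (Lp ℂ 2 (volume.restrict O) × Lp ℂ 2 (volume.restrict O)),
      IsClosed (S : Set (Lp ℂ 2 (volume.restrict O) × Lp ℂ 2 (volume.restrict O))) ∧
      ∀ p, p ∈ S ↔ IsWeakDeriv P v (p.1 ∘ q) (p.2 ∘ q) := by
  let T := {φ : E → ℂ // ContDiff ℝ ∞ φ ∧ HasCompactSupport φ ∧ tsupport φ ⊆ P}
  choose Λ hΛ using fun φ : T => h.exists_clm φ.2.1.continuous φ.2.2.1
  choose Λ' hΛ' using fun φ : T => h.exists_clm (continuous_fderiv_apply_const φ.2.1 v)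
    (hasCompactSupport_fderiv_apply φ.2.2.1 v)
  refine ⟨⨅ φ : T, ((Λ' φ).coprod (Λ φ)).ker, ?_, fun p => ?_⟩
  · rw [Submodule.coe_iInf]
    exact isClosed_iInter fun φ => ((Λ' φ).coprod (Λ φ)).isClosed_ker
  · simp only [Submodule.mem_iInf, LinearMap.mem_ker, ContinuousLinearMap.coe_coe,
      ContinuousLinearMap.coprod_apply, hΛ, hΛ', IsWeakDeriv, Function.comp_apply,
      eq_neg_iff_add_eq_zero]
    exact ⟨fun H φ h1 h2 h3 => H ⟨φ, h1, h2, h3⟩, fun H φ => H φ.1 φ.2.1 φ.2.2.1 φ.2.2.2⟩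

end Tiling

/-! ### Complete orthogonal systems of bounded functions -/

section OrthogonalSystems

open scoped ContDiff ComplexConjugate

/-- An orthogonal system of bounded functions that separates integrable functions. -/
structure IsOrthogonalSystem {X ι : Type*} [MeasurableSpace X] (μ : Measure X) (p : ι → X → ℂ) :
    Prop where
  measurable : ∀ i, Measurable (p i)
  norm_le : ∀ i x, ‖p i x‖ ≤ 1
  orthogonal : ∀ i j, i ≠ j → ∫ x, conj (p i x) * p j x ∂μ = 0
  ne_zero : ∀ i, ∫ x, conj (p i x) * p i x ∂μ ≠ 0
  separating : ∀ f : X → ℂ, Integrable f μ → (∀ i, ∫ x, conj (p i x) * f x ∂μ = 0) → f =ᵐ[μ] 0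

variable {X Y ι κ : Type*} [MeasurableSpace X] [MeasurableSpace Y] {μ : Measure X} {ν : Measure Y}
  {p : ι → X → ℂ} {q : κ → Y → ℂ}

theorem IsOrthogonalSystem.integrable_mul (hp : IsOrthogonalSystem μ p) {f : X → ℂ}
    (hf : Integrable f μ) (i : ι) : Integrable (fun x => conj (p i x) * f x) μ :=
  hf.bdd_mul (c := 1) (Complex.continuous_conj.measurable.comp (hp.measurable i)).aestronglyMeasurable
    (.of_forall fun x => by simpa using hp.norm_le i x)

theorem ae_prod_eq_zero [SFinite μ] [SFinite ν] {f : X × Y → ℂ} (hf : Integrable f (μ.prod ν))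
    (h : ∀ᵐ x ∂μ, (fun y => f (x, y)) =ᵐ[ν] 0) : f =ᵐ[μ.prod ν] 0 := by
  have h1 : ∫ z, ‖f z‖ ∂μ.prod ν = 0 := by
    rw [integral_prod _ hf.norm]
    refine integral_eq_zero_of_ae ?_
    filter_upwards [h] with x hx
    refine integral_eq_zero_of_ae ?_
    filter_upwards [hx] with y hy
    simp [hy]
  rw [integral_eq_zero_iff_of_nonneg (fun z => norm_nonneg _) hf.norm] at h1
  filter_upwards [h1] with z hz
  simpa using hz

theorem IsOrthogonalSystem.ae_separating [SFinite μ] [SFinite ν] [Countable κ]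
    (hq : IsOrthogonalSystem ν q) {f : X × Y → ℂ} (hf : Integrable f (μ.prod ν))
    (h : ∀ j, ∀ᵐ x ∂μ, ∫ y, conj (q j y) * f (x, y) ∂ν = 0) : f =ᵐ[μ.prod ν] 0 := by
  refine ae_prod_eq_zero hf ?_
  filter_upwards [ae_all_iff.2 h, hf.prod_right_ae] with x hx hfx
  exact hq.separating _ hfx hx

/-- Completeness is used one variable at a time: first in `x` for the function `x ↦ ∫ conj (q j)
f(x, ·)`, then in `y` for almost every `x`. The intermediate function is merely integrable, which is
why `separating` is stated for integrable functions; countability of `κ` unites the exceptional null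
sets. -/
theorem IsOrthogonalSystem.prod [SFinite μ] [SFinite ν] [Countable κ]
    (hp : IsOrthogonalSystem μ p) (hq : IsOrthogonalSystem ν q) :
    IsOrthogonalSystem (μ.prod ν) (fun (i : ι × κ) x => p i.1 x.1 * q i.2 x.2) where
  measurable i := ((hp.measurable i.1).comp measurable_fst).mul
    ((hq.measurable i.2).comp measurable_snd)
  norm_le i x := by
    rw [norm_mul]
    exact mul_le_one₀ (hp.norm_le _ _) (norm_nonneg _) (hq.norm_le _ _)
  orthogonal i j hij := by
    simp only [map_mul, mul_mul_mul_comm]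
    rw [integral_prod_mul (fun x => conj (p i.1 x) * p j.1 x) (fun y => conj (q i.2 y) * q j.2 y)]
    by_cases h : i.1 = j.1
    · rw [hq.orthogonal i.2 j.2 fun h' => hij (Prod.ext h h'), mul_zero]
    · rw [hp.orthogonal _ _ h, zero_mul]
  ne_zero i := by
    simp only [map_mul, mul_mul_mul_comm]
    rw [integral_prod_mul (fun x => conj (p i.1 x) * p i.1 x) (fun y => conj (q i.2 y) * q i.2 y)]
    exact mul_ne_zero (hp.ne_zero _) (hq.ne_zero _)
  separating f hf h := by
    refine hq.ae_separating hf fun j => ?_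
    have hj : Integrable (fun z : X × Y => conj (q j z.2) * f z) (μ.prod ν) :=
      hf.bdd_mul (c := 1) (Complex.continuous_conj.measurable.comp
        ((hq.measurable j).comp measurable_snd)).aestronglyMeasurable
        (.of_forall fun x => by simpa using hq.norm_le j x.2)
    refine hp.separating _ hj.integral_prod_left fun i => ?_
    rw [← h (i, j), integral_prod]
    · refine integral_congr_ae (.of_forall fun x => ?_)
      simp only [map_mul, mul_assoc, integral_const_mul]
    · simp only [map_mul, mul_assoc]
      exact hj.bdd_mul (c := 1) (Complex.continuous_conj.measurable.comp
        ((hp.measurable i).comp measurable_fst)).aestronglyMeasurable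
        (.of_forall fun x => by simpa using hp.norm_le i x.1)

/-- Two systems on adjacent intervals yield a system on the union. -/
theorem IsOrthogonalSystem.union {a b c : ℝ} (hab : a < b) (hbc : b < c)
    {p : ι → ℝ → ℂ} {q : κ → ℝ → ℂ}
    (hp : IsOrthogonalSystem (volume.restrict (Ioo a b)) p)
    (hq : IsOrthogonalSystem (volume.restrict (Ioo b c)) q) :
    IsOrthogonalSystem (volume.restrict (Ioo a c))
      (Sum.elim (fun i => (Ioo a b).indicator (p i)) (fun i => (Ioo b c).indicator (q i))) := by
  have hi : ∀ {s : Set ℝ} (F G : ℝ → ℂ), s ⊆ Ioo a c → MeasurableSet s →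
      ∫ x in Ioo a c, conj (s.indicator F x) * G x = ∫ x in s, conj (F x) * G x := by
    intro s F G hs hsm
    rw [← Set.inter_eq_self_of_subset_right hs, ← setIntegral_indicator hsm,
      Set.inter_eq_self_of_subset_right hs]
    refine integral_congr_ae (.of_forall fun x => ?_)
    by_cases hx : x ∈ s <;> simp [hx]
  have hs1 : Ioo a b ⊆ Ioo a c := Ioo_subset_Ioo_right hbc.le
  have hs2 : Ioo b c ⊆ Ioo a c := Ioo_subset_Ioo_left hab.le
  have hc : ∀ {s : Set ℝ} (F G : ℝ → ℂ), MeasurableSet s →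
      ∫ x in s, conj (F x) * s.indicator G x = ∫ x in s, conj (F x) * G x := fun F G hsm =>
    setIntegral_congr_fun hsm fun x hx => by simp [hx]
  have hz : ∀ {s t : Set ℝ} (F G : ℝ → ℂ), MeasurableSet s → Disjoint s t →
      ∫ x in s, conj (F x) * t.indicator G x = 0 := fun F G hsm hst =>
    setIntegral_eq_zero_of_forall_eq_zero fun x hx => by simp [Set.disjoint_left.1 hst hx]
  have hd : Disjoint (Ioo a b) (Ioo b c) :=
    Set.disjoint_left.2 fun x hx hx' => lt_asymm hx.2 hx'.1
  constructor
  · rintro (i | i)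
    · exact (hp.measurable i).indicator measurableSet_Ioo
    · exact (hq.measurable i).indicator measurableSet_Ioo
  · rintro (i | i) x
    · exact (norm_indicator_le_norm_self _ _).trans (hp.norm_le i x)
    · exact (norm_indicator_le_norm_self _ _).trans (hq.norm_le i x)
  · rintro (i | i) (j | j) hij <;> simp only [Sum.elim_inl, Sum.elim_inr]
    · rw [hi _ _ hs1 measurableSet_Ioo, hc _ _ measurableSet_Ioo]
      exact hp.orthogonal i j fun h => hij (by rw [h])
    · rw [hi _ _ hs1 measurableSet_Ioo, hz _ _ measurableSet_Ioo hd]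
    · rw [hi _ _ hs2 measurableSet_Ioo, hz _ _ measurableSet_Ioo hd.symm]
    · rw [hi _ _ hs2 measurableSet_Ioo, hc _ _ measurableSet_Ioo]
      exact hq.orthogonal i j fun h => hij (by rw [h])
  · rintro (i | i) <;> simp only [Sum.elim_inl, Sum.elim_inr]
    · rw [hi _ _ hs1 measurableSet_Ioo, hc _ _ measurableSet_Ioo]
      exact hp.ne_zero i
    · rw [hi _ _ hs2 measurableSet_Ioo, hc _ _ measurableSet_Ioo]
      exact hq.ne_zero i
  · intro f hf h
    have h1 := hp.separating f (IntegrableOn.mono_set hf hs1) fun i => by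
      rw [← h (Sum.inl i), Sum.elim_inl, hi _ _ hs1 measurableSet_Ioo]
    have h2 := hq.separating f (IntegrableOn.mono_set hf hs2) fun i => by
      rw [← h (Sum.inr i), Sum.elim_inr, hi _ _ hs2 measurableSet_Ioo]
    rw [Filter.EventuallyEq, ae_restrict_iff' measurableSet_Ioo] at h1 h2 ⊢
    have h3 : ∀ᵐ x : ℝ, x ≠ b := Measure.ae_ne volume b
    filter_upwards [h1, h2, h3] with x hx1 hx2 hx3 hx
    rcases lt_or_gt_of_ne hx3 with h | h
    · exact hx1 ⟨hx.1, h⟩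
    · exact hx2 ⟨h, hx.2⟩

/-- Injectivity of the Fourier transform on an interval, in a form that covers Fourier series as
well as cosine and sine series. -/
theorem ae_eq_zero_of_fourier {a b T : ℝ} [hT : Fact (0 < T)] (hab : a < b) {c : ℂ}
    (hc : T = b - a ∧ c = 0 ∨ T = 2 * (b - a)) {f : ℝ → ℂ} (hf : IntegrableOn f (Ioo a b))
    (h : ∀ n : ℤ, ∫ x in Ioo a b, f x * (fourier n ((x - a : ℝ) : AddCircle T) +
      c * fourier n ((a - x : ℝ) : AddCircle T)) = 0) :
    f =ᵐ[volume.restrict (Ioo a b)] 0 := by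
  have hTpos : 0 < T := hT.out
  have hcm1 : Continuous fun x : ℝ => ((x - a : ℝ) : AddCircle T) :=
    (AddCircle.continuous_mk' T).comp (continuous_id.sub continuous_const)
  have hcm2 : Continuous fun x : ℝ => ((a - x : ℝ) : AddCircle T) :=
    (AddCircle.continuous_mk' T).comp (continuous_const.sub continuous_id)
  have hcont : ∀ Φ : C(AddCircle T, ℂ), Continuous fun x : ℝ =>
      Φ ((x - a : ℝ) : AddCircle T) + c * Φ ((a - x : ℝ) : AddCircle T) := fun Φ =>
    (Φ.continuous.comp hcm1).add (continuous_const.mul (Φ.continuous.comp hcm2))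
  have hbound : ∀ (Φ : C(AddCircle T, ℂ)) (x : ℝ),
      ‖Φ ((x - a : ℝ) : AddCircle T) + c * Φ ((a - x : ℝ) : AddCircle T)‖ ≤ (1 + ‖c‖) * ‖Φ‖ := by
    intro Φ x
    refine (norm_add_le _ _).trans ?_
    rw [norm_mul, add_mul, one_mul]
    exact add_le_add (Φ.norm_coe_le_norm _)
      (mul_le_mul_of_nonneg_left (Φ.norm_coe_le_norm _) (norm_nonneg c))
  have hint : ∀ Φ : C(AddCircle T, ℂ), IntegrableOn (fun x : ℝ =>
      f x * (Φ ((x - a : ℝ) : AddCircle T) + c * Φ ((a - x : ℝ) : AddCircle T))) (Ioo a b) :=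
    fun Φ => hf.mul_bdd (hcont Φ).aestronglyMeasurable (.of_forall (hbound Φ))
  -- A bounded functional on the continuous functions of the circle. It vanishes on the dense span
  -- of the Fourier monomials, hence everywhere. The reflected term is absent for Fourier series (`c
  -- = 0`), and `c = 1`, `c = -1` produce cosines and sines.
  let Λ₀ : C(AddCircle T, ℂ) →ₗ[ℂ] ℂ :=
    { toFun := fun Φ => ∫ x in Ioo a b, f x * (Φ ((x - a : ℝ) : AddCircle T) +
        c * Φ ((a - x : ℝ) : AddCircle T))
      map_add' := fun Φ Ψ => by
        rw [← integral_add (hint Φ) (hint Ψ)]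
        refine integral_congr_ae (.of_forall fun x => ?_)
        simp only [ContinuousMap.add_apply]
        ring
      map_smul' := fun r Φ => by
        rw [RingHom.id_apply, smul_eq_mul, ← integral_const_mul]
        refine integral_congr_ae (.of_forall fun x => ?_)
        simp only [ContinuousMap.smul_apply, smul_eq_mul]
        ring }
  let Λ : C(AddCircle T, ℂ) →L[ℂ] ℂ := Λ₀.mkContinuous
    (∫ x in Ioo a b, ‖f x‖ * (1 + ‖c‖)) fun Φ => by
      rw [← integral_mul_const]
      refine norm_integral_le_of_norm_le ((hf.norm.mul_const _).mul_const _) (.of_forall fun x => ?_)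
      rw [norm_mul, mul_assoc]
      exact mul_le_mul_of_nonneg_left (hbound Φ x) (norm_nonneg _)
  have hΛ : ∀ Φ, Λ Φ = 0 := by
    have h1 : (Submodule.span ℂ (Set.range (@fourier T))).topologicalClosure ≤ Λ.ker := by
      refine Submodule.topologicalClosure_minimal _ (Submodule.span_le.2 ?_) Λ.isClosed_ker
      rintro _ ⟨n, rfl⟩
      exact h n
    intro Φ
    rw [span_fourier_closure_eq_top] at h1
    exact h1 (Submodule.mem_top (x := Φ))
  have hz := isOpen_Ioo.ae_eq_zero_of_integral_contDiff_smul_eq_zero (μ := volume) (f := f)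
    (U := Ioo a b) hf.locallyIntegrableOn (by
      intro g hg hgc hgs
      have hg0 : ∀ x, x ∉ Ioo a b → g x = 0 := fun x hx =>
        image_eq_zero_of_notMem_tsupport fun h => hx (hgs h)
      -- The test function `g`, shifted by `a` and placed on the circle with fundamental interval
      -- `[b - a - T, b - a)`. For `T = 2(b - a)` the reflected argument falls into the negative
      -- half, where the shifted `g` is zero, so the functional reduces to `∫ f g`.
      let G : C(AddCircle T, ℂ) := ⟨AddCircle.liftIco T (b - a - T) fun t => (g (a + t) : ℂ), by
        refine AddCircle.liftIco_continuous ?_ ?_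
        · rw [hg0 _ fun h => ?_, hg0 _ fun h => ?_]
          · linarith [h.2]
          · rcases hc with hc | hc <;> linarith [h.1]
        · exact (Complex.continuous_ofReal.comp
            (hg.continuous.comp (continuous_const.add continuous_id))).continuousOn⟩
      have hG : ∀ y, G y = AddCircle.liftIco T (b - a - T) (fun t => (g (a + t) : ℂ)) y :=
        fun _ => rfl
      have := hΛ G
      rw [← setIntegral_eq_integral_of_forall_compl_eq_zero (s := Ioo a b)
        fun x hx => by rw [hg0 x hx, zero_smul], ← this]
      refine setIntegral_congr_fun measurableSet_Ioo fun x hx => ?_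
      have e1 : G ((x - a : ℝ) : AddCircle T) = g x := by
        rw [hG, AddCircle.liftIco_coe_apply, add_sub_cancel]
        constructor
        · rcases hc with hc | hc <;> linarith [hx.1, hx.2]
        · linarith [hx.2]
      have e2 : c * G ((a - x : ℝ) : AddCircle T) = 0 := by
        rcases hc with hc | hc
        · rw [hc.2, zero_mul]
        · rw [hG, AddCircle.liftIco_coe_apply, hg0, Complex.ofReal_zero, mul_zero]
          · intro h
            linarith [h.1, hx.1]
          · constructor <;> linarith [hx.1, hx.2]
      rw [e1, e2, add_zero, Complex.real_smul, mul_comm])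
  rwa [Filter.EventuallyEq, ae_restrict_iff' measurableSet_Ioo]

end OrthogonalSystems

/-! ### Trigonometric systems on intervals -/

section Trigonometric

open scoped ContDiff ComplexConjugate

/-- The exponential `x ↦ e^{iαx}`. -/
def ex (α x : ℝ) : ℂ := Complex.exp (α * x * Complex.I)

theorem ex_add (α x y : ℝ) : ex α (x + y) = ex α x * ex α y := by
  rw [ex, ex, ex, ← Complex.exp_add]
  push_cast
  ring_nf

theorem conj_ex (α x : ℝ) : conj (ex α x) = ex (-α) x := by
  rw [ex, ex, ← Complex.exp_conj]
  simp

theorem norm_ex (α x : ℝ) : ‖ex α x‖ = 1 := by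
  rw [ex, ← Complex.ofReal_mul, Complex.norm_exp_ofReal_mul_I]

theorem contDiff_ex (α : ℝ) {n : WithTop ℕ∞} : ContDiff ℝ n (ex α) := by
  unfold ex
  exact ((contDiff_const.mul Complex.ofRealCLM.contDiff).mul contDiff_const).cexp

theorem hasDerivAt_ex (α x : ℝ) : HasDerivAt (ex α) (α * Complex.I * ex α x) x := by
  have h : HasDerivAt (fun x : ℝ => (α : ℂ) * x * Complex.I) (α * 1 * Complex.I) x :=
    (((hasDerivAt_id x).ofReal_comp).const_mul (α : ℂ)).mul_const Complex.I
  have h' := h.cexp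
  rw [mul_one, mul_comm] at h'
  exact h'

theorem ex_mul_int_period {l : ℝ} (hl : 0 < l) (k n : ℤ) : ex (2 * Real.pi * k / l) (n * l) = 1 := by
  rw [ex, Complex.exp_eq_one_iff]
  refine ⟨k * n, ?_⟩
  have : (l : ℂ) ≠ 0 := by exact_mod_cast hl.ne'
  push_cast
  field_simp

theorem conj_ex_mul_ex (α β x : ℝ) : conj (ex α x) * ex β x = ex (β - α) x := by
  rw [conj_ex, ex, ex, ex, ← Complex.exp_add]
  push_cast
  ring_nf

theorem isOrthogonalSystem_ex {l : ℝ} (hl : 0 < l) :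
    IsOrthogonalSystem (volume.restrict (Ioo 0 l)) (fun k : ℤ => ex (2 * Real.pi * k / l)) where
  measurable k := (contDiff_ex _ (n := 0)).continuous.measurable
  norm_le k x := (norm_ex _ x).le
  orthogonal k n hkn := by
    simp only [conj_ex_mul_ex]
    rw [← integral_Ioc_eq_integral_Ioo, ← intervalIntegral.integral_of_le hl.le]
    have hne : (2 * Real.pi * n / l - 2 * Real.pi * k / l : ℝ) ≠ 0 := by
      rw [← sub_div, ← mul_sub]
      have : ((n : ℝ) - k) ≠ 0 := sub_ne_zero.2 (by exact_mod_cast hkn.symm)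
      positivity
    have h1 : ∀ x : ℝ, ex (2 * Real.pi * n / l - 2 * Real.pi * k / l) x = Complex.exp
        (((2 * Real.pi * n / l - 2 * Real.pi * k / l : ℝ) * Complex.I) * x) := fun x => by
      rw [ex]
      ring_nf
    have h2 := ex_mul_int_period hl (n - k) 1
    rw [show 2 * Real.pi * ((n - k : ℤ) : ℝ) / l = 2 * Real.pi * n / l - 2 * Real.pi * k / l by
      push_cast; ring, h1] at h2
    simp only [Int.cast_one, one_mul] at h2
    simp only [h1]
    rw [integral_exp_mul_complex (mul_ne_zero (by exact_mod_cast hne) Complex.I_ne_zero), h2]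
    simp
  ne_zero k := by
    simp only [conj_ex_mul_ex, sub_self]
    have : ∀ x, ex 0 x = 1 := fun x => by simp [ex]
    simp [this, hl.le, hl.ne']
  separating f hf h := by
    have : Fact (0 < l) := ⟨hl⟩
    refine ae_eq_zero_of_fourier (T := l) hl (Or.inl ⟨(sub_zero l).symm, rfl⟩) hf fun n => ?_
    refine Eq.trans (integral_congr_ae (.of_forall fun x => ?_)) (h (-n))
    simp only [conj_ex, zero_mul, add_zero, sub_zero, fourier_coe_apply]
    rw [ex]
    rw [mul_comm]
    congr 2
    push_cast
    ring

theorem integral_cos_Ioo {a b : ℝ} (hab : a < b) (m : ℤ) :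
    ∫ x in Ioo a b, Real.cos (Real.pi * m / (b - a) * (x - a)) = if m = 0 then b - a else 0 := by
  rw [← integral_Ioc_eq_integral_Ioo, ← intervalIntegral.integral_of_le hab.le]
  split_ifs with hm
  · simp [hm]
  · have hba : b - a ≠ 0 := sub_ne_zero.2 hab.ne'
    have hc : Real.pi * m / (b - a) ≠ 0 := by
      have : (m : ℝ) ≠ 0 := by exact_mod_cast hm
      positivity
    have e : ∀ x, Real.pi * m / (b - a) * (x - a) =
        Real.pi * m / (b - a) * x - Real.pi * m / (b - a) * a := fun x => by ring
    simp only [e]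
    rw [intervalIntegral.integral_comp_mul_sub (fun y => Real.cos y) hc, integral_cos, ← e, ← e,
      div_mul_cancel₀ _ hba, mul_comm Real.pi, Real.sin_int_mul_pi]
    simp

theorem integrableOn_cos (c a s t : ℝ) :
    IntegrableOn (fun x => Real.cos (c * (x - a))) (Ioo s t) :=
  (Continuous.integrableOn_Icc (by fun_prop)).mono_set Ioo_subset_Icc_self

theorem integral_cos_mul_cos {a b : ℝ} (hab : a < b) (m n : ℤ) :
    ∫ x in Ioo a b, Real.cos (Real.pi * m / (b - a) * (x - a)) *
      Real.cos (Real.pi * n / (b - a) * (x - a)) =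
      ((if m - n = 0 then b - a else 0) + if m + n = 0 then b - a else 0) / 2 := by
  rw [← integral_cos_Ioo hab, ← integral_cos_Ioo hab, ← integral_add (integrableOn_cos _ _ _ _)
    (integrableOn_cos _ _ _ _), ← integral_div]
  refine integral_congr_ae (.of_forall fun x => ?_)
  rw [eq_div_iff two_ne_zero, mul_comm, ← mul_assoc, Real.two_mul_cos_mul_cos]
  push_cast
  ring_nf

theorem integral_sin_mul_sin {a b : ℝ} (hab : a < b) (m n : ℤ) :
    ∫ x in Ioo a b, Real.sin (Real.pi * m / (b - a) * (x - a)) *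
      Real.sin (Real.pi * n / (b - a) * (x - a)) =
      ((if m - n = 0 then b - a else 0) - if m + n = 0 then b - a else 0) / 2 := by
  rw [← integral_cos_Ioo hab, ← integral_cos_Ioo hab, ← integral_sub (integrableOn_cos _ _ _ _)
    (integrableOn_cos _ _ _ _), ← integral_div]
  refine integral_congr_ae (.of_forall fun x => ?_)
  rw [eq_div_iff two_ne_zero, mul_comm, ← mul_assoc, Real.two_mul_sin_mul_sin]
  push_cast
  ring_nf

theorem fourier_two_mul_coe {L : ℝ} (hL : L ≠ 0) (n : ℤ) (x : ℝ) :
    fourier n (x : AddCircle (2 * L)) = Complex.exp ((Real.pi * n / L * x : ℝ) * Complex.I) := by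
  rw [fourier_coe_apply]
  congr 1
  have : (L : ℂ) ≠ 0 := by exact_mod_cast hL
  push_cast
  field_simp

/-- Completeness comes from Fourier series on the doubled interval with `c = 1`: the bracket in
`ae_eq_zero_of_fourier` becomes twice a cosine, and evenness reduces integers to natural numbers. -/
theorem isOrthogonalSystem_cos {a b : ℝ} (hab : a < b) :
    IsOrthogonalSystem (volume.restrict (Ioo a b))
      (fun (k : ℕ) x => (Real.cos (Real.pi * k / (b - a) * (x - a)) : ℂ)) where
  measurable k := Continuous.measurable (by fun_prop)
  norm_le k x := by
    rw [Complex.norm_real]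
    exact Real.abs_cos_le_one _
  orthogonal k n hkn := by
    simp only [Complex.conj_ofReal, ← Complex.ofReal_mul]
    rw [integral_complex_ofReal]
    have := integral_cos_mul_cos hab k n
    rw [if_neg (by omega), if_neg (by omega)] at this
    simp only [Int.cast_natCast] at this
    rw [this]
    simp
  ne_zero k := by
    simp only [Complex.conj_ofReal, ← Complex.ofReal_mul]
    rw [integral_complex_ofReal]
    have := integral_cos_mul_cos hab k k
    rw [if_pos (by omega)] at this
    simp only [Int.cast_natCast] at this
    rw [this]
    have hba : 0 < b - a := sub_pos.2 hab
    have : 0 < (b - a + if (k : ℤ) + k = 0 then b - a else 0) / 2 := by split_ifs <;> positivity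
    exact_mod_cast this.ne'
  separating f hf h := by
    have hba : 0 < b - a := sub_pos.2 hab
    have : Fact (0 < 2 * (b - a)) := ⟨by positivity⟩
    refine ae_eq_zero_of_fourier (T := 2 * (b - a)) hab (c := 1) (Or.inr rfl) hf fun n => ?_
    have h' := h n.natAbs
    refine Eq.trans (integral_congr_ae (.of_forall fun x => ?_))
      ((integral_const_mul (2 : ℂ) _).trans ((congrArg _ h').trans (mul_zero _)))
    simp only [fourier_two_mul_coe hba.ne', Complex.conj_ofReal]
    have e1 : Real.cos (Real.pi * n.natAbs / (b - a) * (x - a)) =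
        Real.cos (Real.pi * n / (b - a) * (x - a)) := by
      have hn := Int.natAbs_eq n
      generalize n.natAbs = m at hn ⊢
      rcases hn with rfl | rfl
      · simp
      · rw [← Real.cos_neg]
        congr 1
        push_cast
        ring
    have e2 : Real.pi * n / (b - a) * (a - x) = -(Real.pi * n / (b - a) * (x - a)) := by ring
    rw [e1, e2, Complex.ofReal_cos, Complex.cos]
    push_cast
    ring

/-- The index is shifted by one, as frequency zero yields the zero function. With `c = -1` the
bracket in `ae_eq_zero_of_fourier` is `2i` times a sine, and oddness reduces negative frequencies to
positive ones. -/
theorem isOrthogonalSystem_sin {a b : ℝ} (hab : a < b) :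
    IsOrthogonalSystem (volume.restrict (Ioo a b))
      (fun (k : ℕ) x => (Real.sin (Real.pi * (k + 1 : ℕ) / (b - a) * (x - a)) : ℂ)) where
  measurable k := Continuous.measurable (by fun_prop)
  norm_le k x := by
    rw [Complex.norm_real]
    exact Real.abs_sin_le_one _
  orthogonal k n hkn := by
    simp only [Complex.conj_ofReal, ← Complex.ofReal_mul]
    rw [integral_complex_ofReal]
    have := integral_sin_mul_sin hab (k + 1 : ℕ) (n + 1 : ℕ)
    rw [if_neg (by omega), if_neg (by omega)] at this
    simp only [Int.cast_natCast] at this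
    rw [this]
    simp
  ne_zero k := by
    simp only [Complex.conj_ofReal, ← Complex.ofReal_mul]
    rw [integral_complex_ofReal]
    have := integral_sin_mul_sin hab (k + 1 : ℕ) (k + 1 : ℕ)
    rw [if_pos (by omega), if_neg (by omega)] at this
    simp only [Int.cast_natCast] at this
    rw [this]
    have hba : 0 < b - a := sub_pos.2 hab
    have : 0 < (b - a - 0) / 2 := by rw [sub_zero]; positivity
    exact_mod_cast this.ne'
  separating f hf h := by
    have hba : 0 < b - a := sub_pos.2 hab
    have : Fact (0 < 2 * (b - a)) := ⟨by positivity⟩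
    refine ae_eq_zero_of_fourier (T := 2 * (b - a)) hab (c := -1) (Or.inr rfl) hf fun n => ?_
    have h1 : ∫ x in Ioo a b, f x * (Real.sin (Real.pi * n / (b - a) * (x - a)) : ℂ) = 0 := by
      rcases lt_trichotomy n 0 with hn | hn | hn
      · obtain ⟨k, rfl⟩ : ∃ k : ℕ, n = -((k + 1 : ℕ) : ℤ) := ⟨(-n).toNat - 1, by omega⟩
        rw [← neg_eq_zero, ← h k, ← integral_neg]
        refine integral_congr_ae (.of_forall fun x => ?_)
        simp only [Complex.conj_ofReal]
        rw [← mul_neg, mul_comm, ← Complex.ofReal_neg, ← Real.sin_neg]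
        congr 3
        push_cast
        ring
      · simp [hn]
      · obtain ⟨k, rfl⟩ : ∃ k : ℕ, n = ((k + 1 : ℕ) : ℤ) := ⟨n.toNat - 1, by omega⟩
        rw [← h k]
        refine integral_congr_ae (.of_forall fun x => ?_)
        simp only [Complex.conj_ofReal]
        rw [mul_comm]
        push_cast
        ring_nf
    refine Eq.trans (integral_congr_ae (.of_forall fun x => ?_))
      ((integral_const_mul (2 * Complex.I) _).trans ((congrArg _ h1).trans (mul_zero _)))
    simp only [fourier_two_mul_coe hba.ne']
    have e2 : Real.pi * n / (b - a) * (a - x) = -(Real.pi * n / (b - a) * (x - a)) := by ring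
    rw [e2, Complex.ofReal_sin, Complex.sin]
    have : Complex.I * Complex.I = -1 := Complex.I_mul_I
    push_cast
    linear_combination (-f x * (Complex.exp (-(Real.pi * n / (b - a) * (x - a)) * Complex.I) -
      Complex.exp ((Real.pi * n / (b - a) * (x - a)) * Complex.I))) * this

end Trigonometric

/-! ### Approximation by test functions on an interval -/

section Cutoff

open scoped ContDiff
open Filter Topology

/-- The complex valued function that equals `S` in `(a, b)` and is zero elsewhere. -/
def cut (a b : ℝ) (S : ℝ → ℝ) (x : ℝ) : ℂ := ((Ioo a b).indicator S x : ℝ)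

theorem cut_of_mem {a b x : ℝ} (hx : x ∈ Ioo a b) (S : ℝ → ℝ) : cut a b S x = S x := by
  rw [cut, indicator_of_mem hx]

theorem cut_of_notMem {a b x : ℝ} (hx : x ∉ Ioo a b) (S : ℝ → ℝ) : cut a b S x = 0 := by
  rw [cut, indicator_of_notMem hx, Complex.ofReal_zero]

theorem norm_cut_le (a b : ℝ) (S : ℝ → ℝ) (x : ℝ) : ‖cut a b S x‖ ≤ |S x| := by
  rw [cut, Complex.norm_real]
  exact norm_indicator_le_norm_self _ _

theorem measurable_cut (a b : ℝ) {S : ℝ → ℝ} (hS : Measurable S) : Measurable (cut a b S) :=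
  Complex.measurable_ofReal.comp (hS.indicator measurableSet_Ioo)

/-- `s` is a bounded almost everywhere limit of test functions on the interval `(a, b)`. -/
def IsTestLimit (a b : ℝ) (s : ℝ → ℂ) : Prop :=
  ∃ f : ℕ → ℝ → ℂ, (∀ n, ContDiff ℝ ∞ (f n)) ∧ (∀ n, HasCompactSupport (f n)) ∧
    (∀ n, tsupport (f n) ⊆ Ioo a b) ∧ (∃ C, ∀ n x, ‖f n x‖ ≤ C) ∧
    ∀ᵐ x, Tendsto (fun n => f n x) atTop (𝓝 (s x))

/-- `s` is a bounded almost everywhere limit of test functions on the interval `(a, b)`, whose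
derivatives are bounded and converge almost everywhere to `s'`. -/
def IsTestLimit₁ (a b : ℝ) (s s' : ℝ → ℂ) : Prop :=
  ∃ f : ℕ → ℝ → ℂ, (∀ n, ContDiff ℝ ∞ (f n)) ∧ (∀ n, HasCompactSupport (f n)) ∧
    (∀ n, tsupport (f n) ⊆ Ioo a b) ∧ (∃ C, ∀ n x, ‖f n x‖ ≤ C ∧ ‖deriv (f n) x‖ ≤ C) ∧
    ∀ᵐ x, Tendsto (fun n => f n x) atTop (𝓝 (s x)) ∧
      Tendsto (fun n => deriv (f n) x) atTop (𝓝 (s' x))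

/-- Truncated functions that vanish near the points `a`, `b` are test functions. -/
theorem truncation_isTest {a b δ : ℝ} (hδ : 0 < δ) {T S F : ℝ → ℝ} (hT : ContDiff ℝ ∞ T)
    (hS : ContDiff ℝ ∞ S) (hF : ContDiff ℝ ∞ F) (ha : T a = 0) (hb : T b = 0)
    (hF0 : ∀ t, |t| < δ → F t = 0) :
    ContDiff ℝ ∞ (cut a b fun x => F (T x) * S x) ∧
    HasCompactSupport (cut a b fun x => F (T x) * S x) ∧
    tsupport (cut a b fun x => F (T x) * S x) ⊆ Ioo a b := by
  -- The truncated function vanishes off `K`. This compact set avoids the endpoints because `T` is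
  -- zero there.
  let K : Set ℝ := Icc a b ∩ {x | δ ≤ |T x|}
  have hK : IsCompact K := isCompact_Icc.inter_right
    (isClosed_le continuous_const (continuous_abs.comp hT.continuous))
  have hKI : K ⊆ Ioo a b := by
    rintro x ⟨hx, hx'⟩
    refine ⟨lt_of_le_of_ne hx.1 ?_, lt_of_le_of_ne hx.2 ?_⟩
    · rintro rfl
      simp only [mem_ofPred_eq, ha, abs_zero] at hx'
      linarith
    · rintro rfl
      simp only [mem_ofPred_eq, hb, abs_zero] at hx'
      linarith
  have h0 : ∀ x, x ∉ K → cut a b (fun x => F (T x) * S x) x = 0 := by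
    intro x hx
    by_cases hxI : x ∈ Ioo a b
    · rw [cut_of_mem hxI, hF0, zero_mul, Complex.ofReal_zero]
      by_contra h
      exact hx ⟨Ioo_subset_Icc_self hxI, not_lt.1 h⟩
    · exact cut_of_notMem hxI _
  refine ⟨?_, HasCompactSupport.intro hK h0, ?_⟩
  · rw [contDiff_iff_contDiffAt]
    intro x
    by_cases hx : x ∈ Ioo a b
    · have h1 : ContDiffAt ℝ ∞ (fun x => ((F (T x) * S x : ℝ) : ℂ)) x :=
        (Complex.ofRealCLM.contDiff.comp ((hF.comp hT).mul hS)).contDiffAt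
      refine h1.congr_of_eventuallyEq ?_
      filter_upwards [isOpen_Ioo.mem_nhds hx] with y hy
      rw [cut_of_mem hy]
    · refine (contDiffAt_const (c := (0 : ℂ))).congr_of_eventuallyEq ?_
      filter_upwards [hK.isClosed.isOpen_compl.mem_nhds fun h => hx (hKI h)] with y hy
      exact h0 y hy
  · refine (closure_minimal (fun x hx => ?_) hK.isClosed).trans hKI
    by_contra h
    exact hx (h0 x h)

/-- `S` is multiplied by a cutoff in terms of `T = (x - a)(b - x)` that is zero for `T ≤ 1/(n+1)`
and one for `T ≥ 2/(n+1)`. The derivatives are not controlled, so `S` need not vanish at the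
endpoints. -/
theorem isTestLimit_indicator {a b : ℝ} {S : ℝ → ℝ} (hS : ContDiff ℝ ∞ S)
    (hS1 : ∀ x, |S x| ≤ 1) :
    IsTestLimit a b (cut a b S) := by
  have key := fun n : ℕ => truncation_isTest (a := a) (b := b) (δ := 1 / (n + 1 : ℝ))
    (by positivity) (T := fun x => (x - a) * (b - x)) (S := S)
    (F := fun t => Real.smoothTransition ((n + 1) * t - 1))
    (by fun_prop) hS (Real.smoothTransition.contDiff.comp (by fun_prop)) (by simp) (by simp)
    (fun t ht => Real.smoothTransition.zero_of_nonpos (by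
      have := (lt_div_iff₀' (by positivity)).1 ((le_abs_self t).trans_lt ht)
      linarith))
  refine ⟨_, fun n => (key n).1, fun n => (key n).2.1, fun n => (key n).2.2, ⟨1, ?_⟩, ?_⟩
  · intro n x
    refine (norm_cut_le _ _ _ _).trans ?_
    rw [abs_mul, abs_of_nonneg (Real.smoothTransition.nonneg _)]
    exact mul_le_one₀ (Real.smoothTransition.le_one _) (abs_nonneg _) (hS1 x)
  · refine .of_forall fun x => ?_
    by_cases hx : x ∈ Ioo a b
    · have hT : 0 < (x - a) * (b - x) := mul_pos (sub_pos.2 hx.1) (sub_pos.2 hx.2)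
      obtain ⟨N, hN⟩ := exists_nat_gt (2 / ((x - a) * (b - x)))
      refine tendsto_const_nhds.congr' ?_
      filter_upwards [eventually_ge_atTop N] with n hn
      have hn' : (N : ℝ) ≤ n := by exact_mod_cast hn
      rw [div_lt_iff₀ hT] at hN
      simp only [cut_of_mem hx]
      rw [Real.smoothTransition.one_of_one_le, one_mul]
      nlinarith
    · simp only [cut_of_notMem hx]
      exact tendsto_const_nhds

/-- Small values of `S` are truncated: the approximations are `G((n+1)S)/(n+1)`, where `G` vanishes
on `(-1, 1)` and is the identity for `|t| ≥ 2`. The chain rule gives the derivative `G'((n+1)S) S'`,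
which is bounded independently of `n` and equals `S'` for large `n` wherever `S ≠ 0`. -/
theorem isTestLimit₁_indicator {a b : ℝ} {S : ℝ → ℝ} (hS : ContDiff ℝ ∞ S) (ha : S a = 0)
    (hb : S b = 0) (hS1 : ∀ x, |S x| ≤ 1) {C : ℝ} (hS2 : ∀ x, |deriv S x| ≤ C)
    (hS0 : ∀ᵐ x, S x ≠ 0) :
    IsTestLimit₁ a b (cut a b S)
      (cut a b (deriv S)) := by
  let G : ℝ → ℝ := fun t => t * Real.smoothTransition (t ^ 2 - 1)
  have hG : ContDiff ℝ ∞ G :=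
    contDiff_id.mul (Real.smoothTransition.contDiff.comp (by fun_prop))
  have hG0 : ∀ t, |t| < 1 → G t = 0 := fun t ht => by
    have : t ^ 2 ≤ 1 := by rw [← sq_abs]; nlinarith [abs_nonneg t]
    simp only [G]
    rw [Real.smoothTransition.zero_of_nonpos (by linarith), mul_zero]
  have hG1 : ∀ t, 2 ≤ |t| → G t = t := fun t ht => by
    have : 4 ≤ t ^ 2 := by rw [← sq_abs]; nlinarith [abs_nonneg t]
    simp only [G]
    rw [Real.smoothTransition.one_of_one_le (by linarith), mul_one]
  have hGle : ∀ t, |G t| ≤ |t| := fun t => by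
    simp only [G]
    rw [abs_mul, abs_of_nonneg (Real.smoothTransition.nonneg _)]
    exact mul_le_of_le_one_right (abs_nonneg _) (Real.smoothTransition.le_one _)
  have hG1' : ∀ t, 2 < |t| → deriv G t = 1 := fun t ht => by
    have : G =ᶠ[𝓝 t] id := by
      filter_upwards [(isOpen_lt continuous_const continuous_abs).mem_nhds ht] with y hy
      exact hG1 y (le_of_lt hy)
    rw [this.deriv_eq, deriv_id]
  obtain ⟨B, hB⟩ : ∃ B, ∀ t, |deriv G t| ≤ B := by
    obtain ⟨B, hB⟩ := (isCompact_Icc (a := (-2 : ℝ)) (b := 2)).exists_bound_of_continuousOn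
      (hG.continuous_deriv (by simp)).continuousOn
    refine ⟨max B 1, fun t => ?_⟩
    by_cases ht : 2 < |t|
    · rw [hG1' t ht, abs_one]
      exact le_max_right _ _
    · exact (hB t (abs_le.1 (not_lt.1 ht))).trans (le_max_left _ _)
  have hn0 : ∀ n : ℕ, (0 : ℝ) < n + 1 := fun n => by positivity
  have key := fun n : ℕ => truncation_isTest (a := a) (b := b) (δ := 1 / (n + 1 : ℝ))
    (by positivity) (T := S) (S := fun _ => 1)
    (F := fun t => (n + 1 : ℝ)⁻¹ * G ((n + 1) * t)) hS contDiff_const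
    (contDiff_const.mul (hG.comp (by fun_prop))) ha hb
    (fun t ht => by
      rw [hG0, mul_zero]
      rw [abs_mul, abs_of_pos (hn0 n)]
      exact (lt_div_iff₀' (hn0 n)).1 ht)
  simp only [mul_one] at key
  have hd : ∀ (n : ℕ) x, deriv (cut a b fun x => (n + 1 : ℝ)⁻¹ * G ((n + 1) * S x)) x =
      cut a b (fun x => deriv G ((n + 1) * S x) * deriv S x) x := by
    intro n x
    by_cases hx : x ∈ Ioo a b
    · rw [cut_of_mem hx]
      have h1 : HasDerivAt (fun x => (n + 1 : ℝ)⁻¹ * G ((n + 1) * S x))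
          (deriv G ((n + 1) * S x) * deriv S x) x := by
        have h2 := ((hS.differentiable (by simp)) x).hasDerivAt.const_mul (n + 1 : ℝ)
        have h3 := ((hG.differentiable (by simp)) ((n + 1) * S x)).hasDerivAt
        refine ((h3.comp x h2).const_mul (n + 1 : ℝ)⁻¹).congr_deriv ?_
        rw [mul_left_comm, inv_mul_cancel_left₀ (hn0 n).ne']
      refine (h1.ofReal_comp.congr_of_eventuallyEq ?_).deriv
      filter_upwards [isOpen_Ioo.mem_nhds hx] with y hy
      rw [cut_of_mem hy]
    · rw [cut_of_notMem hx]
      by_contra h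
      exact hx ((key n).2.2 (support_deriv_subset h))
  refine ⟨_, fun n => (key n).1, fun n => (key n).2.1, fun n => (key n).2.2,
    ⟨max 1 (B * C), fun n x => ⟨?_, ?_⟩⟩, ?_⟩
  · refine le_trans ?_ (le_max_left _ _)
    refine (norm_cut_le _ _ _ _).trans ?_
    rw [abs_mul, abs_inv, abs_of_pos (hn0 n), inv_mul_le_iff₀ (hn0 n)]
    refine (hGle _).trans ?_
    rw [abs_mul, abs_of_pos (hn0 n)]
    exact mul_le_mul_of_nonneg_left (hS1 x) (hn0 n).le
  · refine le_trans ?_ (le_max_right _ _)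
    rw [hd]
    refine (norm_cut_le _ _ _ _).trans ?_
    rw [abs_mul]
    exact mul_le_mul (hB _) (hS2 x) (abs_nonneg _) ((abs_nonneg _).trans (hB 0))
  · filter_upwards [hS0] with x hx
    simp only [hd]
    obtain ⟨N, hN⟩ := exists_nat_gt (2 / |S x|)
    rw [div_lt_iff₀ (abs_pos.2 hx)] at hN
    have hev : ∀ n : ℕ, N ≤ n → 2 < |(n + 1 : ℝ) * S x| := fun n hn => by
      have hn' : (N : ℝ) ≤ n := by exact_mod_cast hn
      rw [abs_mul, abs_of_pos (hn0 n)]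
      nlinarith [abs_pos.2 hx]
    by_cases hxI : x ∈ Ioo a b
    · simp only [cut_of_mem hxI]
      constructor
      · refine tendsto_const_nhds.congr' ?_
        filter_upwards [eventually_ge_atTop N] with n hn
        rw [hG1 _ (hev n hn).le, inv_mul_cancel_left₀ (hn0 n).ne']
      · refine tendsto_const_nhds.congr' ?_
        filter_upwards [eventually_ge_atTop N] with n hn
        rw [hG1' _ (hev n hn), one_mul]
    · simp only [cut_of_notMem hxI]
      exact ⟨tendsto_const_nhds, tendsto_const_nhds⟩

theorem isTestLimit₁_sin {a b c : ℝ} (hc : c ≠ 0) (hb : Real.sin (c * (b - a)) = 0) :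
    IsTestLimit₁ a b (cut a b fun x => Real.sin (c * (x - a)))
      (cut a b fun x => c * Real.cos (c * (x - a))) := by
  have hd : deriv (fun x => Real.sin (c * (x - a))) = fun x => c * Real.cos (c * (x - a)) := by
    funext x
    have h1 : HasDerivAt (fun x => c * (x - a)) (c * 1) x :=
      ((hasDerivAt_id x).sub_const a).const_mul c
    rw [h1.sin.deriv]
    ring
  rw [← hd]
  refine isTestLimit₁_indicator (C := |c|) (by fun_prop) (by simp) hb
    (fun x => Real.abs_sin_le_one _) (fun x => ?_) ?_
  · rw [hd, abs_mul]
    exact mul_le_of_le_one_right (abs_nonneg _) (Real.abs_cos_le_one _)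
  · have hcount : {x | Real.sin (c * (x - a)) = 0} ⊆ Set.range fun n : ℤ => n * Real.pi / c + a := by
      intro x hx
      obtain ⟨n, hn⟩ := Real.sin_eq_zero_iff.1 hx
      refine ⟨n, ?_⟩
      simp only
      rw [hn]
      field_simp
      ring
    have := ((Set.countable_range _).mono hcount).measure_zero (volume : Measure ℝ)
    rw [measure_eq_zero_iff_ae_notMem] at this
    exact this

/-- A function whose translates by multiples of `l` form a partition of unity. -/
def partitionFun (l x : ℝ) : ℝ :=
  Real.smoothTransition (x / l) - Real.smoothTransition (x / l - 1)

theorem contDiff_partitionFun (l : ℝ) : ContDiff ℝ ∞ (partitionFun l) :=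
  (Real.smoothTransition.contDiff.comp (by fun_prop)).sub
    (Real.smoothTransition.contDiff.comp (by fun_prop))

theorem support_partitionFun_subset {l : ℝ} (hl : 0 < l) :
    Function.support (partitionFun l) ⊆ Icc 0 (2 * l) := by
  intro x hx
  by_contra h
  apply hx
  rw [mem_Icc, not_and_or, not_le, not_le] at h
  unfold partitionFun
  rcases h with h | h
  · have : x / l ≤ 0 := div_nonpos_of_nonpos_of_nonneg h.le hl.le
    rw [Real.smoothTransition.zero_of_nonpos this,
      Real.smoothTransition.zero_of_nonpos (by linarith), sub_zero]
  · have : 2 ≤ x / l := (le_div_iff₀ hl).2 h.le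
    rw [Real.smoothTransition.one_of_one_le (by linarith),
      Real.smoothTransition.one_of_one_le (by linarith), sub_self]

/-- On the cell, only the translates `m = 0` and `m = 1` of the partition function can be nonzero,
so periodizations are finite sums over `{0, 1}`. -/
theorem mem_pair_of_add_mem_Icc {l t : ℝ} {m : ℤ} (hl : 0 < l) (ht : t ∈ Ioo 0 l)
    (htm : t + m * l ∈ Icc 0 (2 * l)) : m ∈ ({0, 1} : Finset ℤ) := by
  have h1 : (-1 : ℝ) < m := by
    by_contra h
    have : (m : ℝ) * l ≤ -1 * l := mul_le_mul_of_nonneg_right (not_lt.1 h) hl.le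
    linarith [ht.2, htm.1]
  have h2 : (m : ℝ) < 2 := by
    by_contra h
    have : 2 * l ≤ (m : ℝ) * l := mul_le_mul_of_nonneg_right (not_lt.1 h) hl.le
    linarith [ht.1, htm.2]
  have h3 : -1 < m := by exact_mod_cast h1
  have h4 : m < 2 := by exact_mod_cast h2
  simp only [Finset.mem_insert, Finset.mem_singleton]
  omega

theorem partitionFun_add {l x : ℝ} (hl : 0 < l) (hx : x ∈ Ioo 0 l) :
    partitionFun l x + partitionFun l (x + l) = 1 := by
  unfold partitionFun
  have h1 : 0 < x / l := div_pos hx.1 hl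
  have h2 : x / l < 1 := (div_lt_one hl).2 hx.2
  have h3 : (x + l) / l = x / l + 1 := by rw [add_div, div_self hl.ne']
  rw [h3, add_sub_cancel_right, Real.smoothTransition.zero_of_nonpos (x := x / l - 1) (by linarith),
    Real.smoothTransition.one_of_one_le (x := x / l + 1) (by linarith)]
  ring

end Cutoff

/-! ### The periodic geometry -/

section Geometry

open scoped ContDiff ComplexConjugate
open Filter Topology

instance isAddHaarMeasure_R3 : (volume : Measure R3).IsAddHaarMeasure :=
  Measure.prod.instIsAddHaarMeasure _ _

theorem sub_floor_mem_Ioo {l t : ℝ} (hl : 0 < l) (ht : ∀ n : ℤ, t ≠ n * l) :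
    t - ⌊t / l⌋ * l ∈ Ioo 0 l := by
  have h1 : (⌊t / l⌋ : ℝ) ≤ t / l := Int.floor_le _
  have h2 : t / l < ⌊t / l⌋ + 1 := Int.lt_floor_add_one _
  rw [le_div_iff₀ hl] at h1
  rw [div_lt_iff₀ hl] at h2
  exact ⟨lt_of_le_of_ne (by linarith) fun h => ht _ (sub_eq_zero.1 h.symm), by linarith⟩

theorem fold_add_aux {l x : ℝ} (hl : 0 < l) (hx : x ∈ Ioo 0 l) (m : ℤ) :
    l * Int.fract ((x + m * l) / l) = x := by
  have h : (x + m * l) / l = x / l + m := by rw [add_div, mul_div_cancel_right₀ _ hl.ne']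
  rw [h, Int.fract_add_intCast, Int.fract_eq_self.2 ⟨(div_pos hx.1 hl).le, (div_lt_one hl).2 hx.2⟩,
    mul_div_cancel₀ _ hl.ne']

theorem ex_fold {l : ℝ} (hl : 0 < l) (k : ℤ) (x : ℝ) :
    ex (2 * Real.pi * k / l) (l * Int.fract (x / l)) = ex (2 * Real.pi * k / l) x := by
  have h : l * Int.fract (x / l) = x + (-⌊x / l⌋ : ℤ) * l := by
    rw [Int.fract, mul_sub, mul_div_cancel₀ _ hl.ne']
    push_cast
    ring
  rw [h, ex_add, ex_mul_int_period hl, mul_one]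

theorem finite_shifts {l : ℝ} (hl : 0 < l) (R : ℝ) :
    {m : ℤ | ∃ t : ℝ, |t| ≤ R ∧ t - m * l ∈ Ioo 0 l}.Finite := by
  refine (Set.finite_Icc (⌊-R / l⌋ - 1) (⌈R / l⌉)).subset ?_
  rintro m ⟨t, ht, h1, h2⟩
  obtain ⟨h3, h4⟩ := abs_le.1 ht
  constructor
  · have h5 : -R / l < m + 1 := by
      rw [div_lt_iff₀ hl]
      linarith
    have h6 : (⌊-R / l⌋ : ℝ) < m + 1 := (Int.floor_le _).trans_lt h5
    have h7 : ⌊-R / l⌋ < m + 1 := by exact_mod_cast h6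
    omega
  · have h5 : (m : ℝ) < R / l := by
      rw [lt_div_iff₀ hl]
      linarith
    have h6 : (m : ℝ) < ⌈R / l⌉ := h5.trans_le (Int.le_ceil _)
    exact_mod_cast h6.le

theorem ae_ne_int_mul (l : ℝ) : ∀ᵐ t : ℝ, ∀ n : ℤ, t ≠ n * l :=
  ae_all_iff.2 fun _ => Measure.ae_ne volume _

namespace Cuboid

variable (D : Cuboid)

theorem isTiling_one : IsTiling D.I₁ univ (fun m : ℤ => m * D.l₁)
    (fun t => D.l₁ * Int.fract (t / D.l₁)) where
  isOpen_cell := isOpen_Ioo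
  isOpen := isOpen_univ
  fold_add m x hx := fold_add_aux D.l₁_pos hx m
  add_mem m x _ := mem_univ _
  injective m n h := by
    have := mul_right_cancel₀ D.l₁_pos.ne' h
    exact_mod_cast this
  cover := by
    filter_upwards [ae_ne_int_mul D.l₁] with x hx _
    exact ⟨_, sub_floor_mem_Ioo D.l₁_pos hx⟩
  locallyFinite K hK := by
    obtain ⟨R, hR⟩ := hK.isBounded.exists_norm_le
    exact (finite_shifts D.l₁_pos R).subset fun m ⟨x, hx, h⟩ => ⟨x, hR x hx, h⟩
  exists_zero := ⟨0, by simp⟩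

/-- The part of the cuboid with third coordinate in `J`. -/
def slab (J : Set ℝ) : Set R3 := D.I₁ ×ˢ (D.I₂ ×ˢ J)

/-- The periodic extension of a slab. -/
def slabPer (J : Set ℝ) : Set R3 := univ ×ˢ (univ ×ˢ J)

/-- The lattice of periods. -/
def shift (m : ℤ × ℤ) : R3 := (m.1 * D.l₁, m.2 * D.l₂, 0)

/-- The map that folds the periodic extension of the cuboid onto the cuboid. -/
def fold (x : R3) : R3 :=
  (D.l₁ * Int.fract (x.1 / D.l₁), D.l₂ * Int.fract (x.2.1 / D.l₂), x.2.2)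

/-- A general open `J` covers `Ω` (with `J = I₃`) and `Ω ∖ Γ` (with `J = I₃ ∖ {0}`) at once. -/
theorem isTiling_slab {J : Set ℝ} (hJ : IsOpen J) :
    IsTiling (D.slab J) (slabPer J) D.shift D.fold where
  isOpen_cell := isOpen_Ioo.prod (isOpen_Ioo.prod hJ)
  isOpen := isOpen_univ.prod (isOpen_univ.prod hJ)
  fold_add m x hx := by
    refine Prod.ext (fold_add_aux D.l₁_pos hx.1 m.1) (Prod.ext (fold_add_aux D.l₂_pos hx.2.1 m.2) ?_)
    simp [fold, shift]
  add_mem m x hx := by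
    refine ⟨mem_univ _, mem_univ _, ?_⟩
    simpa [shift] using hx.2.2
  injective m n h := by
    simp only [shift, Prod.mk.injEq] at h
    have h1 := mul_right_cancel₀ D.l₁_pos.ne' h.1
    have h2 := mul_right_cancel₀ D.l₂_pos.ne' h.2.1
    exact Prod.ext (by exact_mod_cast h1) (by exact_mod_cast h2)
  cover := by
    have h1 : ∀ᵐ x : R3, ∀ n : ℤ, x.1 ≠ n * D.l₁ :=
      Measure.quasiMeasurePreserving_fst.ae (ae_ne_int_mul D.l₁)
    have h2 : ∀ᵐ x : R3, ∀ n : ℤ, x.2.1 ≠ n * D.l₂ :=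
      (Measure.quasiMeasurePreserving_fst.comp Measure.quasiMeasurePreserving_snd).ae
        (ae_ne_int_mul D.l₂)
    filter_upwards [h1, h2] with x hx1 hx2 hx
    refine ⟨(_, _), sub_floor_mem_Ioo D.l₁_pos hx1, sub_floor_mem_Ioo D.l₂_pos hx2, ?_⟩
    simpa [shift] using hx.2.2
  locallyFinite K hK := by
    obtain ⟨R, hR⟩ := hK.isBounded.exists_norm_le
    refine ((finite_shifts D.l₁_pos R).prod (finite_shifts D.l₂_pos R)).subset ?_
    rintro m ⟨x, hx, h⟩
    exact ⟨⟨x.1, (norm_fst_le x).trans (hR x hx), h.1⟩,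
      ⟨x.2.1, (norm_fst_le x.2).trans ((norm_snd_le x).trans (hR x hx)), h.2.1⟩⟩
  exists_zero := ⟨0, by simp [shift]⟩

/-- `H¹_#` of a slab. -/
def HPer (J : Set ℝ) : Set (R3 → ℂ) :=
  {u | MemH1 (D.slab J) u ∧ MemH1loc (slabPer J) (D.perExt u)}

/-- The open interval `I₃` without the position of the interface. -/
def J₃ : Set ℝ := D.I₃ \ {0}

theorem isOpen_I₃ : IsOpen D.I₃ := isOpen_Ioo

theorem isOpen_J₃ : IsOpen D.J₃ := isOpen_Ioo.sdiff isClosed_singleton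

theorem slab_J₃ : D.slab D.J₃ = D.Omega \ D.Gamma := by
  ext x
  simp only [slab, J₃, Omega, Gamma, mem_prod, Set.mem_sdiff, mem_singleton_iff]
  tauto

theorem slabPer_J₃ : slabPer D.J₃ = D.OmegaPer \ GammaPer := by
  ext x
  simp only [slabPer, J₃, OmegaPer, GammaPer, mem_prod, Set.mem_sdiff, mem_singleton_iff, mem_univ,
    true_and]

theorem H1perJump_eq : D.H1perJump = D.HPer D.J₃ := by
  rw [HPer, slab_J₃, slabPer_J₃]
  rfl

theorem ae_snd_snd {p : ℝ → Prop} (hp : ∀ᵐ t, p t) : ∀ᵐ x : R3, p x.2.2 :=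
  (Measure.quasiMeasurePreserving_snd.comp Measure.quasiMeasurePreserving_snd).ae hp

theorem restrict_J₃ : (volume : Measure R3).restrict (D.slab D.J₃) = volume.restrict D.Omega := by
  refine Measure.restrict_congr_set ?_
  filter_upwards [ae_snd_snd (Measure.ae_ne volume 0)] with x hx
  refine propext ⟨fun h => ⟨h.1, h.2.1, h.2.2.1⟩, fun h => ⟨h.1, h.2.1, h.2.2, hx⟩⟩

instance isFiniteMeasure_Omega : IsFiniteMeasure ((volume : Measure R3).restrict D.Omega) := by
  refine ⟨?_⟩
  rw [Measure.restrict_apply_univ]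
  have h : Bornology.IsBounded D.Omega :=
    (Metric.isBounded_Ioo _ _).prod ((Metric.isBounded_Ioo _ _).prod (Metric.isBounded_Ioo _ _))
  exact h.measure_lt_top

/-- `MemH1` asks for a weak derivative in every direction; by linearity the three coordinate
directions suffice. -/
theorem exists_isWeakDeriv {O : Set R3} (hO : IsOpen O) {u : R3 → ℂ} {g : Fin 3 → R3 → ℂ}
    (hu : LocallyIntegrableOn u O) (hg : ∀ i, LocallyIntegrableOn (g i) O)
    (h : ∀ i, IsWeakDeriv O (dir i) u (g i)) (v : R3) :
    IsWeakDeriv O v u (fun x => v.1 * g 0 x + (v.2.1 * g 1 x + v.2.2 * g 2 x)) := by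
  have hc : ∀ (c : ℝ) i, LocallyIntegrableOn (fun x => (c : ℂ) * g i x) O := fun c i =>
    (hg i).continuousOn_mul continuousOn_const hO.isLocallyClosed
  have := ((h 0).smul_dir v.1).add_dir hu (hc _ _) ((hc _ _).add (hc _ _))
    (((h 1).smul_dir v.2.1).add_dir hu (hc _ _) (hc _ _) ((h 2).smul_dir v.2.2))
  have hv : v.1 • dir 0 + (v.2.1 • dir 1 + v.2.2 • dir 2) = v := by
    simp only [dir, Matrix.cons_val, Prod.smul_mk, smul_eq_mul, Prod.mk_add_mk]
    simp
  rw [hv] at this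
  exact this

theorem mem_HPer {J : Set ℝ} (hJ : IsOpen J) {u : R3 → ℂ} {g : Fin 3 → R3 → ℂ}
    (hu : MemLp u 2 (volume.restrict (D.slab J))) (hg : ∀ i, MemLp (g i) 2 (volume.restrict (D.slab J)))
    (h : ∀ i, IsWeakDeriv (slabPer J) (dir i) (u ∘ D.fold) (g i ∘ D.fold)) : u ∈ D.HPer J := by
  have hT := D.isTiling_slab hJ
  have hlin : ∀ v : R3, MemLp (fun x => v.1 * g 0 x + (v.2.1 * g 1 x + v.2.2 * g 2 x)) 2
      (volume.restrict (D.slab J)) := fun v =>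
    ((hg 0).const_mul _).add (((hg 1).const_mul _).add ((hg 2).const_mul _))
  have h2 := fun v => exists_isWeakDeriv hT.isOpen
    ((hT.memL2loc_fold hu).locallyIntegrableOn hT.isOpen)
    (fun i => (hT.memL2loc_fold (hg i)).locallyIntegrableOn hT.isOpen) h v
  exact ⟨⟨hu, fun v => ⟨_, hlin v, hT.isWeakDeriv_of_fold (h2 v)⟩⟩,
    hT.memL2loc_fold hu, fun v => ⟨_, hT.memL2loc_fold (hlin v), h2 v⟩⟩

/-- The converse of `mem_HPer`. Together they replace the two conditions in `H¹_#`, on the cell and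
on the periodic extension, by a single one: the extension has the extended derivative as its weak
derivative. -/
theorem HPer_isWeakDeriv {J : Set ℝ} (hJ : IsOpen J) {u : R3 → ℂ} (hu : u ∈ D.HPer J) (v : R3) :
    MemLp (weakDeriv (D.slab J) v u) 2 (volume.restrict (D.slab J)) ∧
    IsWeakDeriv (slabPer J) v (u ∘ D.fold) (weakDeriv (D.slab J) v u ∘ D.fold) := by
  have hT := D.isTiling_slab hJ
  obtain ⟨g, hg, hd⟩ := hu.1.2 v
  have hae := weakDeriv_ae_eq hT.isOpen_cell hg hd
  have hm := (memLp_congr_ae hae).2 hg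
  exact ⟨hm, hT.isWeakDeriv_fold hm hu.2 (hd.congr .rfl hae.symm)⟩

/-! ### Modes -/

/-- The product `e^{iαx₁} e^{iβx₂} s(x₃)`. -/
def mode (α β : ℝ) (s : ℝ → ℂ) (x : R3) : ℂ := ex α x.1 * (ex β x.2.1 * s x.2.2)

theorem norm_mode (α β : ℝ) (s : ℝ → ℂ) (x : R3) : ‖mode α β s x‖ = ‖s x.2.2‖ := by
  rw [mode, norm_mul, norm_mul, norm_ex, norm_ex, one_mul, one_mul]

theorem measurable_mode (α β : ℝ) {s : ℝ → ℂ} (hs : Measurable s) : Measurable (mode α β s) :=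
  ((contDiff_ex α (n := 0)).continuous.measurable.comp measurable_fst).mul
    (((contDiff_ex β (n := 0)).continuous.measurable.comp
      (measurable_fst.comp measurable_snd)).mul (hs.comp (measurable_snd.comp measurable_snd)))

theorem conj_mode (α β : ℝ) (s : ℝ → ℂ) (x : R3) :
    conj (mode α β s x) = mode (-α) (-β) (fun t => conj (s t)) x := by
  simp only [mode, map_mul, conj_ex]

/-- The frequencies of `l`-periodic exponentials. -/
def freq (l : ℝ) (k : ℤ) : ℝ := 2 * Real.pi * k / l

theorem freq_neg (l : ℝ) (k : ℤ) : freq l (-k) = -freq l k := by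
  unfold freq
  push_cast
  ring

theorem mode_fold (k n : ℤ) (s : ℝ → ℂ) :
    mode (freq D.l₁ k) (freq D.l₂ n) s ∘ D.fold = mode (freq D.l₁ k) (freq D.l₂ n) s := by
  funext x
  simp only [Function.comp_apply, mode, fold, freq, ex_fold D.l₁_pos, ex_fold D.l₂_pos]

theorem mode_add_shift (k n : ℤ) (s : ℝ → ℂ) (x : R3) (m : ℤ × ℤ) :
    mode (freq D.l₁ k) (freq D.l₂ n) s (x + D.shift m) = mode (freq D.l₁ k) (freq D.l₂ n) s x := by
  simp only [mode, shift, freq, Prod.fst_add, Prod.snd_add, ex_add, ex_mul_int_period D.l₁_pos,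
    ex_mul_int_period D.l₂_pos, mul_one, add_zero]

theorem contDiffOn_mode (α β : ℝ) {s : ℝ → ℂ} {J : Set ℝ} {n : WithTop ℕ∞}
    (hs : ContDiffOn ℝ n s J) : ContDiffOn ℝ n (mode α β s) (slabPer J) := by
  have h1 : ContDiff ℝ n fun x : R3 => ex α x.1 := (contDiff_ex α).comp contDiff_fst
  have h2 : ContDiff ℝ n fun x : R3 => ex β x.2.1 :=
    (contDiff_ex β).comp (contDiff_fst.comp contDiff_snd)
  exact h1.contDiffOn.mul (h2.contDiffOn.mul
    (hs.comp (contDiff_snd.comp contDiff_snd).contDiffOn fun x hx => hx.2.2))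

theorem fderiv_mode (α β : ℝ) {s : ℝ → ℂ} {x : R3} (hs : DifferentiableAt ℝ s x.2.2) (v : R3) :
    fderiv ℝ (mode α β s) x v =
      (v.1 * (α * Complex.I) + v.2.1 * (β * Complex.I)) * mode α β s x +
        v.2.2 * mode α β (deriv s) x := by
  have p1 : HasFDerivAt (fun x : R3 => x.1) (ContinuousLinearMap.fst ℝ ℝ (ℝ × ℝ)) x :=
    hasFDerivAt_fst
  have p2 : HasFDerivAt (fun x : R3 => x.2.1) ((ContinuousLinearMap.fst ℝ ℝ ℝ).comp
    (ContinuousLinearMap.snd ℝ ℝ (ℝ × ℝ))) x := hasFDerivAt_fst.comp x hasFDerivAt_snd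
  have p3 : HasFDerivAt (fun x : R3 => x.2.2) ((ContinuousLinearMap.snd ℝ ℝ ℝ).comp
    (ContinuousLinearMap.snd ℝ ℝ (ℝ × ℝ))) x := hasFDerivAt_snd.comp x hasFDerivAt_snd
  have h1 := HasFDerivAt.comp (g := ex α) x (hasDerivAt_ex α x.1).hasFDerivAt p1
  have h2 := HasFDerivAt.comp (g := ex β) x (hasDerivAt_ex β x.2.1).hasFDerivAt p2
  have h3 := HasFDerivAt.comp (g := s) x hs.hasDerivAt.hasFDerivAt p3
  have h := (h1.mul (h2.mul h3)).fderiv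
  have h' : fderiv ℝ (mode α β s) x = _ := h
  rw [h']
  simp [mode]
  ring

end Cuboid

end Geometry

/-! ### Modes as weakly differentiable functions and as test functions. -/

section Green

open scoped ContDiff ComplexConjugate
open Filter Topology

namespace Cuboid

variable (D : Cuboid)

/-- The gradient of a mode with derivative `s'` of the third factor. -/
def modeGrad (α β : ℝ) (s s' : ℝ → ℂ) : Fin 3 → R3 → ℂ :=
  ![fun x => α * Complex.I * mode α β s x, fun x => β * Complex.I * mode α β s x, mode α β s']

theorem fderiv_mode_dir (α β : ℝ) {s : ℝ → ℂ} {x : R3} (hs : DifferentiableAt ℝ s x.2.2)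
    (i : Fin 3) : fderiv ℝ (mode α β s) x (dir i) = modeGrad α β s (deriv s) i x := by
  rw [fderiv_mode α β hs]
  fin_cases i <;> simp [dir, modeGrad]

theorem isWeakDeriv_mode {J : Set ℝ} (hJ : IsOpen J) (α β : ℝ) {s s' : ℝ → ℂ}
    (hs : ContDiffOn ℝ 1 s J) (hs' : ∀ t ∈ J, deriv s t = s' t) (i : Fin 3) :
    IsWeakDeriv (slabPer J) (dir i) (mode α β s) (modeGrad α β s s' i) := by
  have hO : IsOpen (slabPer J) := isOpen_univ.prod (isOpen_univ.prod hJ)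
  refine (isWeakDeriv_of_contDiffOn hO (contDiffOn_mode α β hs) (dir i)).congr .rfl ?_
  filter_upwards [ae_restrict_mem hO.measurableSet] with x hx
  rw [fderiv_mode_dir α β
    ((hs.differentiableOn (by simp)).differentiableAt (hJ.mem_nhds hx.2.2)) i]
  fin_cases i <;> simp [modeGrad, mode, hs' _ hx.2.2]

theorem tendsto_integral_mode {O : Set R3} (α β : ℝ) {f : ℕ → ℝ → ℂ} {s : ℝ → ℂ}
    (hf : ∀ n, Measurable (f n)) {C : ℝ} (hC : ∀ n x, ‖f n x‖ ≤ C)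
    (hlim : ∀ᵐ t, Tendsto (fun n => f n t) atTop (𝓝 (s t))) {ψ : R3 → ℂ} (hψ : IntegrableOn ψ O) :
    Tendsto (fun n => ∫ x in O, ψ x * mode α β (f n) x) atTop
      (𝓝 (∫ x in O, ψ x * mode α β s x)) := by
  refine tendsto_integral_of_dominated_convergence (fun x => ‖ψ x‖ * C) (fun n => ?_)
    (hψ.norm.mul_const C) (fun n => .of_forall fun x => ?_) ?_
  · exact hψ.1.mul (measurable_mode α β (hf n)).aestronglyMeasurable
  · rw [norm_mul, norm_mode]
    exact mul_le_mul_of_nonneg_left (hC n _) (norm_nonneg _)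
  · filter_upwards [ae_restrict_of_ae (ae_snd_snd hlim)] with x hx
    exact tendsto_const_nhds.mul (tendsto_const_nhds.mul (tendsto_const_nhds.mul hx))

theorem tendsto_integral_modeGrad {O : Set R3} (α β : ℝ) {f f' : ℕ → ℝ → ℂ} {s s' : ℝ → ℂ}
    (hf : ∀ n, Measurable (f n)) (hf' : ∀ n, Measurable (f' n)) {C : ℝ} (hC : ∀ n x, ‖f n x‖ ≤ C)
    (hC' : ∀ n x, ‖f' n x‖ ≤ C)
    (hlim : ∀ᵐ t, Tendsto (fun n => f n t) atTop (𝓝 (s t)))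
    (hlim' : ∀ᵐ t, Tendsto (fun n => f' n t) atTop (𝓝 (s' t))) {ψ : R3 → ℂ}
    (hψ : IntegrableOn ψ O) (i : Fin 3) :
    Tendsto (fun n => ∫ x in O, ψ x * modeGrad α β (f n) (f' n) i x) atTop
      (𝓝 (∫ x in O, ψ x * modeGrad α β s s' i x)) := by
  have h := tendsto_integral_mode α β hf hC hlim hψ
  fin_cases i
  · simp only [modeGrad, Fin.zero_eta, Matrix.cons_val_zero, mul_left_comm (ψ _),
      integral_const_mul]
    exact h.const_mul _
  · simp only [modeGrad, Fin.mk_one, Matrix.cons_val_one, Matrix.cons_val_zero,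
      mul_left_comm (ψ _), integral_const_mul]
    exact h.const_mul _
  · exact tendsto_integral_mode α β hf' hC' hlim' hψ

/-- Integration by parts passes to the limit by dominated convergence. The points `a`, `b` may lie
inside `J`: extending such an `s` by zero beyond them creates no singular part. In this way a sine
supported on one side of `Γ` is weakly differentiable across `Γ`. -/
theorem isWeakDeriv_mode_of_isTestLimit₁ {J : Set ℝ} (hJ : IsOpen J) (α β : ℝ) {a b : ℝ}
    {s s' : ℝ → ℂ} (h : IsTestLimit₁ a b s s') (i : Fin 3) :
    IsWeakDeriv (slabPer J) (dir i) (mode α β s) (modeGrad α β s s' i) := by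
  obtain ⟨f, h1, h2, h3, ⟨C, hC⟩, h4⟩ := h
  have hm : ∀ n, Measurable (f n) := fun n => (h1 n).continuous.measurable
  have hm' : ∀ n, Measurable (deriv (f n)) := fun n => measurable_deriv _
  intro φ hφ hc hs
  have i1 : IntegrableOn (fun x => fderiv ℝ φ x (dir i)) (slabPer J) :=
    ((continuous_fderiv_apply_const hφ (dir i)).integrable_of_hasCompactSupport
      (hasCompactSupport_fderiv_apply hc (dir i))).integrableOn
  have i2 : IntegrableOn φ (slabPer J) :=
    (hφ.continuous.integrable_of_hasCompactSupport hc).integrableOn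
  have t1 := tendsto_integral_mode α β hm (fun n x => (hC n x).1) (h4.mono fun x hx => hx.1) i1
  have t2 := tendsto_integral_modeGrad α β hm hm' (fun n x => (hC n x).1) (fun n x => (hC n x).2)
    (h4.mono fun x hx => hx.1) (h4.mono fun x hx => hx.2) i2 i
  simp only [mul_comm (fderiv ℝ φ _ _), mul_comm (φ _)] at t1 t2
  refine tendsto_nhds_unique t1 (t2.neg.congr fun n => ?_)
  exact (isWeakDeriv_mode hJ α β ((h1 n).of_le (by simp)).contDiffOn (fun _ _ => rfl) i φ hφ hc
    hs).symm

variable {D}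

/-- Periodic modes may be used as test functions. -/
theorem integral_mul_modeGrad_test {J : Set ℝ} (hJ : IsOpen J) {u g : R3 → ℂ} {i : Fin 3}
    (hu : IntegrableOn u (D.slab J)) (hg : IntegrableOn g (D.slab J))
    (hd : IsWeakDeriv (slabPer J) (dir i) (u ∘ D.fold) (g ∘ D.fold)) {s : ℝ → ℂ}
    (hs : ContDiff ℝ ∞ s) (hc : HasCompactSupport s) (hsJ : tsupport s ⊆ J) (k n : ℤ) :
    ∫ x in D.slab J, u x * modeGrad (freq D.l₁ k) (freq D.l₂ n) s (deriv s) i x =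
      - ∫ x in D.slab J, g x * mode (freq D.l₁ k) (freq D.l₂ n) s x := by
  -- The mode is made compactly supported by a lateral partition of unity. Summing the four
  -- translates that reach the cell gives back the mode there.
  let φ : R3 → ℂ := fun x => ((partitionFun D.l₁ x.1 * partitionFun D.l₂ x.2.1 : ℝ) : ℂ) *
    mode (freq D.l₁ k) (freq D.l₂ n) s x
  have hφ : ContDiff ℝ ∞ φ := by
    have h1 : ContDiff ℝ ∞ fun x : R3 => partitionFun D.l₁ x.1 * partitionFun D.l₂ x.2.1 :=
      ((contDiff_partitionFun _).comp contDiff_fst).mul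
        ((contDiff_partitionFun _).comp (contDiff_fst.comp contDiff_snd))
    have h2 : ContDiff ℝ ∞ (mode (freq D.l₁ k) (freq D.l₂ n) s) := by
      have := contDiffOn_mode (freq D.l₁ k) (freq D.l₂ n) hs.contDiffOn (J := univ)
      rwa [slabPer, univ_prod_univ, univ_prod_univ, contDiffOn_univ] at this
    exact (Complex.ofRealCLM.contDiff.comp h1).mul h2
  let K : Set R3 := Icc 0 (2 * D.l₁) ×ˢ (Icc 0 (2 * D.l₂) ×ˢ tsupport s)
  have hK : IsCompact K := isCompact_Icc.prod (isCompact_Icc.prod hc)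
  have hφK : tsupport φ ⊆ K := by
    refine closure_minimal (fun x hx => ?_) hK.isClosed
    have h1 := left_ne_zero_of_mul hx
    have h2 : mode (freq D.l₁ k) (freq D.l₂ n) s x ≠ 0 := right_ne_zero_of_mul hx
    rw [Complex.ofReal_ne_zero] at h1
    exact ⟨support_partitionFun_subset D.l₁_pos (left_ne_zero_of_mul h1),
      support_partitionFun_subset D.l₂_pos (right_ne_zero_of_mul h1),
      subset_tsupport _ (right_ne_zero_of_mul (right_ne_zero_of_mul h2))⟩
  have hKJ : K ⊆ slabPer J := fun x hx => ⟨mem_univ _, mem_univ _, hsJ hx.2.2⟩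
  have hφc : HasCompactSupport φ := hK.of_isClosed_subset (isClosed_tsupport _) hφK
  have hT := D.isTiling_slab hJ
  have key := hT.setIntegral_periodic hu hg hd hφ hφc (hφK.trans hKJ)
    (({0, 1} : Finset ℤ) ×ˢ ({0, 1} : Finset ℤ))
    (fun m x hx hm => Finset.mem_product.2
      ⟨mem_pair_of_add_mem_Icc D.l₁_pos hx.1 (hφK hm).1, mem_pair_of_add_mem_Icc D.l₂_pos hx.2.1 (hφK hm).2.1⟩)
    (Φ := mode (freq D.l₁ k) (freq D.l₂ n) s) (by
      intro x hx
      have e1 := partitionFun_add D.l₁_pos hx.1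
      have e2 := partitionFun_add D.l₂_pos hx.2.1
      simp only [φ, mode_add_shift, Finset.sum_product, ← Finset.sum_mul, ← Complex.ofReal_sum]
      have : ∑ m ∈ ({0, 1} : Finset ℤ), ∑ m' ∈ ({0, 1} : Finset ℤ),
          partitionFun D.l₁ (x + D.shift (m, m')).1 *
            partitionFun D.l₂ (x + D.shift (m, m')).2.1 = 1 := by
        simp only [shift, Prod.fst_add, Prod.snd_add, ← Finset.mul_sum, ← Finset.sum_mul]
        rw [Finset.sum_pair (by norm_num), Finset.sum_pair (by norm_num)]
        simp only [Int.cast_zero, zero_mul, add_zero, Int.cast_one, one_mul]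
        rw [e1, e2, one_mul]
      rw [this, Complex.ofReal_one, one_mul])
  rw [← key]
  refine setIntegral_congr_fun hT.isOpen_cell.measurableSet fun x hx => ?_
  rw [fderiv_mode_dir _ _ ((hs.differentiable (by simp)) _) i]

/-- Here `u` is arbitrary and the mode takes the role of test function. No boundary term arises at
`x₃ = a` or `x₃ = b`, since the approximations of `s` are supported in `(a, b)`; nothing is assumed
on traces of `u`. -/
theorem integral_mul_modeGrad {J : Set ℝ} (hJ : IsOpen J) {u g : R3 → ℂ} {i : Fin 3}
    (hu : IntegrableOn u (D.slab J)) (hg : IntegrableOn g (D.slab J))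
    (hd : IsWeakDeriv (slabPer J) (dir i) (u ∘ D.fold) (g ∘ D.fold)) {a b : ℝ} {s s' : ℝ → ℂ}
    (hab : Ioo a b ⊆ J) (h : IsTestLimit₁ a b s s') (k n : ℤ) :
    ∫ x in D.slab J, u x * modeGrad (freq D.l₁ k) (freq D.l₂ n) s s' i x =
      - ∫ x in D.slab J, g x * mode (freq D.l₁ k) (freq D.l₂ n) s x := by
  obtain ⟨f, h1, h2, h3, ⟨C, hC⟩, h4⟩ := h
  have hm : ∀ n, Measurable (f n) := fun n => (h1 n).continuous.measurable
  have t1 := tendsto_integral_mode (freq D.l₁ k) (freq D.l₂ n) hm (fun n x => (hC n x).1)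
    (h4.mono fun x hx => hx.1) hg
  have t2 := tendsto_integral_modeGrad (freq D.l₁ k) (freq D.l₂ n) hm
    (fun n => measurable_deriv (f n)) (fun n x => (hC n x).1) (fun n x => (hC n x).2)
    (h4.mono fun x hx => hx.1) (h4.mono fun x hx => hx.2) hu i
  refine tendsto_nhds_unique t2 (t1.neg.congr fun m => ?_)
  exact (integral_mul_modeGrad_test hJ hu hg hd (h1 m) (h2 m) ((h3 m).trans hab) k n).symm

/-- Lateral derivatives do not act on the third factor, so `s` has to be approximated without its
derivative and `s'` is arbitrary. This admits cosines, which do not vanish at the ends. -/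
theorem integral_mul_modeGrad_lateral {J : Set ℝ} (hJ : IsOpen J) {u g : R3 → ℂ} {i : Fin 3}
    (hi : i ≠ 2) (hu : IntegrableOn u (D.slab J)) (hg : IntegrableOn g (D.slab J))
    (hd : IsWeakDeriv (slabPer J) (dir i) (u ∘ D.fold) (g ∘ D.fold)) {a b : ℝ} {s s' : ℝ → ℂ}
    (hab : Ioo a b ⊆ J) (h : IsTestLimit a b s) (k n : ℤ) :
    ∫ x in D.slab J, u x * modeGrad (freq D.l₁ k) (freq D.l₂ n) s s' i x =
      - ∫ x in D.slab J, g x * mode (freq D.l₁ k) (freq D.l₂ n) s x := by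
  obtain ⟨f, h1, h2, h3, ⟨C, hC⟩, h4⟩ := h
  have hm : ∀ n, Measurable (f n) := fun n => (h1 n).continuous.measurable
  have t1 := tendsto_integral_mode (freq D.l₁ k) (freq D.l₂ n) hm hC h4 hg
  have hne : ∀ (σ σ' : ℝ → ℂ), modeGrad (freq D.l₁ k) (freq D.l₂ n) σ σ' i =
      modeGrad (freq D.l₁ k) (freq D.l₂ n) σ (fun _ => 0) i := by
    intro σ σ'
    fin_cases i
    · rfl
    · rfl
    · exact absurd rfl hi
  have t2 := tendsto_integral_modeGrad (freq D.l₁ k) (freq D.l₂ n) hm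
    (f' := fun _ _ => 0) (s' := fun _ => 0) (fun n => measurable_const) hC
    (fun n x => by simpa using (norm_nonneg _).trans (hC n x)) h4
    (.of_forall fun _ => tendsto_const_nhds) hu i
  rw [hne]
  refine tendsto_nhds_unique t2 (t1.neg.congr fun m => ?_)
  rw [← hne _ (deriv (f m))]
  exact (integral_mul_modeGrad_test hJ hu hg hd (h1 m) (h2 m) ((h3 m).trans hab) k n).symm

end Cuboid

end Green

/-! ### Helmholtz-type problems in graph spaces -/

section Graph

open scoped ComplexConjugate
open Filter Topology

variable {X : Type*} [MeasurableSpace X] {ν : Measure X}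

/-- Complex conjugation in `L²`. -/
def conjL2 : Lp ℂ 2 ν → Lp ℂ 2 ν := fun f => Complex.conjCLE.toContinuousLinearMap.compLp f

theorem coeFn_conjL2 (f : Lp ℂ 2 ν) : conjL2 f =ᵐ[ν] fun x => conj (f x) :=
  ContinuousLinearMap.coeFn_compLp _ f

theorem conjL2_conjL2 (f : Lp ℂ 2 ν) : conjL2 (conjL2 f) = f := by
  refine Lp.ext ?_
  filter_upwards [coeFn_conjL2 (conjL2 f), coeFn_conjL2 f] with x h1 h2
  rw [h1, h2, Complex.conj_conj]

theorem conjL2_add (f g : Lp ℂ 2 ν) : conjL2 (f + g) = conjL2 f + conjL2 g := by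
  refine Lp.ext ?_
  filter_upwards [coeFn_conjL2 (f + g), coeFn_conjL2 f, coeFn_conjL2 g, Lp.coeFn_add f g,
    Lp.coeFn_add (conjL2 f) (conjL2 g)] with x h1 h2 h3 h4 h5
  rw [h1, h4, h5, Pi.add_apply, Pi.add_apply, h2, h3, map_add]

theorem conjL2_smul (c : ℂ) (f : Lp ℂ 2 ν) : conjL2 (c • f) = conj c • conjL2 f := by
  refine Lp.ext ?_
  filter_upwards [coeFn_conjL2 (c • f), coeFn_conjL2 f, Lp.coeFn_smul c f,
    Lp.coeFn_smul (conj c) (conjL2 f)] with x h1 h2 h3 h4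
  rw [h1, h3, h4, Pi.smul_apply, Pi.smul_apply, h2, smul_eq_mul, smul_eq_mul, map_mul]

theorem continuous_conjL2 : Continuous (conjL2 : Lp ℂ 2 ν → Lp ℂ 2 ν) :=
  (ContinuousLinearMap.compLpL 2 ν (Complex.conjCLE.toContinuousLinearMap)).continuous

theorem integrable_mul_L2 {f g : X → ℂ} (hf : MemLp f 2 ν) (hg : MemLp g 2 ν) :
    Integrable (fun x => f x * g x) ν := hf.integrable_mul hg

theorem inner_conjL2 (f g : Lp ℂ 2 ν) : inner ℂ (conjL2 f) g = ∫ x, g x * f x ∂ν := by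
  rw [L2.inner_def]
  refine integral_congr_ae ?_
  filter_upwards [coeFn_conjL2 f] with x hx
  rw [hx]
  simp

variable (ν) in
/-- Tuples of functions in `L²`, meant to consist of a function and some of its derivatives. -/
abbrev GraphSpace (m : ℕ) : Type _ := PiLp 2 (fun _ : Fin (m + 1) => Lp ℂ 2 ν)

/-- Complex conjugation of tuples. -/
def conjGraph {m : ℕ} (p : GraphSpace ν m) : GraphSpace ν m := WithLp.toLp 2 fun i => conjL2 (p i)

theorem inner_conjGraph {m : ℕ} (p q : GraphSpace ν m) :
    inner ℂ (conjGraph p) q = ∑ i, ∫ x, q i x * p i x ∂ν := by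
  rw [PiLp.inner_apply]
  exact Finset.sum_congr rfl fun i _ => inner_conjL2 _ _

/-- The form `∇u · ∇φ - κ u φ` as an operator. -/
def helmholtzOp (m : ℕ) (κ : ℝ) : GraphSpace ν m →L[ℂ] GraphSpace ν m :=
  (PiLp.continuousLinearEquiv 2 ℂ (fun _ : Fin (m + 1) => Lp ℂ 2 ν)).symm.toContinuousLinearMap ∘L
    (ContinuousLinearMap.pi fun i => (Fin.cons (-(κ : ℂ)) (fun _ => 1) : Fin (m + 1) → ℂ) i •
      ContinuousLinearMap.proj i) ∘L
    (PiLp.continuousLinearEquiv 2 ℂ (fun _ : Fin (m + 1) => Lp ℂ 2 ν)).toContinuousLinearMap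

theorem inner_helmholtzOp {m : ℕ} (κ : ℝ) (p q : GraphSpace ν m) :
    inner ℂ q (helmholtzOp m κ p) =
      -(κ : ℂ) * inner ℂ (q 0) (p 0) + ∑ i : Fin m, inner ℂ (q i.succ) (p i.succ) := by
  have h0 : helmholtzOp m κ p 0 = (-(κ : ℂ)) • p 0 := rfl
  have h1 : ∀ i : Fin m, helmholtzOp m κ p i.succ = (1 : ℂ) • p i.succ := fun _ => rfl
  rw [PiLp.inner_apply, Fin.sum_univ_succ, h0, inner_smul_right]
  simp only [h1, one_smul]

/-- `hgreen` says that `⟨e k, p⟩ = (lam k + 1) ⟨e k 0, p 0⟩` on `V`. Orthogonality and totality of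
the first components in `L²` are thereby inherited by the `e k` in `V`, and the form `∇u · ∇φ - κuφ`
becomes diagonal with entries `(lam k - κ)/(lam k + 1)`. -/
theorem existsUnique_helmholtz {m : ℕ} {V : Submodule ℂ (GraphSpace ν m)}
    (hV : IsClosed (V : Set (GraphSpace ν m))) {ι : Type*} {e : ι → GraphSpace ν m}
    (he : ∀ k, e k ∈ V) (hCe : ∀ k, conjGraph (e k) ∈ V)
    (ho : ∀ k l, k ≠ l → inner ℂ (e k 0) (e l 0) = 0) (hne : ∀ k, e k 0 ≠ 0)
    (htot : ∀ u : Lp ℂ 2 ν, (∀ k, inner ℂ (e k 0) u = 0) → u = 0)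
    (hinj : ∀ p ∈ V, p 0 = 0 → p = 0) {lam : ι → ℝ} (hlam : ∀ k, 0 ≤ lam k)
    (hgreen : ∀ k, ∀ p ∈ V,
      ∑ i : Fin m, inner ℂ (e k i.succ) (p i.succ) = lam k * inner ℂ (e k 0) (p 0))
    {κ : ℝ} {c : ℝ} (hc : 0 < c) (hκ : ∀ k, c ≤ |lam k - κ|)
    (f : Lp ℂ 2 ν) (G : Fin m → Lp ℂ 2 ν) :
    ∃! p, p ∈ V ∧ ∀ q ∈ V, (∫ x, ((∑ i : Fin m, p i.succ x * q i.succ x) - κ * p 0 x * q 0 x) ∂ν) =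
      ∫ x, ((∑ i : Fin m, G i x * q i.succ x) + f x * q 0 x) ∂ν := by
  have hinner : ∀ k, ∀ p ∈ V, inner ℂ (e k) p = (lam k + 1) * inner ℂ (e k 0) (p 0) := by
    intro k p hp
    rw [PiLp.inner_apply, Fin.sum_univ_succ, hgreen k p hp]
    ring
  have hl1 : ∀ k, (0 : ℝ) < lam k + 1 := fun k => by linarith [hlam k]
  have hl1' : ∀ k, (lam k + 1 : ℂ) ≠ 0 := fun k => by exact_mod_cast (hl1 k).ne'
  have htot' : ∀ p ∈ V, (∀ k, inner ℂ (e k) p = 0) → p = 0 := by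
    intro p hp h
    refine hinj p hp (htot _ fun k => ?_)
    have := h k
    rw [hinner k p hp] at this
    exact (mul_eq_zero.1 this).resolve_left (hl1' k)
  -- The variational equation pairs without conjugation, the inner product with it. Stability of `V`
  -- under conjugation makes the two formulations equivalent.
  have hclosed : ∀ {q}, q ∈ V → conjGraph q ∈ V := by
    intro q hq
    refine conj_mem_of_total hV (C := conjGraph) ?_ ?_ ?_ he htot' hCe hq
    · exact (PiLp.continuous_toLp 2 _).comp (continuous_pi fun i =>
        continuous_conjL2.comp ((continuous_apply i).comp (PiLp.continuous_ofLp 2 _)))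
    · intro x y
      ext1 i
      exact conjL2_add _ _
    · intro a x
      ext1 i
      exact conjL2_smul _ _
  obtain ⟨p, ⟨hpV, hp⟩, huniq⟩ := existsUnique_of_diagonal hV (helmholtzOp m κ) he
    (fun k h => hne k (by rw [h]; rfl))
    (fun k l hkl => by
      simp only
      rw [hinner k _ (he l), ho k l hkl, mul_zero]) htot'
    (τ := fun k => ((lam k - κ) / (lam k + 1) : ℝ)) (fun k p hp => by
      rw [inner_helmholtzOp, hgreen k p hp, hinner k p hp]
      have := hl1' k
      push_cast
      field_simp
      ring)
    -- The bound follows from `lam ≤ |lam - κ| + |κ|`: this gives `c (lam + 1) ≤ c |lam - κ| + c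
    -- (|κ| + 1)`, and the last term is at most `|lam - κ| (|κ| + 1)`. The summand `κ ^ 2` is mere
    -- slack.
    (c := c / (κ ^ 2 + 1 + c + |κ|)) (by positivity) (fun k => by
      rw [Complex.norm_real, Real.norm_eq_abs, abs_div, abs_of_pos (hl1 k)]
      rw [div_le_div_iff₀ (by positivity) (hl1 k)]
      have h1 := hκ k
      have h2 : lam k ≤ |lam k - κ| + |κ| := by
        have := abs_add_le (lam k - κ) κ
        rw [sub_add_cancel, abs_of_nonneg (hlam k)] at this
        exact this
      have h3 : c * (|κ| + 1) ≤ |lam k - κ| * (|κ| + 1) :=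
        mul_le_mul_of_nonneg_right h1 (by positivity)
      have h4 : 0 ≤ |lam k - κ| * κ ^ 2 := by positivity
      nlinarith [mul_le_mul_of_nonneg_left h2 hc.le])
    (WithLp.toLp 2 (Fin.cons f G))
  have hiff : ∀ p : GraphSpace ν m, (∀ q ∈ V, inner ℂ q (helmholtzOp m κ p) =
      inner ℂ q (WithLp.toLp 2 (Fin.cons f G) : GraphSpace ν m)) ↔ ∀ q ∈ V,
      (∫ x, ((∑ i : Fin m, p i.succ x * q i.succ x) - κ * p 0 x * q 0 x) ∂ν) =
        ∫ x, ((∑ i : Fin m, G i x * q i.succ x) + f x * q 0 x) ∂ν := by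
    intro p
    have hI : ∀ a b : Lp ℂ 2 ν, Integrable (fun x => a x * b x) ν := fun a b =>
      integrable_mul_L2 (Lp.memLp a) (Lp.memLp b)
    have e1 : ∀ q : GraphSpace ν m, inner ℂ (conjGraph q) (helmholtzOp m κ p) =
        ∫ x, ((∑ i : Fin m, p i.succ x * q i.succ x) - κ * p 0 x * q 0 x) ∂ν := by
      intro q
      simp only [mul_assoc]
      rw [inner_helmholtzOp, integral_sub (integrable_finsetSum _ fun i _ => hI _ _)
        ((hI _ _).const_mul _), integral_finsetSum _ fun i _ => hI _ _, integral_const_mul]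
      simp only [conjGraph, inner_conjL2]
      ring
    have e2 : ∀ q : GraphSpace ν m,
        inner ℂ (conjGraph q) (WithLp.toLp 2 (Fin.cons f G) : GraphSpace ν m) =
        ∫ x, ((∑ i : Fin m, G i x * q i.succ x) + f x * q 0 x) ∂ν := by
      intro q
      rw [inner_conjGraph, Fin.sum_univ_succ, integral_add (integrable_finsetSum _ fun i _ => hI _ _)
        (hI _ _), integral_finsetSum _ fun i _ => hI _ _, add_comm]
      rfl
    constructor
    · intro h q hq
      rw [← e1, ← e2]
      exact h _ (hclosed hq)
    · intro h q hq
      have hqq : conjGraph (conjGraph q) = q := by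
        ext1 i
        exact conjL2_conjL2 _
      have := h _ (hclosed hq)
      rwa [← e1, ← e2, hqq] at this
  exact ⟨p, ⟨hpV, (hiff p).1 hp⟩, fun p' hp' => huniq p' ⟨hp'.1, (hiff p').2 hp'.2⟩⟩

end Graph

/-! ### Modes as elements of `L²(Ω)`, and the passage from graphs back to functions. -/

section Systems

open scoped ComplexConjugate
open Filter Topology

variable {X : Type*} [MeasurableSpace X] {ν : Measure X}

open Classical in
/-- The element of `L²` that is represented by the function `f`, if `f` is square integrable. -/
def toL2 (ν : Measure X) (f : X → ℂ) : Lp ℂ 2 ν := if h : MemLp f 2 ν then h.toLp else 0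

theorem coeFn_toL2 {f : X → ℂ} (h : MemLp f 2 ν) : toL2 ν f =ᵐ[ν] f := by
  rw [toL2, dif_pos h]
  exact h.coeFn_toLp

theorem conjL2_toL2 {f : X → ℂ} (h : MemLp f 2 ν) :
    conjL2 (toL2 ν f) = toL2 ν fun x => conj (f x) := by
  have h' : MemLp (fun x => conj (f x)) 2 ν := h.star
  refine Lp.ext ?_
  filter_upwards [coeFn_conjL2 (toL2 ν f), coeFn_toL2 h, coeFn_toL2 h'] with x h1 h2 h3
  rw [h1, h2, h3]

theorem inner_toL2 {f : X → ℂ} (h : MemLp f 2 ν) (g : Lp ℂ 2 ν) :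
    inner ℂ (toL2 ν f) g = ∫ x, conj (f x) * g x ∂ν := by
  rw [L2.inner_def]
  refine integral_congr_ae ?_
  filter_upwards [coeFn_toL2 h] with x hx
  rw [hx]
  simp [mul_comm]

theorem memLp_of_norm_le [IsFiniteMeasure ν] {f : X → ℂ} (hf : Measurable f) {C : ℝ}
    (hC : ∀ x, ‖f x‖ ≤ C) : MemLp f 2 ν :=
  MemLp.of_bound hf.aestronglyMeasurable C (.of_forall hC)

namespace IsOrthogonalSystem

variable [IsFiniteMeasure ν] {ι : Type*} {p : ι → X → ℂ} (hp : IsOrthogonalSystem ν p)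
include hp

theorem memLp (i : ι) : MemLp (p i) 2 ν := memLp_of_norm_le (hp.measurable i) (hp.norm_le i)

theorem inner_toL2_toL2 (i j : ι) :
    inner ℂ (toL2 ν (p i)) (toL2 ν (p j)) = ∫ x, conj (p i x) * p j x ∂ν := by
  rw [inner_toL2 (hp.memLp i)]
  refine integral_congr_ae ?_
  filter_upwards [coeFn_toL2 (hp.memLp j)] with x hx
  rw [hx]

theorem inner_eq_zero (i j : ι) (hij : i ≠ j) :
    inner ℂ (toL2 ν (p i)) (toL2 ν (p j)) = 0 := by
  rw [hp.inner_toL2_toL2, hp.orthogonal i j hij]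

theorem toL2_ne_zero (i : ι) : toL2 ν (p i) ≠ 0 := by
  intro h
  refine hp.ne_zero i ?_
  rw [← hp.inner_toL2_toL2, h, inner_zero_left]

theorem eq_zero_of_inner (u : Lp ℂ 2 ν) (h : ∀ i, inner ℂ (toL2 ν (p i)) u = 0) : u = 0 := by
  have := hp.separating u ((Lp.memLp u).integrable (by norm_num)) fun i => by
    rw [← inner_toL2 (hp.memLp i), h i]
  exact Lp.ext (this.trans (Lp.coeFn_zero _ _ _).symm)

end IsOrthogonalSystem

theorem IsOrthogonalSystem.indicator {s : Set X} (hs : MeasurableSet s) {ι : Type*} {p : ι → X → ℂ}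
    (hp : IsOrthogonalSystem (ν.restrict s) p) :
    IsOrthogonalSystem (ν.restrict s) (fun i => s.indicator (p i)) := by
  have hc : ∀ i (f g : X → ℂ), (∀ x ∈ s, f x = g x) → ∫ x in s, conj (s.indicator (p i) x) * f x ∂ν =
      ∫ x in s, conj (p i x) * g x ∂ν := fun i f g hfg =>
    setIntegral_congr_fun hs fun x hx => by simp only [indicator_of_mem hx, hfg x hx]
  have hi : ∀ i, ∀ x ∈ s, s.indicator (p i) x = p i x := fun i x hx => indicator_of_mem hx _
  exact
    { measurable := fun i => (hp.measurable i).indicator hs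
      norm_le := fun i x => (norm_indicator_le_norm_self _ _).trans (hp.norm_le i x)
      orthogonal := fun i j hij => by rw [hc i _ _ (hi j), hp.orthogonal i j hij]
      ne_zero := fun i => by
        rw [hc i _ _ (hi i)]
        exact hp.ne_zero i
      separating := fun f hf h => hp.separating f hf fun i => by
        rw [← h i, hc i f f fun _ _ => rfl] }

theorem cut_eq_indicator (a b : ℝ) (S : ℝ → ℝ) :
    cut a b S = (Ioo a b).indicator fun x => (S x : ℂ) := by
  funext x
  by_cases hx : x ∈ Ioo a b
  · rw [cut_of_mem hx, indicator_of_mem hx]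
  · rw [cut_of_notMem hx, indicator_of_notMem hx]

namespace Cuboid

variable (D : Cuboid)

theorem volume_restrict_Omega : (volume : Measure R3).restrict D.Omega =
    (volume.restrict D.I₁).prod ((volume.restrict D.I₂).prod (volume.restrict D.I₃)) := by
  rw [Measure.prod_restrict, Measure.prod_restrict]
  rfl

theorem volume_restrict_U : (volume : Measure (ℝ × ℝ)).restrict D.U =
    (volume.restrict D.I₂).prod (volume.restrict D.I₃) := by
  rw [Measure.prod_restrict]
  rfl

theorem isOrthogonalSystem_mode {ι : Type*} [Countable ι] {r : ι → ℝ → ℂ}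
    (hr : IsOrthogonalSystem (volume.restrict D.I₃) r) :
    IsOrthogonalSystem (volume.restrict D.Omega)
      (fun i : ℤ × ℤ × ι => mode (freq D.l₁ i.1) (freq D.l₂ i.2.1) (r i.2.2)) := by
  rw [volume_restrict_Omega]
  exact (isOrthogonalSystem_ex D.l₁_pos).prod ((isOrthogonalSystem_ex D.l₂_pos).prod hr)

/-- A Helmholtz-type problem in a space `S` of functions, whose graphs with respect to some partial
derivatives form the closed subspace `V`. -/
theorem existsUnique_of_graph {m : ℕ} (idx : Fin m → Fin 3) {S : Set D.L2}
    {V : Submodule ℂ (GraphSpace (volume.restrict D.Omega) m)}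
    (hV : IsClosed (V : Set (GraphSpace (volume.restrict D.Omega) m)))
    (hVS : ∀ p ∈ V, p 0 ∈ S ∧ ∀ i, D.pd (idx i) (p 0) =ᵐ[volume.restrict D.Omega] p i.succ)
    (hSV : ∀ u ∈ S, ∃ p ∈ V, p 0 = u)
    {ι : Type*} {e : ι → GraphSpace (volume.restrict D.Omega) m}
    (he : ∀ k, e k ∈ V) (hCe : ∀ k, conjGraph (e k) ∈ V)
    (ho : ∀ k l, k ≠ l → inner ℂ (e k 0) (e l 0) = 0) (hne : ∀ k, e k 0 ≠ 0)
    (htot : ∀ u : D.L2, (∀ k, inner ℂ (e k 0) u = 0) → u = 0)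
    {lam : ι → ℝ} (hlam : ∀ k, 0 ≤ lam k)
    (hgreen : ∀ k, ∀ p ∈ V,
      ∑ i : Fin m, inner ℂ (e k i.succ) (p i.succ) = lam k * inner ℂ (e k 0) (p 0))
    {κ : ℝ} {c : ℝ} (hc : 0 < c) (hκ : ∀ k, c ≤ |lam k - κ|) (f : D.L2) (G : Fin m → D.L2) :
    ∃! u : D.L2, u ∈ S ∧ ∀ φ ∈ S,
      (∫ x in D.Omega, ((∑ i, D.pd (idx i) u x * D.pd (idx i) φ x) - κ * u x * φ x)) =
        ∫ x in D.Omega, ((∑ i, G i x * D.pd (idx i) φ x) + f x * φ x) := by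
  -- Weak derivatives are unique, so a graph is determined by its function. This makes problems in
  -- `S` and in `V` equivalent.
  have huniq : ∀ p ∈ V, ∀ p' ∈ V, p 0 = p' 0 → p = p' := by
    intro p hp p' hp' h
    ext1 i
    refine Fin.cases h (fun i => ?_) i
    refine Lp.ext (((hVS p hp).2 i).symm.trans ?_)
    rw [h]
    exact (hVS p' hp').2 i
  have hint : ∀ p ∈ V, ∀ q ∈ V,
      (∫ x in D.Omega, ((∑ i, D.pd (idx i) (p 0) x * D.pd (idx i) (q 0) x) - κ * p 0 x * q 0 x)) =
      ∫ x in D.Omega, ((∑ i : Fin m, p i.succ x * q i.succ x) - κ * p 0 x * q 0 x) := by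
    intro p hp q hq
    refine integral_congr_ae ?_
    filter_upwards [ae_all_iff.2 (hVS p hp).2, ae_all_iff.2 (hVS q hq).2] with x h1 h2
    simp only [h1, h2]
  have hint' : ∀ q ∈ V,
      (∫ x in D.Omega, ((∑ i, G i x * D.pd (idx i) (q 0) x) + f x * q 0 x)) =
      ∫ x in D.Omega, ((∑ i : Fin m, G i x * q i.succ x) + f x * q 0 x) := by
    intro q hq
    refine integral_congr_ae ?_
    filter_upwards [ae_all_iff.2 (hVS q hq).2] with x h2
    simp only [h2]
  obtain ⟨p, ⟨hpV, hp⟩, hu⟩ := existsUnique_helmholtz hV he hCe ho hne htot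
    (fun p hp h => huniq p hp 0 V.zero_mem h) hlam hgreen hc hκ f G
  refine ⟨p 0, ⟨(hVS p hpV).1, fun φ hφ => ?_⟩, ?_⟩
  · obtain ⟨q, hq, rfl⟩ := hSV φ hφ
    rw [hint p hpV q hq, hint' q hq]
    exact hp q hq
  · rintro u ⟨huS, h⟩
    obtain ⟨p', hp', rfl⟩ := hSV u huS
    have := hu p' ⟨hp', fun q hq => by
      rw [← hint p' hp' q hq, ← hint' q hq]
      exact h _ (hVS q hq).1⟩
    rw [this]

end Cuboid

end Systems

/-! ### Periodic weak derivatives in one variable, and sections of functions on `Ω`. -/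

section OneDim

open scoped ContDiff ComplexConjugate
open Filter Topology

namespace Cuboid

variable (D : Cuboid)

instance isFiniteMeasure_I₁ : IsFiniteMeasure ((volume : Measure ℝ).restrict D.I₁) :=
  inferInstanceAs (IsFiniteMeasure ((volume : Measure ℝ).restrict (Ioo 0 D.l₁)))

/-- The map that folds the line onto `I₁`. -/
def fold₁ (t : ℝ) : ℝ := D.l₁ * Int.fract (t / D.l₁)

theorem isTiling_fold₁ : IsTiling D.I₁ univ (fun m : ℤ => m * D.l₁) D.fold₁ := D.isTiling_one

theorem memLp_ex (k : ℤ) : MemLp (ex (freq D.l₁ k)) 2 (volume.restrict D.I₁) :=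
  memLp_of_norm_le (contDiff_ex _ (n := 0)).continuous.measurable fun t => (norm_ex _ t).le

/-- Periodicity removes the boundary terms: an exponential is the periodization of a test function.
The exponential is not conjugated here, so the usual coefficient formula is the case of `-k`. -/
theorem integral_ex_mul_of_isWeakDeriv {u g : ℝ → ℂ} (hu : IntegrableOn u D.I₁)
    (hg : IntegrableOn g D.I₁) (hd : IsWeakDeriv univ (1 : ℝ) (u ∘ D.fold₁) (g ∘ D.fold₁)) (k : ℤ) :
    ∫ t in D.I₁, ex (freq D.l₁ k) t * g t =
      -(freq D.l₁ k * Complex.I) * ∫ t in D.I₁, ex (freq D.l₁ k) t * u t := by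
  let φ : ℝ → ℂ := fun t => (partitionFun D.l₁ t : ℂ) * ex (freq D.l₁ k) t
  have hφ : ContDiff ℝ ∞ φ :=
    (Complex.ofRealCLM.contDiff.comp (contDiff_partitionFun _)).mul (contDiff_ex _)
  have hφK : tsupport φ ⊆ Icc 0 (2 * D.l₁) := by
    refine closure_minimal (fun t ht => ?_) isClosed_Icc
    have h1 := left_ne_zero_of_mul ht
    rw [Complex.ofReal_ne_zero] at h1
    exact support_partitionFun_subset D.l₁_pos h1
  have key := D.isTiling_fold₁.setIntegral_periodic hu hg hd hφ
    (isCompact_Icc.of_isClosed_subset (isClosed_tsupport _) hφK) (subset_univ _) {0, 1}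
    (fun m t ht hm => mem_pair_of_add_mem_Icc D.l₁_pos ht (hφK hm)) (Φ := ex (freq D.l₁ k)) (by
      intro t ht
      rw [Finset.sum_pair (by norm_num)]
      have hp : ex (freq D.l₁ k) D.l₁ = 1 := by simpa [freq] using ex_mul_int_period D.l₁_pos k 1
      simp only [φ, ex_add, hp, mul_one, Int.cast_zero, zero_mul, add_zero, Int.cast_one, one_mul]
      rw [← add_mul, ← Complex.ofReal_add, partitionFun_add D.l₁_pos ht]
      simp)
  have e1 : ∀ t, fderiv ℝ (ex (freq D.l₁ k)) t 1 = freq D.l₁ k * Complex.I * ex (freq D.l₁ k) t :=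
    fun t => by rw [fderiv_apply_one_eq_deriv, (hasDerivAt_ex _ t).deriv]
  simp only [e1, mul_left_comm (u _), integral_const_mul] at key
  simp only [mul_comm (ex _ _)]
  rw [neg_mul, key, neg_neg]

/-- Periodic functions with a weak derivative, in terms of Fourier coefficients. -/
theorem isWeakDeriv_fold₁_of_fourier {u g : ℝ → ℂ} (hu : MemLp u 2 (volume.restrict D.I₁))
    (hg : MemLp g 2 (volume.restrict D.I₁))
    (h : ∀ k : ℤ, ∫ t in D.I₁, conj (ex (freq D.l₁ k) t) * g t =
      freq D.l₁ k * Complex.I * ∫ t in D.I₁, conj (ex (freq D.l₁ k) t) * u t) :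
    IsWeakDeriv univ (1 : ℝ) (u ∘ D.fold₁) (g ∘ D.fold₁) := by
  let ν : Measure ℝ := volume.restrict D.I₁
  have hT := D.isTiling_fold₁
  obtain ⟨S₀, hS₀, hmem₀⟩ := hT.exists_submodule (1 : ℝ)
  let pr : GraphSpace ν 1 →L[ℂ] Lp ℂ 2 ν × Lp ℂ 2 ν :=
    (PiLp.proj 2 (fun _ : Fin 2 => Lp ℂ 2 ν) 0).prod (PiLp.proj 2 (fun _ : Fin 2 => Lp ℂ 2 ν) 1)
  let S : Submodule ℂ (GraphSpace ν 1) := S₀.comap pr.toLinearMap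
  have hS : IsClosed (S : Set (GraphSpace ν 1)) := hS₀.preimage pr.continuous
  have hmem : ∀ p : GraphSpace ν 1, p ∈ S ↔ IsWeakDeriv univ (1 : ℝ) (p 0 ∘ D.fold₁)
      (p 1 ∘ D.fold₁) := fun p => hmem₀ (pr p)
  have hsys : IsOrthogonalSystem ν fun k : ℤ => ex (freq D.l₁ k) := isOrthogonalSystem_ex D.l₁_pos
  let b : ℤ → Lp ℂ 2 ν := fun k => toL2 ν (ex (freq D.l₁ k))
  -- `R` consists of the pairs satisfying the Fourier relation, `S` of the pairs with the weak
  -- derivative relation, and `S ≤ R`. If a pair in `R` is orthogonal to the graphs `e k ∈ S` of the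
  -- exponentials, then `1 + freq²` times each coefficient of its first entry is zero, so the pair
  -- vanishes and `S = R`.
  let R : Submodule ℂ (GraphSpace ν 1) := ⨅ k : ℤ, LinearMap.ker
    ((innerSL ℂ (b k)).toLinearMap ∘ₗ (PiLp.proj 2 (fun _ : Fin 2 => Lp ℂ 2 ν) 1).toLinearMap -
      (freq D.l₁ k * Complex.I : ℂ) • ((innerSL ℂ (b k)).toLinearMap ∘ₗ
        (PiLp.proj 2 (fun _ : Fin 2 => Lp ℂ 2 ν) 0).toLinearMap))
  have hR : ∀ p : GraphSpace ν 1, p ∈ R ↔ ∀ k, inner ℂ (b k) (p 1) =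
      freq D.l₁ k * Complex.I * inner ℂ (b k) (p 0) := fun p => by
    simp [R, Submodule.mem_iInf, LinearMap.mem_ker, sub_eq_zero]
  have hSR : S ≤ R := by
    intro p hp
    rw [hR]
    intro k
    have h1 := D.integral_ex_mul_of_isWeakDeriv ((Lp.memLp (p 0)).integrable (by norm_num))
      ((Lp.memLp (p 1)).integrable (by norm_num)) ((hmem p).1 hp) (-k)
    rw [inner_toL2 (D.memLp_ex k), inner_toL2 (D.memLp_ex k)]
    simp only [conj_ex]
    rw [freq_neg] at h1
    rw [h1]
    push_cast
    ring
  let e : ℤ → GraphSpace ν 1 := fun k => WithLp.toLp 2 ![b k, (freq D.l₁ k * Complex.I : ℂ) • b k]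
  have he : ∀ k, e k ∈ S := by
    intro k
    rw [hmem]
    have hper : ex (freq D.l₁ k) ∘ D.fold₁ = ex (freq D.l₁ k) :=
      funext fun t => ex_fold D.l₁_pos k t
    have h1 : IsWeakDeriv univ (1 : ℝ) (ex (freq D.l₁ k))
        (fun t => freq D.l₁ k * Complex.I * ex (freq D.l₁ k) t) := by
      have := isWeakDeriv_of_contDiffOn isOpen_univ (contDiff_ex (freq D.l₁ k)).contDiffOn (1 : ℝ)
      refine this.congr .rfl (.of_forall fun t => ?_)
      simp only
      rw [fderiv_apply_one_eq_deriv, (hasDerivAt_ex _ t).deriv]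
    have h2 := hT.ae_fold (coeFn_toL2 (D.memLp_ex k))
    have h3 := hT.ae_fold (Lp.coeFn_smul (freq D.l₁ k * Complex.I : ℂ) (b k))
    have hper' : ∀ t, ex (freq D.l₁ k) (D.fold₁ t) = ex (freq D.l₁ k) t := congrFun hper
    refine h1.congr ?_ ?_
    · filter_upwards [h2] with t ht
      exact (hper' t).symm.trans ht.symm
    · filter_upwards [h2, h3] with t ht ht'
      refine Eq.trans ?_ ht'.symm
      rw [Pi.smul_apply, smul_eq_mul]
      refine congrArg _ ((hper' t).symm.trans ht.symm)
  have : CompleteSpace S := hS.completeSpace_coe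
  have h1 : S ⊔ Sᗮ ⊓ R = R := Submodule.sup_orthogonal_inf_of_hasOrthogonalProjection hSR
  have h2 : Sᗮ ⊓ R = ⊥ := by
    rw [Submodule.eq_bot_iff]
    rintro p ⟨hpS, hpR⟩
    have hpR' := (hR p).1 hpR
    have h0 : ∀ k, inner ℂ (b k) (p 0) = 0 := by
      intro k
      have h3 := (Submodule.mem_orthogonal _ _).1 hpS _ (he k)
      rw [PiLp.inner_apply, Fin.sum_univ_two] at h3
      have h4 : inner ℂ (b k) (p 0) + inner ℂ ((freq D.l₁ k * Complex.I : ℂ) • b k) (p 1) = 0 := h3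
      rw [inner_smul_left, hpR' k] at h4
      have h5 : ((1 + freq D.l₁ k ^ 2 : ℝ) : ℂ) * inner ℂ (b k) (p 0) = 0 := by
        rw [← h4]
        simp only [map_mul, Complex.conj_ofReal, Complex.conj_I]
        push_cast
        linear_combination ((freq D.l₁ k : ℂ) ^ 2 * inner ℂ (b k) (p 0)) * Complex.I_mul_I
      have h6 : ((1 + freq D.l₁ k ^ 2 : ℝ) : ℂ) ≠ 0 := by
        have : 0 < 1 + freq D.l₁ k ^ 2 := by positivity
        exact_mod_cast this.ne'
      exact (mul_eq_zero.1 h5).resolve_left h6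
    have hp0 : p 0 = 0 := hsys.eq_zero_of_inner _ h0
    have hp1 : p 1 = 0 := hsys.eq_zero_of_inner _ fun k => by
      have := hpR' k
      rw [h0 k, mul_zero] at this
      exact this
    ext1 i
    fin_cases i
    · exact hp0
    · exact hp1
  rw [h2, sup_bot_eq] at h1
  have hp : (WithLp.toLp 2 ![toL2 ν u, toL2 ν g] : GraphSpace ν 1) ∈ S := by
    rw [h1, hR]
    intro k
    have := h k
    refine Eq.trans ?_ (this.trans ?_)
    · refine (inner_toL2 (D.memLp_ex k) _).trans (integral_congr_ae ?_)
      filter_upwards [coeFn_toL2 hg] with t ht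
      exact congrArg _ ht
    · refine congrArg _ ((inner_toL2 (D.memLp_ex k) _).trans (integral_congr_ae ?_)).symm
      filter_upwards [coeFn_toL2 hu] with t ht
      exact congrArg _ ht
  exact ((hmem _).1 hp).congr (hT.ae_fold (coeFn_toL2 hu)) (hT.ae_fold (coeFn_toL2 hg))

theorem mem_H1perI₁ {u g : ℝ → ℂ} (hu : MemLp u 2 (volume.restrict D.I₁))
    (hg : MemLp g 2 (volume.restrict D.I₁))
    (h : IsWeakDeriv univ (1 : ℝ) (u ∘ D.fold₁) (g ∘ D.fold₁)) : u ∈ D.H1perI₁ := by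
  have hT := D.isTiling_fold₁
  have hv : ∀ v : ℝ, IsWeakDeriv univ v (u ∘ D.fold₁) ((fun t => (v : ℂ) * g t) ∘ D.fold₁) :=
    fun v => by
      have := h.smul_dir v
      rw [smul_eq_mul, mul_one] at this
      exact this
  exact ⟨⟨hu, fun v => ⟨_, hg.const_mul _, hT.isWeakDeriv_of_fold (hv v)⟩⟩,
    hT.memL2loc_fold hu, fun v => ⟨_, hT.memL2loc_fold (hg.const_mul _), hv v⟩⟩

/-- Sections in the first variable of a function in `L²(Ω)`. -/
theorem memLp_section {u : R3 → ℂ} (hu : MemLp u 2 (volume.restrict D.Omega)) :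
    ∀ᵐ y ∂(volume.restrict D.U), MemLp (fun t => u (t, y)) 2 (volume.restrict D.I₁) := by
  have hm : AEStronglyMeasurable u ((volume.restrict D.I₁).prod (volume.restrict D.U)) := by
    have := hu.1
    rwa [volume_restrict_Omega, ← volume_restrict_U] at this
  have hi := (memLp_two_iff_integrable_sq_norm hu.1).1 hu
  rw [volume_restrict_Omega, ← volume_restrict_U] at hi
  have hm' : ∀ᵐ y ∂(volume.restrict D.U),
      AEStronglyMeasurable (fun t => u (t, y)) (volume.restrict D.I₁) := by
    have := hm.prod_swap.prodMk_left
    exact this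
  filter_upwards [hm', hi.prod_left_ae] with y h1 h2
  exact (memLp_two_iff_integrable_sq_norm h1).2 h2

theorem integral_Omega {F : R3 → ℂ} (hF : IntegrableOn F D.Omega) :
    ∫ x in D.Omega, F x = ∫ y in D.U, ∫ t in D.I₁, F (t, y) := by
  rw [IntegrableOn, volume_restrict_Omega, ← volume_restrict_U] at hF
  rw [volume_restrict_Omega, ← volume_restrict_U]
  exact integral_prod_symm _ hF

/-- A weak derivative of almost all sections is a weak derivative. -/
theorem isWeakDeriv_of_section {u g : R3 → ℂ} (hu : MemLp u 2 (volume.restrict D.Omega))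
    (hg : MemLp g 2 (volume.restrict D.Omega))
    (h : ∀ᵐ y ∂(volume.restrict D.U),
      IsWeakDeriv D.I₁ (1 : ℝ) (fun t => u (t, y)) (fun t => g (t, y))) :
    IsWeakDeriv D.Omega (dir 0) u g := by
  intro φ hφ hc hs
  have i1 := integrableOn_mul_of_tsupport_subset hu.locallyIntegrableOn_two
    (continuous_fderiv_apply_const hφ (dir 0)) (hasCompactSupport_fderiv_apply hc (dir 0))
    ((tsupport_fderiv_apply_subset' φ (dir 0)).trans hs)
  have i2 := integrableOn_mul_of_tsupport_subset hg.locallyIntegrableOn_two hφ.continuous hc hs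
  rw [D.integral_Omega i1, D.integral_Omega i2, ← integral_neg]
  refine integral_congr_ae ?_
  filter_upwards [h] with y hy
  have hcd : ContDiff ℝ ∞ fun t : ℝ => ((t, y) : R3) := contDiff_id.prodMk contDiff_const
  have hψ : ContDiff ℝ ∞ fun t => φ (t, y) := hφ.comp hcd
  have hts : tsupport (fun t => φ (t, y)) ⊆ (fun t : ℝ => ((t, y) : R3)) ⁻¹' tsupport φ :=
    tsupport_comp_subset_preimage φ hcd.continuous
  have hψs : tsupport (fun t => φ (t, y)) ⊆ D.I₁ := fun t ht => (hs (hts ht)).1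
  have hψc : HasCompactSupport fun t => φ (t, y) :=
    isCompact_Icc.of_isClosed_subset (isClosed_tsupport _)
      (hψs.trans (Ioo_subset_Icc_self (a := 0) (b := D.l₁)))
  have := hy _ hψ hψc hψs
  refine Eq.trans (integral_congr_ae (.of_forall fun t => ?_)) this
  simp only
  congr 1
  have h1 : HasFDerivAt φ (fderiv ℝ φ (t, y)) (t, y) := (hφ.differentiable (by simp) _).hasFDerivAt
  have h2 : HasDerivAt (fun t : ℝ => ((t, y) : R3)) (dir 0) t := by
    have := (hasDerivAt_id t).prodMk (hasDerivAt_const t y)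
    exact this
  have h3 : deriv (fun t => φ (t, y)) t = _ := (h1.comp_hasDerivAt t h2).deriv
  rw [fderiv_apply_one_eq_deriv, h3]

end Cuboid

end OneDim

/-! ### The distance of `ω²εμ` to the eigenvalues. -/

section Gap

theorem finite_sq_le {a : ℝ} (ha : 0 < a) (R : ℝ) : {k : ℕ | (a * k) ^ 2 ≤ R}.Finite := by
  refine (Set.finite_Iic ⌈R / a ^ 2⌉₊).subset fun k hk => ?_
  have h1 : (k : ℝ) ^ 2 ≤ R / a ^ 2 := by
    rw [le_div_iff₀ (by positivity)]
    have : (a * k) ^ 2 ≤ R := hk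
    nlinarith
  have h2 : (k : ℝ) ≤ (k : ℝ) ^ 2 := by
    exact_mod_cast Nat.le_self_pow two_ne_zero k
  have h3 : (k : ℝ) ≤ ⌈R / a ^ 2⌉₊ := h2.trans (h1.trans (Nat.le_ceil _))
  exact_mod_cast h3

/-- Outside of the spectrum, there is a positive distance to the spectrum. -/
theorem exists_gap {ε μ ω L₁ L₂ L₃ : ℝ} (hε : 0 < ε) (hμ : 0 < μ) (h₁ : 0 < L₁) (h₂ : 0 < L₂)
    (h₃ : 0 < L₃) (h : ω ^ 2 ∉ sigma ε μ L₁ L₂ L₃) :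
    ∃ c, 0 < c ∧ ∀ (k n : ℤ) (j : ℕ), c ≤ |Cuboid.freq L₁ k ^ 2 + Cuboid.freq L₂ n ^ 2 +
      (Real.pi * j / L₃) ^ 2 - ω ^ 2 * ε * μ| := by
  have hπ := Real.pi_pos
  let F : ℕ × ℕ × ℕ → ℝ := fun i =>
    (2 * Real.pi / L₁ * i.1) ^ 2 + (2 * Real.pi / L₂ * i.2.1) ^ 2 + (Real.pi / L₃ * i.2.2) ^ 2
  have hF : ∀ i, F i ≠ ω ^ 2 * ε * μ := by
    intro i hi
    refine h ⟨i.1, i.2.1, i.2.2, ?_⟩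
    have : ω ^ 2 = F i / (ε * μ) := by
      rw [hi]
      field_simp
    rw [this]
    simp only [F]
    field_simp
    ring
  -- Only finitely many eigenvalue indices have to be considered; the other eigenvalues are at
  -- distance at least one.
  have hfin : {i | F i ≤ ω ^ 2 * ε * μ + 1}.Finite := by
    refine ((finite_sq_le (a := 2 * Real.pi / L₁) (by positivity) (ω ^ 2 * ε * μ + 1)).prod
      ((finite_sq_le (a := 2 * Real.pi / L₂) (by positivity) (ω ^ 2 * ε * μ + 1)).prod
      (finite_sq_le (a := Real.pi / L₃) (by positivity) (ω ^ 2 * ε * μ + 1)))).subset ?_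
    intro i hi
    have hi' : F i ≤ ω ^ 2 * ε * μ + 1 := hi
    simp only [F] at hi'
    have p1 := sq_nonneg (2 * Real.pi / L₁ * i.1)
    have p2 := sq_nonneg (2 * Real.pi / L₂ * i.2.1)
    have p3 := sq_nonneg (Real.pi / L₃ * i.2.2)
    refine ⟨?_, ?_, ?_⟩ <;> simp only [mem_ofPred_eq] <;> linarith
  obtain ⟨c, hc, hcF⟩ : ∃ c, 0 < c ∧ ∀ i, c ≤ |F i - ω ^ 2 * ε * μ| := by
    have hbig : ∀ i, ¬ F i ≤ ω ^ 2 * ε * μ + 1 → 1 ≤ |F i - ω ^ 2 * ε * μ| := fun i hi =>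
      le_abs.2 (Or.inl (by linarith))
    rcases Set.eq_empty_or_nonempty {i | F i ≤ ω ^ 2 * ε * μ + 1} with he | hne
    · exact ⟨1, one_pos, fun i => hbig i fun hi => (Set.eq_empty_iff_forall_notMem.1 he i) hi⟩
    · obtain ⟨a, -, ha⟩ := Set.exists_min_image _ (fun i => |F i - ω ^ 2 * ε * μ|) hfin hne
      refine ⟨min 1 |F a - ω ^ 2 * ε * μ|,
        lt_min one_pos (abs_pos.2 (sub_ne_zero.2 (hF a))), fun i => ?_⟩
      by_cases hi : F i ≤ ω ^ 2 * ε * μ + 1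
      · exact (min_le_right _ _).trans (ha i hi)
      · exact (min_le_left _ _).trans (hbig i hi)
  refine ⟨c, hc, fun k n j => ?_⟩
  have := hcF (k.natAbs, n.natAbs, j)
  -- The spectrum is indexed by natural numbers, the exponentials by integers; only the squares
  -- matter.
  have e : ∀ (L : ℝ) (k : ℤ), (2 * Real.pi / L * (k.natAbs : ℝ)) ^ 2 = Cuboid.freq L k ^ 2 := by
    intro L k
    have : ((k.natAbs : ℕ) : ℝ) ^ 2 = (k : ℝ) ^ 2 := by
      rw [← Int.cast_natCast, Int.natCast_natAbs, Int.cast_abs, sq_abs]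
    rw [Cuboid.freq, mul_pow, this]
    ring
  simp only [F, e] at this
  rwa [div_mul_eq_mul_div] at this

end Gap

/-! ### The space `W` in terms of Fourier coefficients, and the problem in the first variable. -/

section SpaceW

open scoped ComplexConjugate
open Filter Topology

namespace Cuboid

variable (D : Cuboid)

/-- The cosine system of the interval `I₃`, extended by zero. -/
def cosFun (j : ℕ) : ℝ → ℂ :=
  cut (-D.l₃m) D.l₃p fun x => Real.cos (Real.pi * j / D.l₃ * (x - -D.l₃m))

theorem l₃_eq : D.l₃p - -D.l₃m = D.l₃ := by
  rw [sub_neg_eq_add]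
  rfl

theorem I₃_lt : -D.l₃m < D.l₃p := by linarith [D.l₃p_pos, D.l₃m_pos]

theorem isOrthogonalSystem_cosFun : IsOrthogonalSystem (volume.restrict D.I₃) D.cosFun := by
  have h := (isOrthogonalSystem_cos D.I₃_lt).indicator measurableSet_Ioo
  have e : D.cosFun = fun j : ℕ => (Ioo (-D.l₃m) D.l₃p).indicator fun x =>
      (Real.cos (Real.pi * j / (D.l₃p - -D.l₃m) * (x - -D.l₃m)) : ℂ) := by
    funext j
    rw [cosFun, cut_eq_indicator, l₃_eq]
  rw [e]
  exact h

theorem conj_cut (a b : ℝ) (S : ℝ → ℝ) (x : ℝ) : conj (cut a b S x) = cut a b S x :=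
  Complex.conj_ofReal _

/-- The modes with cosines in the third variable. -/
def cosMode (i : ℤ × ℤ × ℕ) : R3 → ℂ :=
  mode (freq D.l₁ i.1) (freq D.l₂ i.2.1) (D.cosFun i.2.2)

theorem isOrthogonalSystem_cosMode : IsOrthogonalSystem (volume.restrict D.Omega) D.cosMode :=
  D.isOrthogonalSystem_mode D.isOrthogonalSystem_cosFun

theorem conj_cosMode (i : ℤ × ℤ × ℕ) (x : R3) :
    conj (D.cosMode i x) = D.cosMode (-i.1, -i.2.1, i.2.2) x := by
  rw [cosMode, cosMode, conj_mode, freq_neg, freq_neg]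
  simp only [cosFun, conj_cut]

theorem integrableOn_section {F : R3 → ℂ} (hF : IntegrableOn F D.Omega) :
    IntegrableOn (fun y => ∫ t in D.I₁, F (t, y)) D.U := by
  rw [IntegrableOn, volume_restrict_Omega, ← volume_restrict_U] at hF
  exact hF.integral_prod_right

/-- The functions in `W` and their derivatives, in terms of modes. -/
theorem section_iff (u g : D.L2) :
    (∀ᵐ y ∂(volume.restrict D.U), (fun t => u (t, y)) ∈ D.H1perI₁ ∧
      IsWeakDeriv D.I₁ (1 : ℝ) (fun t => u (t, y)) (fun t => g (t, y))) ↔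
    ∀ i, inner ℂ (toL2 (volume.restrict D.Omega) (D.cosMode i)) g =
      freq D.l₁ i.1 * Complex.I * inner ℂ (toL2 (volume.restrict D.Omega) (D.cosMode i)) u := by
  have hsys := D.isOrthogonalSystem_cosMode
  have hsysU := (isOrthogonalSystem_ex D.l₂_pos).prod D.isOrthogonalSystem_cosFun
  have hU : (volume.restrict (Ioo 0 D.l₂)).prod (volume.restrict D.I₃) = volume.restrict D.U :=
    D.volume_restrict_U.symm
  rw [hU] at hsysU
  have hI : ∀ (f : D.L2) i, Integrable (fun x => conj (D.cosMode i x) * f x)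
      (volume.restrict D.Omega) := fun f i =>
    hsys.integrable_mul ((Lp.memLp f).integrable (by norm_num)) i
  have hinner : ∀ (f : D.L2) i, inner ℂ (toL2 (volume.restrict D.Omega) (D.cosMode i)) f =
      ∫ y in D.U, conj (ex (freq D.l₂ i.2.1) y.1 * D.cosFun i.2.2 y.2) *
        ∫ t in D.I₁, conj (ex (freq D.l₁ i.1) t) * f (t, y) := by
    intro f i
    rw [inner_toL2 (hsys.memLp i), D.integral_Omega (hI f i)]
    refine integral_congr_ae (.of_forall fun y => ?_)
    simp only
    rw [← integral_const_mul]
    refine integral_congr_ae (.of_forall fun t => ?_)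
    simp only [cosMode, mode, map_mul]
    ring
  have hsu := D.memLp_section (Lp.memLp u)
  have hsg := D.memLp_section (Lp.memLp g)
  constructor
  · intro h i
    rw [hinner, hinner, ← integral_const_mul]
    refine integral_congr_ae ?_
    filter_upwards [h, hsu, hsg] with y hy hyu hyg
    have h1 := D.isTiling_fold₁.isWeakDeriv_fold (u := fun t => u (t, y)) hyg hy.1.2 hy.2
    have h2 := D.integral_ex_mul_of_isWeakDeriv (hyu.integrable (by norm_num))
      (hyg.integrable (by norm_num)) h1 (-i.1)
    simp only [conj_ex, freq_neg] at h2 ⊢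
    rw [h2]
    push_cast
    ring
  · intro h
    have hk : ∀ k : ℤ, ∀ᵐ y ∂(volume.restrict D.U),
        ∫ t in D.I₁, conj (ex (freq D.l₁ k) t) * g (t, y) =
          freq D.l₁ k * Complex.I * ∫ t in D.I₁, conj (ex (freq D.l₁ k) t) * u (t, y) := by
      intro k
      -- For fixed `k`, the defect of the Fourier relation is an integrable function of `y` whose
      -- coefficients with respect to a complete system on `U` are zero. It vanishes for almost
      -- every `y`, then simultaneously for all of the countably many `k`.
      let F : D.L2 → ℝ × ℝ → ℂ := fun f y => ∫ t in D.I₁, conj (ex (freq D.l₁ k) t) * f (t, y)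
      have hFi : ∀ f, IntegrableOn (F f) D.U := by
        intro f
        have h1 : Integrable (fun x : R3 => conj (ex (freq D.l₁ k) x.1) * f x)
            (volume.restrict D.Omega) :=
          ((Lp.memLp f).integrable (by norm_num)).bdd_mul (c := 1)
            (Complex.continuous_conj.measurable.comp ((contDiff_ex _ (n := 0)).continuous.measurable.comp
              measurable_fst)).aestronglyMeasurable
            (.of_forall fun x => by simp [norm_ex])
        exact D.integrableOn_section h1
      have hz := hsysU.separating (fun y => F g y - freq D.l₁ k * Complex.I * F u y)
        ((hFi g).sub ((hFi u).const_mul _)) fun j => by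
          have h1 := h (k, j.1, j.2)
          rw [hinner, hinner] at h1
          simp only [mul_sub, mul_left_comm _ (_ * Complex.I)]
          rw [integral_sub (hsysU.integrable_mul (hFi g) j)
            ((hsysU.integrable_mul (hFi u) j).const_mul _), integral_const_mul, sub_eq_zero]
          exact h1
      filter_upwards [hz] with y hy
      exact sub_eq_zero.1 hy
    filter_upwards [ae_all_iff.2 hk, hsu, hsg] with y hy hyu hyg
    have h1 := D.isWeakDeriv_fold₁_of_fourier hyu hyg hy
    exact ⟨D.mem_H1perI₁ hyu hyg h1, D.isTiling_fold₁.isWeakDeriv_of_fold h1⟩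

/-- Solvability of the problem in one variable. -/
theorem existsUnique_W {κ c : ℝ} (hc : 0 < c) (hκ : ∀ k : ℤ, c ≤ |freq D.l₁ k ^ 2 - κ|)
    (f G : D.L2) :
    ∃! u : D.L2, u ∈ D.W ∧ ∀ φ ∈ D.W,
      (∫ x in D.Omega, (D.pd 0 u x * D.pd 0 φ x - κ * u x * φ x)) =
        ∫ x in D.Omega, (G x * D.pd 0 φ x + f x * φ x) := by
  let ν : Measure R3 := volume.restrict D.Omega
  have hsys := D.isOrthogonalSystem_cosMode
  let b : ℤ × ℤ × ℕ → D.L2 := fun i => toL2 ν (D.cosMode i)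
  -- The graph space is defined by the Fourier relations of `section_iff`, so that its closedness is
  -- immediate. Cosines in `x₃` are an arbitrary choice here, because only `x₁` is differentiated.
  let V : Submodule ℂ (GraphSpace ν 1) := ⨅ i, LinearMap.ker
    ((innerSL ℂ (b i)) ∘L (PiLp.proj 2 (fun _ : Fin 2 => Lp ℂ 2 ν) 1) -
      (freq D.l₁ i.1 * Complex.I : ℂ) • ((innerSL ℂ (b i)) ∘L
        (PiLp.proj 2 (fun _ : Fin 2 => Lp ℂ 2 ν) 0))).toLinearMap
  have hVc : IsClosed (V : Set (GraphSpace ν 1)) := by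
    simp only [V, Submodule.coe_iInf]
    exact isClosed_iInter fun i => ContinuousLinearMap.isClosed_ker _
  have hV : ∀ p : GraphSpace ν 1, p ∈ V ↔ ∀ i, inner ℂ (b i) (p 1) =
      freq D.l₁ i.1 * Complex.I * inner ℂ (b i) (p 0) := fun p => by
    simp [V, Submodule.mem_iInf, LinearMap.mem_ker, sub_eq_zero]
  let e : ℤ × ℤ × ℕ → GraphSpace ν 1 := fun i =>
    WithLp.toLp 2 ![b i, (freq D.l₁ i.1 * Complex.I : ℂ) • b i]
  have he : ∀ i, e i ∈ V := by
    intro i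
    rw [hV]
    intro j
    have h1 : inner ℂ (b j) ((freq D.l₁ i.1 * Complex.I : ℂ) • b i) =
        freq D.l₁ j.1 * Complex.I * inner ℂ (b j) (b i) := by
      rw [inner_smul_right]
      by_cases hij : j = i
      · rw [hij]
      · rw [hsys.inner_eq_zero j i hij, mul_zero, mul_zero]
    exact h1
  have hCe : ∀ i, conjGraph (e i) = e (-i.1, -i.2.1, i.2.2) := by
    intro i
    have h1 : conjL2 (b i) = b (-i.1, -i.2.1, i.2.2) := by
      refine (conjL2_toL2 (hsys.memLp i)).trans ?_
      exact congrArg _ (funext fun x => D.conj_cosMode i x)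
    have h2 : conjL2 ((freq D.l₁ i.1 * Complex.I : ℂ) • b i) =
        (freq D.l₁ (-i.1) * Complex.I : ℂ) • b (-i.1, -i.2.1, i.2.2) := by
      rw [conjL2_smul, h1, freq_neg]
      simp
    ext1 k
    fin_cases k
    · exact h1
    · exact h2
  have hpd : ∀ p ∈ V, p 0 ∈ D.W ∧ ∀ i : Fin 1, D.pd (![0] i) (p 0) =ᵐ[ν] p i.succ := by
    intro p hp
    have h1 := (D.section_iff (p 0) (p 1)).2 ((hV p).1 hp)
    refine ⟨⟨p 1, h1⟩, fun i => ?_⟩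
    have h2 := D.isWeakDeriv_of_section (Lp.memLp (p 0)) (Lp.memLp (p 1)) (h1.mono fun y hy => hy.2)
    fin_cases i
    exact weakDeriv_ae_eq (D.isTiling_slab D.isOpen_I₃).isOpen_cell (Lp.memLp (p 1)) h2
  have := D.existsUnique_of_graph (m := 1) ![0] (S := D.W) hVc hpd
    (fun u hu => by
      obtain ⟨g, hg⟩ := hu
      exact ⟨WithLp.toLp 2 ![u, g], (hV _).2 ((D.section_iff u g).1 hg), rfl⟩)
    he (fun i => by rw [hCe]; exact he _) hsys.inner_eq_zero hsys.toL2_ne_zero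
    hsys.eq_zero_of_inner (lam := fun i => freq D.l₁ i.1 ^ 2) (fun i => sq_nonneg _)
    (fun i p hp => by
      have h1 : inner ℂ ((freq D.l₁ i.1 * Complex.I : ℂ) • b i) (p 1) =
          ((freq D.l₁ i.1 ^ 2 : ℝ) : ℂ) * inner ℂ (b i) (p 0) := by
        rw [inner_smul_left, (hV p).1 hp i]
        simp only [map_mul, Complex.conj_ofReal, Complex.conj_I]
        push_cast
        linear_combination (-(freq D.l₁ i.1 : ℂ) ^ 2 * inner ℂ (b i) (p 0)) * Complex.I_mul_I
      rw [Fin.sum_univ_one]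
      exact h1) hc (fun i => hκ i.1) f (fun _ => G)
  simpa using this

end Cuboid

end SpaceW

/-! ### Truncated sines and cosines and their derivatives. -/

section TrigCut

open scoped ContDiff ComplexConjugate
open Filter Topology

/-- `sin (γ (x - a))` in `(a, b)`, extended by zero. -/
def sinCut (a b γ : ℝ) : ℝ → ℂ := cut a b fun x => Real.sin (γ * (x - a))

/-- `cos (γ (x - a))` in `(a, b)`, extended by zero. -/
def cosCut (a b γ : ℝ) : ℝ → ℂ := cut a b fun x => Real.cos (γ * (x - a))

theorem norm_sinCut_le (a b γ x : ℝ) : ‖sinCut a b γ x‖ ≤ 1 :=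
  (norm_cut_le _ _ _ _).trans (Real.abs_sin_le_one _)

theorem norm_cosCut_le (a b γ x : ℝ) : ‖cosCut a b γ x‖ ≤ 1 :=
  (norm_cut_le _ _ _ _).trans (Real.abs_cos_le_one _)

theorem measurable_sinCut (a b γ : ℝ) : Measurable (sinCut a b γ) :=
  measurable_cut a b (Continuous.measurable (by fun_prop))

theorem measurable_cosCut (a b γ : ℝ) : Measurable (cosCut a b γ) :=
  measurable_cut a b (Continuous.measurable (by fun_prop))

theorem conj_sinCut (a b γ x : ℝ) : conj (sinCut a b γ x) = sinCut a b γ x := Complex.conj_ofReal _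

theorem conj_cosCut (a b γ x : ℝ) : conj (cosCut a b γ x) = cosCut a b γ x := Complex.conj_ofReal _

theorem isTestLimit_cosCut (a b γ : ℝ) : IsTestLimit a b (cosCut a b γ) :=
  isTestLimit_indicator (by fun_prop) fun _ => Real.abs_cos_le_one _

theorem cut_const_mul (a b c : ℝ) (S : ℝ → ℝ) : cut a b (fun x => c * S x) = fun x => c * cut a b S x := by
  funext x
  by_cases hx : x ∈ Ioo a b
  · rw [cut_of_mem hx, cut_of_mem hx, Complex.ofReal_mul]
  · rw [cut_of_notMem hx, cut_of_notMem hx, mul_zero]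

theorem isTestLimit₁_sinCut {a b γ : ℝ} (hb : Real.sin (γ * (b - a)) = 0) :
    IsTestLimit₁ a b (sinCut a b γ) (fun x => γ * cosCut a b γ x) := by
  -- For `γ = 0` the sine is identically zero, and truncation of small values, which needs `S ≠ 0`
  -- almost everywhere, is not available. This case is needed for the constant cosine.
  by_cases hγ : γ = 0
  · have h0 : sinCut a b γ = fun _ => 0 := by
      funext x
      simp [sinCut, cut, hγ]
    rw [h0, hγ]
    refine ⟨fun _ _ => 0, fun _ => contDiff_const, fun _ => HasCompactSupport.zero,
      fun _ => ?_, ⟨0, fun n x => by simp⟩, .of_forall fun x => by simp⟩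
    have : tsupport (fun _ : ℝ => (0 : ℂ)) = ∅ := tsupport_eq_empty_iff.2 rfl
    rw [this]
    exact empty_subset _
  · rw [cosCut, ← cut_const_mul]
    exact isTestLimit₁_sin hγ hb

theorem IsTestLimit₁.const_mul {a b : ℝ} {s s' : ℝ → ℂ} (h : IsTestLimit₁ a b s s') (c : ℂ) :
    IsTestLimit₁ a b (fun x => c * s x) (fun x => c * s' x) := by
  obtain ⟨f, h1, h2, h3, ⟨C, hC⟩, h4⟩ := h
  have hd : ∀ n x, deriv (fun x => c * f n x) x = c * deriv (f n) x := fun n x =>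
    deriv_const_mul c ((h1 n).differentiable (by simp) x)
  refine ⟨fun n x => c * f n x, fun n => contDiff_const.mul (h1 n), fun n => (h2 n).mul_left,
    fun n => (tsupport_mul_subset_right).trans (h3 n), ⟨‖c‖ * C, fun n x => ⟨?_, ?_⟩⟩, ?_⟩
  · rw [norm_mul]
    exact mul_le_mul_of_nonneg_left (hC n x).1 (norm_nonneg _)
  · rw [hd, norm_mul]
    exact mul_le_mul_of_nonneg_left (hC n x).2 (norm_nonneg _)
  · filter_upwards [h4] with x hx
    simp only [hd]
    exact ⟨hx.1.const_mul c, hx.2.const_mul c⟩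

theorem cut_eventuallyEq {a b t : ℝ} (ha : t ≠ a) (hb : t ≠ b) (S : ℝ → ℝ) :
    (t ∈ Ioo a b ∧ cut a b S =ᶠ[𝓝 t] fun x => (S x : ℂ)) ∨
      (t ∉ Ioo a b ∧ cut a b S =ᶠ[𝓝 t] fun _ => 0) := by
  by_cases ht : t ∈ Ioo a b
  · refine Or.inl ⟨ht, ?_⟩
    filter_upwards [isOpen_Ioo.mem_nhds ht] with x hx using cut_of_mem hx S
  · refine Or.inr ⟨ht, ?_⟩
    have ht' : t ∈ (Icc a b)ᶜ := fun h => ht ⟨lt_of_le_of_ne h.1 ha.symm, lt_of_le_of_ne h.2 hb⟩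
    filter_upwards [isClosed_Icc.isOpen_compl.mem_nhds ht'] with x hx
    exact cut_of_notMem (fun h => hx (Ioo_subset_Icc_self h)) S

theorem contDiffAt_cut {a b t : ℝ} (ha : t ≠ a) (hb : t ≠ b) {S : ℝ → ℝ} {n : WithTop ℕ∞}
    (hS : ContDiff ℝ n S) : ContDiffAt ℝ n (cut a b S) t := by
  rcases cut_eventuallyEq ha hb S with ⟨-, h⟩ | ⟨-, h⟩
  · exact (Complex.ofRealCLM.contDiff.comp hS).contDiffAt.congr_of_eventuallyEq h
  · exact contDiffAt_const.congr_of_eventuallyEq h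

theorem deriv_cut {a b t d : ℝ} (ha : t ≠ a) (hb : t ≠ b) {S S' : ℝ → ℝ}
    (hS : HasDerivAt S d t) (hd : d = S' t) : deriv (cut a b S) t = cut a b S' t := by
  rcases cut_eventuallyEq ha hb S with ⟨ht, h⟩ | ⟨ht, h⟩
  · rw [h.deriv_eq, cut_of_mem ht, ← hd]
    exact hS.ofReal_comp.deriv
  · rw [h.deriv_eq, cut_of_notMem ht, deriv_const]

theorem deriv_sinCut {a b t : ℝ} (γ : ℝ) (ha : t ≠ a) (hb : t ≠ b) :
    deriv (sinCut a b γ) t = γ * cosCut a b γ t := by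
  have h1 : HasDerivAt (fun x => γ * (x - a)) (γ * 1) t :=
    ((hasDerivAt_id t).sub_const a).const_mul γ
  have h2 := congrFun (cut_const_mul a b γ fun x => Real.cos (γ * (x - a))) t
  refine Eq.trans ?_ h2
  exact deriv_cut ha hb h1.sin (by ring)

theorem deriv_cosCut {a b t : ℝ} (γ : ℝ) (ha : t ≠ a) (hb : t ≠ b) :
    deriv (cosCut a b γ) t = -γ * sinCut a b γ t := by
  have h1 : HasDerivAt (fun x => γ * (x - a)) (γ * 1) t :=
    ((hasDerivAt_id t).sub_const a).const_mul γ
  have h2 := congrFun (cut_const_mul a b (-γ) fun x => Real.sin (γ * (x - a))) t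
  push_cast at h2
  refine Eq.trans ?_ h2
  exact deriv_cut ha hb h1.cos (by ring)

theorem contDiffOn_sinCut {a b γ : ℝ} {J : Set ℝ} (hJ : ∀ t ∈ J, t ≠ a ∧ t ≠ b)
    {n : WithTop ℕ∞} : ContDiffOn ℝ n (sinCut a b γ) J := fun t ht =>
  (contDiffAt_cut (hJ t ht).1 (hJ t ht).2 (by fun_prop)).contDiffWithinAt

theorem contDiffOn_cosCut {a b γ : ℝ} {J : Set ℝ} (hJ : ∀ t ∈ J, t ≠ a ∧ t ≠ b)
    {n : WithTop ℕ∞} : ContDiffOn ℝ n (cosCut a b γ) J := fun t ht =>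
  (contDiffAt_cut (hJ t ht).1 (hJ t ht).2 (by fun_prop)).contDiffWithinAt

end TrigCut

/-! ### Graphs `(u, ∇u)` of periodic functions and of modes. -/

section Graphs

open scoped ComplexConjugate
open Filter Topology

namespace Cuboid

variable (D : Cuboid)

theorem isTiling_Omega : IsTiling D.Omega D.OmegaPer D.shift D.fold := D.isTiling_slab D.isOpen_I₃

/-- `p = (u, g₁, g₂, g₃)` with `g = ∇u` for the periodic extensions. -/
def IsPerGraph (p : GraphSpace (volume.restrict D.Omega) 3) : Prop :=
  ∀ i : Fin 3, IsWeakDeriv D.OmegaPer (dir i) (p 0 ∘ D.fold) (p i.succ ∘ D.fold)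

theorem exists_submodule_isPerGraph :
    ∃ V : Submodule ℂ (GraphSpace (volume.restrict D.Omega) 3),
      IsClosed (V : Set (GraphSpace (volume.restrict D.Omega) 3)) ∧ ∀ p, p ∈ V ↔ D.IsPerGraph p := by
  choose S hS hmem using fun i : Fin 3 => D.isTiling_Omega.exists_submodule (dir i)
  let pr : Fin 3 → GraphSpace (volume.restrict D.Omega) 3 →L[ℂ] D.L2 × D.L2 := fun i =>
    (PiLp.proj 2 (fun _ : Fin 4 => D.L2) 0).prod (PiLp.proj 2 (fun _ : Fin 4 => D.L2) i.succ)
  refine ⟨⨅ i, (S i).comap (pr i).toLinearMap, ?_, fun p => ?_⟩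
  · rw [Submodule.coe_iInf]
    exact isClosed_iInter fun i => (hS i).preimage (pr i).continuous
  · rw [Submodule.mem_iInf]
    exact forall_congr' fun i => hmem i (pr i p)

variable {D} in
theorem IsPerGraph.mem_H1per {p : GraphSpace (volume.restrict D.Omega) 3} (hp : D.IsPerGraph p) :
    (p 0 : R3 → ℂ) ∈ D.H1per ∧ ∀ i, D.pd i (p 0) =ᵐ[volume.restrict D.Omega] p i.succ := by
  refine ⟨D.mem_HPer D.isOpen_I₃ (Lp.memLp (p 0)) (fun i => Lp.memLp (p i.succ)) hp, fun i => ?_⟩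
  exact weakDeriv_ae_eq D.isTiling_Omega.isOpen_cell (Lp.memLp _)
    (D.isTiling_Omega.isWeakDeriv_of_fold (hp i))

theorem exists_isPerGraph {u : D.L2} (hu : (u : R3 → ℂ) ∈ D.H1per) :
    ∃ p, D.IsPerGraph p ∧ p 0 = u := by
  have h := fun i => D.HPer_isWeakDeriv D.isOpen_I₃ hu (dir i)
  refine ⟨WithLp.toLp 2 (Fin.cons u fun i => toL2 _ (D.pd i u)), fun i => ?_, rfl⟩
  have h' := D.isTiling_Omega.ae_fold (coeFn_toL2 (h i).1)
  refine (h i).2.congr .rfl ?_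
  filter_upwards [h'] with x hx using hx.symm

/-- The conditions on the factor `s` of a mode and its derivative `s'`. -/
structure IsFactor (s s' : ℝ → ℂ) : Prop where
  measurable : Measurable s
  measurable' : Measurable s'
  bounded : ∃ C, ∀ t, ‖s t‖ ≤ C
  bounded' : ∃ C, ∀ t, ‖s' t‖ ≤ C

variable {D}

theorem IsFactor.memLp_mode {s s' : ℝ → ℂ} (h : IsFactor s s') (α β : ℝ) (ν : Measure R3)
    [IsFiniteMeasure ν] : MemLp (mode α β s) 2 ν := by
  obtain ⟨C, hC⟩ := h.bounded
  exact memLp_of_norm_le (measurable_mode α β h.measurable) fun x => by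
    rw [norm_mode]
    exact hC _

theorem IsFactor.memLp_modeGrad {s s' : ℝ → ℂ} (h : IsFactor s s') (α β : ℝ) (ν : Measure R3)
    [IsFiniteMeasure ν] (i : Fin 3) : MemLp (modeGrad α β s s' i) 2 ν := by
  obtain ⟨C, hC⟩ := h.bounded'
  fin_cases i
  · exact (h.memLp_mode α β ν).const_mul _
  · exact (h.memLp_mode α β ν).const_mul _
  · have h2 : MemLp (mode α β s') 2 ν := memLp_of_norm_le (measurable_mode α β h.measurable')
      fun x => by
        rw [norm_mode]
        exact hC _
    exact h2

variable (D)

/-- A mode together with its gradient. -/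
def modeGraph (α β : ℝ) (s s' : ℝ → ℂ) : GraphSpace (volume.restrict D.Omega) 3 :=
  WithLp.toLp 2 (Fin.cons (toL2 _ (mode α β s)) fun i => toL2 _ (modeGrad α β s s' i))

theorem modeGraph_zero (α β : ℝ) (s s' : ℝ → ℂ) :
    D.modeGraph α β s s' 0 = toL2 _ (mode α β s) := rfl

theorem modeGraph_succ (α β : ℝ) (s s' : ℝ → ℂ) (i : Fin 3) :
    D.modeGraph α β s s' i.succ = toL2 _ (modeGrad α β s s' i) := rfl

theorem conj_modeGrad (α β : ℝ) {s s' : ℝ → ℂ} (hs : ∀ t, conj (s t) = s t)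
    (hs' : ∀ t, conj (s' t) = s' t) (i : Fin 3) (x : R3) :
    conj (modeGrad α β s s' i x) = modeGrad (-α) (-β) s s' i x := by
  fin_cases i <;> simp [modeGrad, conj_mode, hs, hs']

theorem conjGraph_modeGraph (α β : ℝ) {s s' : ℝ → ℂ} (h : IsFactor s s')
    (hs : ∀ t, conj (s t) = s t) (hs' : ∀ t, conj (s' t) = s' t) :
    conjGraph (D.modeGraph α β s s') = D.modeGraph (-α) (-β) s s' := by
  ext1 i
  refine Fin.cases ?_ (fun i => ?_) i
  · refine (conjL2_toL2 (h.memLp_mode α β _)).trans (congrArg _ (funext fun x => ?_))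
    simp only [conj_mode, hs]
  · refine (conjL2_toL2 (h.memLp_modeGrad α β _ i)).trans (congrArg _ (funext fun x => ?_))
    rw [conj_modeGrad α β hs hs']

theorem modeGrad_fold (k n : ℤ) (s s' : ℝ → ℂ) (i : Fin 3) :
    modeGrad (freq D.l₁ k) (freq D.l₂ n) s s' i ∘ D.fold =
      modeGrad (freq D.l₁ k) (freq D.l₂ n) s s' i := by
  have h1 := fun s => congrFun (D.mode_fold k n s)
  simp only [Function.comp_apply] at h1
  funext x
  fin_cases i <;> simp [modeGrad, h1]

theorem isPerGraph_modeGraph (k n : ℤ) {s s' : ℝ → ℂ} (h : IsFactor s s')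
    (hd : ∀ i, IsWeakDeriv D.OmegaPer (dir i) (mode (freq D.l₁ k) (freq D.l₂ n) s)
      (modeGrad (freq D.l₁ k) (freq D.l₂ n) s s' i)) :
    D.IsPerGraph (D.modeGraph (freq D.l₁ k) (freq D.l₂ n) s s') := by
  intro i
  have h2 := D.isTiling_Omega.ae_fold (coeFn_toL2 (h.memLp_mode (freq D.l₁ k) (freq D.l₂ n) _))
  have h3 := D.isTiling_Omega.ae_fold
    (coeFn_toL2 (h.memLp_modeGrad (freq D.l₁ k) (freq D.l₂ n) _ i))
  refine (hd i).congr ?_ ?_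
  · filter_upwards [h2] with x hx
    exact (congrFun (D.mode_fold k n s) x).symm.trans hx.symm
  · filter_upwards [h3] with x hx
    exact (congrFun (D.modeGrad_fold k n s s' i) x).symm.trans hx.symm

theorem inner_modeGraph_zero (k n : ℤ) {s s' : ℝ → ℂ} (h : IsFactor s s')
    (hs : ∀ t, conj (s t) = s t) (u : D.L2) :
    inner ℂ (D.modeGraph (freq D.l₁ k) (freq D.l₂ n) s s' 0) u =
      ∫ x in D.Omega, u x * mode (freq D.l₁ (-k)) (freq D.l₂ (-n)) s x := by
  rw [modeGraph_zero, inner_toL2 (h.memLp_mode _ _ _)]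
  simp only [conj_mode, hs, freq_neg, mul_comm]

theorem inner_modeGraph_succ (k n : ℤ) {s s' : ℝ → ℂ} (h : IsFactor s s')
    (hs : ∀ t, conj (s t) = s t) (hs' : ∀ t, conj (s' t) = s' t) (i : Fin 3) (u : D.L2) :
    inner ℂ (D.modeGraph (freq D.l₁ k) (freq D.l₂ n) s s' i.succ) u =
      ∫ x in D.Omega, u x * modeGrad (freq D.l₁ (-k)) (freq D.l₂ (-n)) s s' i x := by
  rw [modeGraph_succ, inner_toL2 (h.memLp_modeGrad _ _ _ i)]
  simp only [conj_modeGrad _ _ hs hs', freq_neg, mul_comm]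

/-! ### The space `H¹_#(Ω)` -/

theorem I₃_ne {t : ℝ} (ht : t ∈ D.I₃) : t ≠ -D.l₃m ∧ t ≠ D.l₃p := ⟨ht.1.ne', ht.2.ne⟩

/-- The frequencies in the third variable. -/
def freq₃ (l : ℝ) (j : ℕ) : ℝ := Real.pi * j / l

theorem sin_freq₃ {l : ℝ} (hl : 0 < l) (j : ℕ) : Real.sin (freq₃ l j * l) = 0 := by
  rw [freq₃, div_mul_cancel₀ _ hl.ne', mul_comm]
  exact Real.sin_nat_mul_pi j

theorem l₃_pos : 0 < D.l₃ := add_pos D.l₃p_pos D.l₃m_pos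

theorem isFactor_cosFun (j : ℕ) : IsFactor (D.cosFun j)
    (fun t => -freq₃ D.l₃ j * sinCut (-D.l₃m) D.l₃p (freq₃ D.l₃ j) t) where
  measurable := measurable_cosCut _ _ _
  measurable' := measurable_const.mul (measurable_sinCut _ _ _)
  bounded := ⟨1, norm_cosCut_le _ _ _⟩
  bounded' := ⟨|freq₃ D.l₃ j| * 1, fun t => by
    rw [norm_mul, norm_neg, Complex.norm_real]
    exact mul_le_mul_of_nonneg_left (norm_sinCut_le _ _ _ _) (abs_nonneg _)⟩

/-- The Neumann problem. Functions in `H¹_#(Ω)` have no prescribed trace, so Green's formula needs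
the vertical derivative of the mode to vanish at the top and the bottom. For cosines it is a
multiple of a sine that does so. -/
theorem existsUnique_H1per {κ c : ℝ} (hc : 0 < c)
    (hκ : ∀ (k n : ℤ) (j : ℕ), c ≤ |freq D.l₁ k ^ 2 + freq D.l₂ n ^ 2 + freq₃ D.l₃ j ^ 2 - κ|)
    (f : D.L2) (G : Fin 3 → D.L2) :
    ∃! u : D.L2, (u : R3 → ℂ) ∈ D.H1per ∧ ∀ φ : D.L2, (φ : R3 → ℂ) ∈ D.H1per →
      (∫ x in D.Omega, ((∑ i, D.pd i u x * D.pd i φ x) - κ * u x * φ x)) =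
        ∫ x in D.Omega, ((∑ i, G i x * D.pd i φ x) + f x * φ x) := by
  obtain ⟨V, hVc, hV⟩ := D.exists_submodule_isPerGraph
  have hsys := D.isOrthogonalSystem_cosMode
  let s' : ℕ → ℝ → ℂ := fun j t => -freq₃ D.l₃ j * sinCut (-D.l₃m) D.l₃p (freq₃ D.l₃ j) t
  let e : ℤ × ℤ × ℕ → GraphSpace (volume.restrict D.Omega) 3 := fun i =>
    D.modeGraph (freq D.l₁ i.1) (freq D.l₂ i.2.1) (D.cosFun i.2.2) (s' i.2.2)
  have hcs : ∀ j t, conj (D.cosFun j t) = D.cosFun j t := fun j t => conj_cosCut _ _ _ _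
  have hcs' : ∀ j t, conj (s' j t) = s' j t := fun j t => by
    simp only [s', map_mul, map_neg, Complex.conj_ofReal, conj_sinCut]
  have he : ∀ i, e i ∈ V := by
    intro i
    rw [hV]
    refine D.isPerGraph_modeGraph _ _ (D.isFactor_cosFun _) fun r => ?_
    exact isWeakDeriv_mode D.isOpen_I₃ _ _ (contDiffOn_cosCut fun t ht => D.I₃_ne ht)
      (fun t ht => deriv_cosCut _ (D.I₃_ne ht).1 (D.I₃_ne ht).2) r
  refine D.existsUnique_of_graph id (S := {u : D.L2 | (u : R3 → ℂ) ∈ D.H1per}) hVc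
    (fun p hp => ((hV p).1 hp).mem_H1per)
    (fun u hu => by
      obtain ⟨p, hp, hpu⟩ := D.exists_isPerGraph hu
      exact ⟨p, (hV p).2 hp, hpu⟩) he (fun i => ?_) hsys.inner_eq_zero hsys.toL2_ne_zero
    hsys.eq_zero_of_inner
    (lam := fun i => freq D.l₁ i.1 ^ 2 + freq D.l₂ i.2.1 ^ 2 + freq₃ D.l₃ i.2.2 ^ 2)
    (fun i => by positivity) (fun i p hp => ?_) hc (fun i => hκ _ _ _) f G
  · rw [D.conjGraph_modeGraph _ _ (D.isFactor_cosFun _) (hcs _) (hcs' _), ← freq_neg, ← freq_neg]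
    exact he (-i.1, -i.2.1, i.2.2)
  · have hint : ∀ r, IntegrableOn (p r) D.Omega := fun r => (Lp.memLp (p r)).integrable (by norm_num)
    have hd := (hV p).1 hp
    -- Green's formula by components. The indices are negated because the inner product conjugates
    -- the mode. In the lateral directions the cosine itself serves as factor of the test function,
    -- in the vertical direction its derivative does.
    have hlat := fun (r : Fin 3) (hr : r ≠ 2) => integral_mul_modeGrad_lateral D.isOpen_I₃
      (u := p 0) (g := p r.succ) (i := r) hr (hint _) (hint _) (hd r) subset_rfl
      (s' := s' i.2.2) (isTestLimit_cosCut (-D.l₃m) D.l₃p (freq₃ D.l₃ i.2.2)) (-i.1) (-i.2.1)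
    have hlim : IsTestLimit₁ (-D.l₃m) D.l₃p (s' i.2.2) _ := (isTestLimit₁_sinCut
      (a := -D.l₃m) (b := D.l₃p) (γ := freq₃ D.l₃ i.2.2)
      (by rw [l₃_eq]; exact sin_freq₃ D.l₃_pos _)).const_mul (-freq₃ D.l₃ i.2.2)
    have hver := integral_mul_modeGrad D.isOpen_I₃ (u := p 0) (g := p (Fin.succ 2)) (i := 2)
      (hint _) (hint _) (hd 2) subset_rfl hlim (-i.1) (-i.2.1)
    have h0 := hlat 0 (by decide)
    have h1 := hlat 1 (by decide)
    have hs2 : ∀ x, mode (freq D.l₁ (-i.1)) (freq D.l₂ (-i.2.1)) (fun t => -freq₃ D.l₃ i.2.2 *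
        (freq₃ D.l₃ i.2.2 * cosCut (-D.l₃m) D.l₃p (freq₃ D.l₃ i.2.2) t)) x =
        (-freq₃ D.l₃ i.2.2 ^ 2 : ℂ) * mode (freq D.l₁ (-i.1)) (freq D.l₂ (-i.2.1))
          (D.cosFun i.2.2) x := fun x => by
      simp only [mode, cosFun, cosCut, freq₃]
      ring
    rw [Fin.sum_univ_three, D.inner_modeGraph_succ _ _ (D.isFactor_cosFun _) (hcs _) (hcs' _),
      D.inner_modeGraph_succ _ _ (D.isFactor_cosFun _) (hcs _) (hcs' _),
      D.inner_modeGraph_succ _ _ (D.isFactor_cosFun _) (hcs _) (hcs' _),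
      D.inner_modeGraph_zero _ _ (D.isFactor_cosFun _) (hcs _)]
    simp only [modeGrad, Matrix.cons_val, mul_left_comm (p _ _), integral_const_mul, hs2]
      at h0 h1 hver ⊢
    have hver' : ∫ x in D.Omega, p (Fin.succ 2) x *
        mode (freq D.l₁ (-i.1)) (freq D.l₂ (-i.2.1)) (s' i.2.2) x =
        -((-freq₃ D.l₃ i.2.2 ^ 2 : ℂ) * ∫ x in D.Omega, p 0 x *
          mode (freq D.l₁ (-i.1)) (freq D.l₂ (-i.2.1)) (D.cosFun i.2.2) x) := by
      rw [eq_neg_iff_add_eq_zero, add_comm, ← eq_neg_iff_add_eq_zero]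
      exact hver
    have h0' : ∫ x in D.Omega, p (Fin.succ 0) x *
        mode (freq D.l₁ (-i.1)) (freq D.l₂ (-i.2.1)) (D.cosFun i.2.2) x =
        -((freq D.l₁ (-i.1) : ℂ) * Complex.I * ∫ x in D.Omega, p 0 x *
          mode (freq D.l₁ (-i.1)) (freq D.l₂ (-i.2.1)) (D.cosFun i.2.2) x) := by
      rw [eq_neg_iff_add_eq_zero, add_comm, ← eq_neg_iff_add_eq_zero]
      exact h0
    have h1' : ∫ x in D.Omega, p (Fin.succ 1) x *
        mode (freq D.l₁ (-i.1)) (freq D.l₂ (-i.2.1)) (D.cosFun i.2.2) x =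
        -((freq D.l₂ (-i.2.1) : ℂ) * Complex.I * ∫ x in D.Omega, p 0 x *
          mode (freq D.l₁ (-i.1)) (freq D.l₂ (-i.2.1)) (D.cosFun i.2.2) x) := by
      rw [eq_neg_iff_add_eq_zero, add_comm, ← eq_neg_iff_add_eq_zero]
      exact h1
    rw [hver', h0', h1']
    simp only [freq_neg]
    push_cast
    linear_combination (-((freq D.l₁ i.1 : ℂ) ^ 2 + (freq D.l₂ i.2.1 : ℂ) ^ 2) *
      ∫ x in D.Omega, p 0 x * mode (-freq D.l₁ i.1) (-freq D.l₂ i.2.1) (D.cosFun i.2.2) x) *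
      Complex.I_mul_I

end Cuboid

end Graphs

/-! ### The space `H¹_{0,#}(Ω ∖ Γ)` and the Dirichlet problem on both sides of `Γ`. -/

section Zero

open scoped ComplexConjugate
open Filter Topology

namespace Cuboid

variable (D : Cuboid)

/-- `p = (u, ∇u)`, where the trace of `u` on `Γ` and on the horizontal boundaries vanishes. -/
def IsZeroGraph (p : GraphSpace (volume.restrict D.Omega) 3) : Prop :=
  D.IsPerGraph p ∧ ∀ ψ : Fin 3 → R3 → ℂ, (∀ i, ψ i ∈ D.H1perJump) →
    ∑ i : Fin 3, ∫ x in D.Omega, p i.succ x * ψ i x =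
      -∑ i : Fin 3, ∫ x in D.Omega, p 0 x * weakDeriv (D.Omega \ D.Gamma) (dir i) (ψ i) x

variable {D} in
theorem memLp_of_mem_H1perJump {u : R3 → ℂ} (hu : u ∈ D.H1perJump) :
    MemLp u 2 (volume.restrict D.Omega) := by
  rw [H1perJump_eq] at hu
  rw [← restrict_J₃]
  exact hu.1.1

variable {D} in
theorem memLp_weakDeriv_of_mem_H1perJump {u : R3 → ℂ} (hu : u ∈ D.H1perJump) (v : R3) :
    MemLp (weakDeriv (D.Omega \ D.Gamma) v u) 2 (volume.restrict D.Omega) := by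
  rw [H1perJump_eq] at hu
  have := (D.HPer_isWeakDeriv D.isOpen_J₃ hu v).1
  rwa [restrict_J₃, slab_J₃] at this

/-- Each `ψ` and its weak derivatives are square integrable, so the trace condition is a continuous
linear equation in `(u, ∇u)` for every `ψ`. -/
theorem exists_submodule_isZeroGraph :
    ∃ V : Submodule ℂ (GraphSpace (volume.restrict D.Omega) 3),
      IsClosed (V : Set (GraphSpace (volume.restrict D.Omega) 3)) ∧ ∀ p, p ∈ V ↔ D.IsZeroGraph p := by
  obtain ⟨V, hVc, hV⟩ := D.exists_submodule_isPerGraph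
  let T := {ψ : Fin 3 → R3 → ℂ // ∀ i, ψ i ∈ D.H1perJump}
  choose Λ hΛ using fun (ψ : T) (i : Fin 3) =>
    exists_clm_integral_mul (memLp_of_mem_H1perJump (ψ.2 i))
  choose Λ' hΛ' using fun (ψ : T) (i : Fin 3) =>
    exists_clm_integral_mul (memLp_weakDeriv_of_mem_H1perJump (ψ.2 i) (dir i))
  let F : T → GraphSpace (volume.restrict D.Omega) 3 →L[ℂ] ℂ := fun ψ =>
    ∑ i : Fin 3, ((Λ ψ i).comp (PiLp.proj 2 (fun _ : Fin 4 => D.L2) i.succ) +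
      (Λ' ψ i).comp (PiLp.proj 2 (fun _ : Fin 4 => D.L2) 0))
  have hF : ∀ ψ p, F ψ p = ∑ i : Fin 3, (Λ ψ i (p i.succ) + Λ' ψ i (p 0)) := fun ψ p => by
    simp only [F, sum_apply, add_apply]
    rfl
  refine ⟨V ⊓ ⨅ ψ, LinearMap.ker (F ψ).toLinearMap, ?_, fun p => ?_⟩
  · rw [Submodule.coe_inf, Submodule.coe_iInf]
    exact hVc.inter (isClosed_iInter fun ψ => (F ψ).isClosed_ker)
  · rw [Submodule.mem_inf, hV, Submodule.mem_iInf, IsZeroGraph]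
    refine and_congr_right fun _ => ⟨fun h ψ hψ => ?_, fun h ψ => ?_⟩
    · have := (hF ⟨ψ, hψ⟩ p).symm.trans (h ⟨ψ, hψ⟩)
      simp only [hΛ, hΛ', Finset.sum_add_distrib] at this
      exact eq_neg_of_add_eq_zero_left this
    · refine (hF ψ p).trans ?_
      simp only [hΛ, hΛ', Finset.sum_add_distrib]
      exact (eq_neg_iff_add_eq_zero.1 (h ψ.1 ψ.2))

/-- The condition in the definition of `H¹_{0,#}(Ω ∖ Γ)`, in terms of the gradient. -/
theorem zero_condition_iff {p : GraphSpace (volume.restrict D.Omega) 3}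
    (hp : ∀ i, D.pd i (p 0) =ᵐ[volume.restrict D.Omega] p i.succ)
    {ψ : Fin 3 → R3 → ℂ} (hψ : ∀ i, ψ i ∈ D.H1perJump) :
    (∫ x in D.Omega, ∑ i, weakDeriv D.Omega (dir i) (p 0) x * ψ i x =
      - ∫ x in D.Omega, p 0 x * ∑ i, weakDeriv (D.Omega \ D.Gamma) (dir i) (ψ i) x) ↔
    ∑ i : Fin 3, ∫ x in D.Omega, p i.succ x * ψ i x =
      -∑ i : Fin 3, ∫ x in D.Omega, p 0 x * weakDeriv (D.Omega \ D.Gamma) (dir i) (ψ i) x := by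
  have h1 : ∑ i : Fin 3, ∫ x in D.Omega, p i.succ x * ψ i x =
      ∫ x in D.Omega, ∑ i : Fin 3, p i.succ x * ψ i x :=
    (integral_finsetSum _ fun i _ => (Lp.memLp (p i.succ)).integrable_mul
      (memLp_of_mem_H1perJump (hψ i))).symm
  have h2 : ∑ i : Fin 3, ∫ x in D.Omega, p 0 x * weakDeriv (D.Omega \ D.Gamma) (dir i) (ψ i) x =
      ∫ x in D.Omega, ∑ i : Fin 3, p 0 x * weakDeriv (D.Omega \ D.Gamma) (dir i) (ψ i) x :=
    (integral_finsetSum _ fun i _ => (Lp.memLp (p 0)).integrable_mul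
      (memLp_weakDeriv_of_mem_H1perJump (hψ i) (dir i))).symm
  rw [h1, h2]
  simp only [Finset.mul_sum]
  refine Eq.congr (integral_congr_ae ?_) rfl
  filter_upwards [ae_all_iff.2 hp] with x hx
  exact Finset.sum_congr rfl fun i _ => by rw [← hx i]; rfl

variable {D} in
theorem IsZeroGraph.mem_H1perZero {p : GraphSpace (volume.restrict D.Omega) 3}
    (hp : D.IsZeroGraph p) :
    (p 0 : R3 → ℂ) ∈ D.H1perZero ∧ ∀ i, D.pd i (p 0) =ᵐ[volume.restrict D.Omega] p i.succ := by
  have h := hp.1.mem_H1per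
  exact ⟨⟨h.1, fun ψ hψ => (D.zero_condition_iff h.2 hψ).2 (hp.2 ψ hψ)⟩, h.2⟩

theorem exists_isZeroGraph {u : D.L2} (hu : (u : R3 → ℂ) ∈ D.H1perZero) :
    ∃ p, D.IsZeroGraph p ∧ p 0 = u := by
  obtain ⟨p, hp, rfl⟩ := D.exists_isPerGraph hu.1
  exact ⟨p, ⟨hp, fun ψ hψ => (D.zero_condition_iff hp.mem_H1per.2 hψ).1 (hu.2 ψ hψ)⟩, rfl⟩

/-- Regularity of `s` is required only away from `0`, so jumps across `Γ` are allowed. As `Γ` is a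
null set, the derivatives are identified almost everywhere in `Ω`. -/
theorem mode_mem_H1perJump (k n : ℤ) {s s' : ℝ → ℂ} (h : IsFactor s s')
    (hs : ContDiffOn ℝ 1 s D.J₃) (hs' : ∀ t ∈ D.J₃, deriv s t = s' t) :
    mode (freq D.l₁ k) (freq D.l₂ n) s ∈ D.H1perJump ∧ ∀ i,
      weakDeriv (D.Omega \ D.Gamma) (dir i) (mode (freq D.l₁ k) (freq D.l₂ n) s)
        =ᵐ[volume.restrict D.Omega] modeGrad (freq D.l₁ k) (freq D.l₂ n) s s' i := by
  have hd := isWeakDeriv_mode D.isOpen_J₃ (freq D.l₁ k) (freq D.l₂ n) hs hs'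
  have hd' : ∀ i, IsWeakDeriv (slabPer D.J₃) (dir i) (mode (freq D.l₁ k) (freq D.l₂ n) s ∘ D.fold)
      (modeGrad (freq D.l₁ k) (freq D.l₂ n) s s' i ∘ D.fold) := fun i => by
    rw [mode_fold, modeGrad_fold]
    exact hd i
  have hT := D.isTiling_slab D.isOpen_J₃
  have hm := h.memLp_mode (freq D.l₁ k) (freq D.l₂ n) (volume.restrict D.Omega)
  have hm' := h.memLp_modeGrad (freq D.l₁ k) (freq D.l₂ n) (volume.restrict D.Omega)
  rw [H1perJump_eq, ← restrict_J₃, ← slab_J₃]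
  rw [← restrict_J₃] at hm hm'
  exact ⟨D.mem_HPer D.isOpen_J₃ hm hm' hd', fun i =>
    weakDeriv_ae_eq hT.isOpen_cell (hm' i) (hT.isWeakDeriv_of_fold (hd' i))⟩

/-- The lower end of the interval where `sinFun j` does not vanish. -/
def lo : ℕ ⊕ ℕ → ℝ := Sum.elim (fun _ => -D.l₃m) fun _ => 0

/-- The upper end of the interval where `sinFun j` does not vanish. -/
def hi : ℕ ⊕ ℕ → ℝ := Sum.elim (fun _ => 0) fun _ => D.l₃p

/-- The frequencies of the functions `sinFun`. -/
def freqSin : ℕ ⊕ ℕ → ℝ :=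
  Sum.elim (fun k => freq₃ D.l₃m (k + 1)) fun k => freq₃ D.l₃p (k + 1)

/-- The eigenfunctions of the Dirichlet problem on `(-l₃⁻, 0) ∪ (0, l₃⁺)`. -/
def sinFun (j : ℕ ⊕ ℕ) : ℝ → ℂ := sinCut (D.lo j) (D.hi j) (D.freqSin j)

/-- The derivatives of the functions `sinFun`. -/
def sinFun' (j : ℕ ⊕ ℕ) (t : ℝ) : ℂ := D.freqSin j * cosCut (D.lo j) (D.hi j) (D.freqSin j) t

theorem sin_freqSin (j : ℕ ⊕ ℕ) : Real.sin (D.freqSin j * (D.hi j - D.lo j)) = 0 := by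
  rcases j with k | k
  · simpa [freqSin, hi, lo] using sin_freq₃ D.l₃m_pos (k + 1)
  · simpa [freqSin, hi, lo] using sin_freq₃ D.l₃p_pos (k + 1)

theorem Ioo_lo_hi_subset (j : ℕ ⊕ ℕ) : Ioo (D.lo j) (D.hi j) ⊆ D.J₃ := by
  have h1 := D.l₃m_pos
  have h2 := D.l₃p_pos
  rcases j with k | k
  · rintro t ⟨ha, hb⟩
    simp only [lo, hi, Sum.elim_inl] at ha hb
    exact ⟨⟨ha, hb.trans h2⟩, hb.ne⟩
  · rintro t ⟨ha, hb⟩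
    simp only [lo, hi, Sum.elim_inr] at ha hb
    exact ⟨⟨by linarith, hb⟩, ha.ne'⟩

theorem ne_lo_hi (j : ℕ ⊕ ℕ) {t : ℝ} (ht : t ∈ D.J₃) : t ≠ D.lo j ∧ t ≠ D.hi j := by
  have h := D.I₃_ne ht.1
  rcases j with k | k
  · exact ⟨h.1, ht.2⟩
  · exact ⟨ht.2, h.2⟩

theorem isTestLimit₁_sinFun (j : ℕ ⊕ ℕ) :
    IsTestLimit₁ (D.lo j) (D.hi j) (D.sinFun j) (D.sinFun' j) :=
  isTestLimit₁_sinCut (D.sin_freqSin j)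

theorem isFactor_sinFun (j : ℕ ⊕ ℕ) : IsFactor (D.sinFun j) (D.sinFun' j) where
  measurable := measurable_sinCut _ _ _
  measurable' := measurable_const.mul (measurable_cosCut _ _ _)
  bounded := ⟨1, norm_sinCut_le _ _ _⟩
  bounded' := ⟨|D.freqSin j| * 1, fun t => by
    rw [sinFun', norm_mul, Complex.norm_real]
    exact mul_le_mul_of_nonneg_left (norm_cosCut_le _ _ _ _) (abs_nonneg _)⟩

theorem IsFactor.const_mul {s s' : ℝ → ℂ} (h : IsFactor s s') (c : ℂ) :
    IsFactor (fun t => c * s t) (fun t => c * s' t) where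
  measurable := measurable_const.mul h.measurable
  measurable' := measurable_const.mul h.measurable'
  bounded := by
    obtain ⟨C, hC⟩ := h.bounded
    exact ⟨‖c‖ * C, fun t => by
      rw [norm_mul]
      exact mul_le_mul_of_nonneg_left (hC t) (norm_nonneg _)⟩
  bounded' := by
    obtain ⟨C, hC⟩ := h.bounded'
    exact ⟨‖c‖ * C, fun t => by
      rw [norm_mul]
      exact mul_le_mul_of_nonneg_left (hC t) (norm_nonneg _)⟩

theorem conj_sinFun (j : ℕ ⊕ ℕ) (t : ℝ) : conj (D.sinFun j t) = D.sinFun j t := conj_sinCut _ _ _ _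

theorem conj_sinFun' (j : ℕ ⊕ ℕ) (t : ℝ) : conj (D.sinFun' j t) = D.sinFun' j t := by
  rw [sinFun', map_mul, Complex.conj_ofReal, conj_cosCut]

theorem isOrthogonalSystem_sinFun : IsOrthogonalSystem (volume.restrict D.I₃) D.sinFun := by
  have h := (isOrthogonalSystem_sin (neg_lt_zero.2 D.l₃m_pos)).union (neg_lt_zero.2 D.l₃m_pos)
    D.l₃p_pos (isOrthogonalSystem_sin D.l₃p_pos)
  refine (congrArg (IsOrthogonalSystem (volume.restrict D.I₃)) (funext fun j => ?_)).mpr h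
  rcases j with k | k
  · simp only [sinFun, sinCut, lo, hi, freqSin, freq₃, cut_eq_indicator, Sum.elim_inl, zero_sub,
      neg_neg]
  · simp only [sinFun, sinCut, lo, hi, freqSin, freq₃, cut_eq_indicator, Sum.elim_inr, sub_zero]

/-- The trace condition is read with exchanged roles: `ψ i` is the weakly differentiable function
and the sine mode is the test function. The mode is a limit of test functions supported on one side
of `Γ`, so jumps of `ψ` do not contribute. -/
theorem isZeroGraph_modeGraph (k n : ℤ) (j : ℕ ⊕ ℕ) :
    D.IsZeroGraph (D.modeGraph (freq D.l₁ k) (freq D.l₂ n) (D.sinFun j) (D.sinFun' j)) := by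
  have hf := D.isFactor_sinFun j
  refine ⟨D.isPerGraph_modeGraph _ _ hf
    (isWeakDeriv_mode_of_isTestLimit₁ D.isOpen_I₃ _ _ (D.isTestLimit₁_sinFun j)), fun ψ hψ => ?_⟩
  rw [← Finset.sum_neg_distrib]
  refine Finset.sum_congr rfl fun i _ => ?_
  have hψ' := hψ i
  rw [H1perJump_eq] at hψ'
  have h1 := D.HPer_isWeakDeriv D.isOpen_J₃ hψ' (dir i)
  have hint : ∀ {u : R3 → ℂ}, MemLp u 2 (volume.restrict (D.slab D.J₃)) →
      IntegrableOn u (D.slab D.J₃) := fun {u} hu => by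
    rw [restrict_J₃] at hu
    rw [IntegrableOn, restrict_J₃]
    exact hu.integrable (by norm_num)
  have h2 := integral_mul_modeGrad D.isOpen_J₃ (hint hψ'.1.1) (hint h1.1) h1.2
    (D.Ioo_lo_hi_subset j) (D.isTestLimit₁_sinFun j) k n
  rw [restrict_J₃, slab_J₃] at h2
  calc
    _ = ∫ x in D.Omega, ψ i x *
        modeGrad (freq D.l₁ k) (freq D.l₂ n) (D.sinFun j) (D.sinFun' j) i x := by
      refine integral_congr_ae ?_
      filter_upwards [coeFn_toL2 (hf.memLp_modeGrad (freq D.l₁ k) (freq D.l₂ n)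
        (volume.restrict D.Omega) i)] with x hx
      rw [modeGraph_succ, hx, mul_comm]
    _ = _ := h2
    _ = _ := by
      refine congrArg _ (integral_congr_ae ?_)
      filter_upwards [coeFn_toL2 (hf.memLp_mode (freq D.l₁ k) (freq D.l₂ n)
        (volume.restrict D.Omega))] with x hx
      rw [modeGraph_zero, hx, mul_comm]

/-- The defining condition of `H¹_{0,#}` is applied with `ψ` the gradient of the mode. The truncated
cosine in its third component jumps across `Γ`, which `H1perJump` permits. The divergence of `ψ` is
`-λ` times the mode, since `(iα)² + (iβ)² - γ² = -λ`. -/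
theorem green_sinFun (k n : ℤ) (j : ℕ ⊕ ℕ) {p : GraphSpace (volume.restrict D.Omega) 3}
    (hp : D.IsZeroGraph p) :
    ∑ i : Fin 3, ∫ x in D.Omega, p i.succ x *
        modeGrad (freq D.l₁ k) (freq D.l₂ n) (D.sinFun j) (D.sinFun' j) i x =
      ((freq D.l₁ k ^ 2 + freq D.l₂ n ^ 2 + D.freqSin j ^ 2 : ℝ) : ℂ) *
        ∫ x in D.Omega, p 0 x * mode (freq D.l₁ k) (freq D.l₂ n) (D.sinFun j) x := by
  have hf := D.isFactor_sinFun j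
  have hsm : ContDiffOn ℝ 1 (D.sinFun j) D.J₃ := contDiffOn_sinCut fun t ht => D.ne_lo_hi j ht
  have hsm' : ContDiffOn ℝ 1 (D.sinFun' j) D.J₃ :=
    contDiffOn_const.mul (contDiffOn_cosCut fun t ht => D.ne_lo_hi j ht)
  have hder : ∀ t ∈ D.J₃, deriv (D.sinFun j) t = D.sinFun' j t := fun t ht =>
    deriv_sinCut _ (D.ne_lo_hi j ht).1 (D.ne_lo_hi j ht).2
  have hder' : ∀ t ∈ D.J₃, deriv (D.sinFun' j) t = -(D.freqSin j : ℂ) ^ 2 * D.sinFun j t := by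
    intro t ht
    have h1 := D.ne_lo_hi j ht
    have h2 : DifferentiableAt ℝ (cosCut (D.lo j) (D.hi j) (D.freqSin j)) t :=
      (contDiffAt_cut h1.1 h1.2 (n := 1) (by fun_prop)).differentiableAt (by simp)
    refine (deriv_const_mul _ h2).trans ?_
    rw [deriv_cosCut _ h1.1 h1.2, sinFun]
    ring
  have hf' : IsFactor (D.sinFun' j) fun t => -(D.freqSin j : ℂ) ^ 2 * D.sinFun j t :=
    ⟨hf.measurable', (hf.const_mul _).measurable, hf.bounded', (hf.const_mul _).bounded⟩
  have hc : ∀ c : ℂ, ∀ x, mode (freq D.l₁ k) (freq D.l₂ n) (fun t => c * D.sinFun j t) x =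
      c * mode (freq D.l₁ k) (freq D.l₂ n) (D.sinFun j) x := fun c x => by
    simp only [mode]
    ring
  have hlat : ∀ c : ℂ, _ := fun c => D.mode_mem_H1perJump k n (hf.const_mul c)
    (contDiffOn_const.mul hsm) fun t ht => by
      rw [← hder t ht]
      exact deriv_const_mul c ((hsm.differentiableOn (by simp)).differentiableAt
        (D.isOpen_J₃.mem_nhds ht))
  simp only [funext (hc _)] at hlat
  have hver := D.mode_mem_H1perJump k n hf' hsm' hder'
  have hmem : ∀ i, modeGrad (freq D.l₁ k) (freq D.l₂ n) (D.sinFun j) (D.sinFun' j) i ∈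
      D.H1perJump := by
    intro i
    fin_cases i
    · exact (hlat _).1
    · exact (hlat _).1
    · exact hver.1
  rw [hp.2 _ hmem, Fin.sum_univ_three]
  have e0 : weakDeriv (D.Omega \ D.Gamma) (dir 0)
      (modeGrad (freq D.l₁ k) (freq D.l₂ n) (D.sinFun j) (D.sinFun' j) 0)
      =ᵐ[volume.restrict D.Omega] _ := (hlat _).2 0
  have e1 : weakDeriv (D.Omega \ D.Gamma) (dir 1)
      (modeGrad (freq D.l₁ k) (freq D.l₂ n) (D.sinFun j) (D.sinFun' j) 1)
      =ᵐ[volume.restrict D.Omega] _ := (hlat _).2 1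
  have e2 : weakDeriv (D.Omega \ D.Gamma) (dir 2)
      (modeGrad (freq D.l₁ k) (freq D.l₂ n) (D.sinFun j) (D.sinFun' j) 2)
      =ᵐ[volume.restrict D.Omega] _ := hver.2 2
  have hmul : ∀ {g : R3 → ℂ} {c : ℂ}, (g =ᵐ[volume.restrict D.Omega] fun x =>
      c * mode (freq D.l₁ k) (freq D.l₂ n) (D.sinFun j) x) → ∫ x in D.Omega, p 0 x * g x =
      c * ∫ x in D.Omega, p 0 x * mode (freq D.l₁ k) (freq D.l₂ n) (D.sinFun j) x := by
    intro g c hg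
    rw [← integral_const_mul]
    refine integral_congr_ae ?_
    filter_upwards [hg] with x hx
    rw [hx, mul_left_comm]
  rw [hmul (c := (freq D.l₁ k * Complex.I) ^ 2) (e0.trans (.of_forall fun x => ?_)),
    hmul (c := (freq D.l₂ n * Complex.I) ^ 2) (e1.trans (.of_forall fun x => ?_)),
    hmul (c := -(D.freqSin j : ℂ) ^ 2) (e2.trans (.of_forall fun x => ?_))]
  · simp only [mul_pow, Complex.I_sq]
    push_cast
    ring
  · simp only [modeGrad, Matrix.cons_val, hc]
  · simp only [modeGrad, Matrix.cons_val, hc]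
    ring
  · simp only [modeGrad, Matrix.cons_val, hc]
    ring

theorem existsUnique_H1perZero {κ c : ℝ} (hc : 0 < c)
    (hκ : ∀ (k n : ℤ) (j : ℕ ⊕ ℕ),
      c ≤ |freq D.l₁ k ^ 2 + freq D.l₂ n ^ 2 + D.freqSin j ^ 2 - κ|)
    (f : D.L2) (G : Fin 3 → D.L2) :
    ∃! u : D.L2, (u : R3 → ℂ) ∈ D.H1perZero ∧ ∀ φ : D.L2, (φ : R3 → ℂ) ∈ D.H1perZero →
      (∫ x in D.Omega, ((∑ i, D.pd i u x * D.pd i φ x) - κ * u x * φ x)) =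
        ∫ x in D.Omega, ((∑ i, G i x * D.pd i φ x) + f x * φ x) := by
  obtain ⟨V, hVc, hV⟩ := D.exists_submodule_isZeroGraph
  have hsys := D.isOrthogonalSystem_mode D.isOrthogonalSystem_sinFun
  let e : ℤ × ℤ × (ℕ ⊕ ℕ) → GraphSpace (volume.restrict D.Omega) 3 := fun i =>
    D.modeGraph (freq D.l₁ i.1) (freq D.l₂ i.2.1) (D.sinFun i.2.2) (D.sinFun' i.2.2)
  have he : ∀ i, e i ∈ V := fun i => (hV _).2 (D.isZeroGraph_modeGraph _ _ _)
  refine D.existsUnique_of_graph id (S := {u : D.L2 | (u : R3 → ℂ) ∈ D.H1perZero}) hVc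
    (fun p hp => ((hV p).1 hp).mem_H1perZero)
    (fun u hu => by
      obtain ⟨p, hp, hpu⟩ := D.exists_isZeroGraph hu
      exact ⟨p, (hV p).2 hp, hpu⟩) he (fun i => ?_) hsys.inner_eq_zero hsys.toL2_ne_zero
    hsys.eq_zero_of_inner
    (lam := fun i => freq D.l₁ i.1 ^ 2 + freq D.l₂ i.2.1 ^ 2 + D.freqSin i.2.2 ^ 2)
    (fun i => by positivity) (fun i p hp => ?_) hc (fun i => hκ _ _ _) f G
  · rw [D.conjGraph_modeGraph _ _ (D.isFactor_sinFun _) (D.conj_sinFun _) (D.conj_sinFun' _),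
      ← freq_neg, ← freq_neg]
    exact he (-i.1, -i.2.1, i.2.2)
  · simp only [e, D.inner_modeGraph_succ _ _ (D.isFactor_sinFun _) (D.conj_sinFun _)
      (D.conj_sinFun' _), D.inner_modeGraph_zero _ _ (D.isFactor_sinFun _) (D.conj_sinFun _)]
    rw [D.green_sinFun _ _ _ ((hV p).1 hp)]
    simp only [freq_neg, neg_sq]

end Cuboid

end Zero

/-! ### Decoupling of the system. -/

section System

open Filter Topology

namespace Cuboid

variable (D : Cuboid)

theorem memLp_pd (i : Fin 3) (u : R3 → ℂ) : MemLp (D.pd i u) 2 (volume.restrict D.Omega) := by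
  unfold pd weakDeriv
  split_ifs with h
  · exact h.choose_spec.1
  · exact MemLp.zero

/-- `u ∈ S` solves the Helmholtz equation with right-hand side `f - div G`. -/
def SolvesHelmholtz (S : Set (R3 → ℂ)) (κ : ℝ) (f : D.L2) (G : Fin 3 → D.L2) (u : D.L2) : Prop :=
  (u : R3 → ℂ) ∈ S ∧ ∀ φ : D.L2, (φ : R3 → ℂ) ∈ S →
    (∫ x in D.Omega, ((∑ i, D.pd i u x * D.pd i φ x) - κ * u x * φ x)) =
      ∫ x in D.Omega, ((∑ i, G i x * D.pd i φ x) + f x * φ x)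

/-- `u ∈ W` solves the Helmholtz equation in the first variable, with right-hand side
`f - ∂₁ G`. -/
def SolvesW (κ : ℝ) (f G u : D.L2) : Prop :=
  u ∈ D.W ∧ ∀ φ ∈ D.W, (∫ x in D.Omega, (D.pd 0 u x * D.pd 0 φ x - κ * u x * φ x)) =
    ∫ x in D.Omega, (G x * D.pd 0 φ x + f x * φ x)

/-- `h · curl(e₁φ) = h₁ ∂₃φ - h₂ ∂₂φ` is a pairing of `(0, -h₂, h₁)` with `∇φ`. The first component
of the curl is zero, so `h₀` plays no role. -/
theorem integral_curlE₁ (f h₁ h₂ φ : D.L2) (h₀ : R3 → ℂ) (z : ℂ) :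
    ∫ x in D.Omega, (z * f x * φ x + ∑ i, (![h₀, h₁, h₂] : Fin 3 → R3 → ℂ) i x * D.curlE₁ φ i x) =
      ∫ x in D.Omega, ((∑ i, (![0, -h₂, h₁] : Fin 3 → D.L2) i x * D.pd i φ x) +
        (z • f) x * φ x) := by
  refine integral_congr_ae ?_
  filter_upwards [Lp.coeFn_zero ℂ 2 (volume.restrict D.Omega), Lp.coeFn_neg h₂,
    Lp.coeFn_smul z f] with x e1 e2 e3
  simp only [Fin.sum_univ_three, curlE₁, Matrix.cons_val, e1, e2, e3, Pi.zero_apply, Pi.neg_apply,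
    Pi.smul_apply, smul_eq_mul]
  ring

theorem FE₁_eq (μ ω : ℝ) (fh fe : D.L2vec) (φ : D.L2) :
    D.FE₁ μ ω fh fe φ = ∫ x in D.Omega,
      ((∑ i, (![0, -fh 2, fh 1] : Fin 3 → D.L2) i x * D.pd i φ x) +
        ((Complex.I * ω * μ) • fe 0) x * φ x) := by
  rw [← integral_curlE₁ (h₀ := fh 0)]
  simp only [FE₁, Fin.sum_univ_three, Matrix.cons_val]

theorem FH₁_eq (ε ω : ℝ) (fh fe : D.L2vec) (ψ : D.L2) :
    D.FH₁ ε ω fh fe ψ = ∫ x in D.Omega,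
      ((∑ i, (![0, -fe 2, fe 1] : Fin 3 → D.L2) i x * D.pd i ψ x) +
        ((-Complex.I * ω * ε) • fh 0) x * ψ x) := by
  rw [← integral_curlE₁ (h₀ := fe 0)]
  simp only [FH₁, Fin.sum_univ_three, Matrix.cons_val]

/-- The combination `z ∂ᵢ u + w h`. -/
def source (z : ℂ) (i : Fin 3) (u : D.L2) (w : ℂ) (h : D.L2) : D.L2 :=
  z • toL2 _ (D.pd i u) + w • h

theorem coeFn_source (z : ℂ) (i : Fin 3) (u : D.L2) (w : ℂ) (h : D.L2) :
    D.source z i u w h =ᵐ[volume.restrict D.Omega] fun x => z * D.pd i u x + w * h x := by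
  filter_upwards [coeFn_toL2 (D.memLp_pd i u), Lp.coeFn_smul w h,
    Lp.coeFn_add (z • toL2 (volume.restrict D.Omega) (D.pd i u)) (w • h),
    Lp.coeFn_smul z (toL2 (volume.restrict D.Omega) (D.pd i u))] with x e1 e2 e3 e4
  simp only [source, e3, e4, e2, e1, Pi.add_apply, Pi.smul_apply, smul_eq_mul]

/-- The coupling terms and the data are merged into one right-hand side `∫ G ∂₁φ + f φ`. The four
equations in `W` differ only in the constants and indices. -/
theorem integral_add_pd (i j : Fin 3) (u v g h φ : D.L2) (s z w : ℂ) {F₁ F₂ : R3 → ℂ}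
    (h₁ : ∀ x, F₁ x = D.pd i u x * D.pd 0 φ x + z * D.pd j v x * φ x)
    (h₂ : ∀ x, F₂ x = s * g x * D.pd 0 φ x + w * h x * φ x) :
    (∫ x in D.Omega, F₁ x) + ∫ x in D.Omega, F₂ x =
      ∫ x in D.Omega, (D.source 1 i u s g x * D.pd 0 φ x + D.source z j v w h x * φ x) := by
  have hφ := Lp.memLp φ
  have hd := D.memLp_pd 0 φ
  simp only [h₁, h₂]
  refine (integral_add (((D.memLp_pd i u).integrable_mul hd).add
    (((D.memLp_pd j v).const_mul z).integrable_mul hφ))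
    ((((Lp.memLp g).const_mul s).integrable_mul hd).add
      (((Lp.memLp h).const_mul w).integrable_mul hφ))).symm.trans (integral_congr_ae ?_)
  filter_upwards [D.coeFn_source 1 i u s g, D.coeFn_source z j v w h] with x e1 e2
  simp only [e1, e2, Pi.mul_apply, Pi.add_apply]
  ring

theorem isWeakSolution_iff (ε μ ω : ℝ) (fh fe E H : D.L2vec) :
    D.IsWeakSolution ε μ ω fh fe E H ↔
      D.SolvesHelmholtz D.H1perZero (ω ^ 2 * ε * μ) ((Complex.I * ω * μ) • fe 0)
        ![0, -fh 2, fh 1] (E 0) ∧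
      D.SolvesHelmholtz D.H1per (ω ^ 2 * ε * μ) ((-Complex.I * ω * ε) • fh 0)
        ![0, -fe 2, fe 1] (H 0) ∧
      D.SolvesW (ω ^ 2 * ε * μ)
        (D.source (-Complex.I * ω * μ) 2 (H 0) (Complex.I * ω * μ) (fe 1))
        (D.source 1 1 (E 0) 1 (fh 2)) (E 1) ∧
      D.SolvesW (ω ^ 2 * ε * μ)
        (D.source (Complex.I * ω * ε) 2 (E 0) (-Complex.I * ω * ε) (fh 1))
        (D.source 1 1 (H 0) 1 (fe 2)) (H 1) ∧
      D.SolvesW (ω ^ 2 * ε * μ)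
        (D.source (Complex.I * ω * μ) 1 (H 0) (Complex.I * ω * μ) (fe 2))
        (D.source 1 2 (E 0) (-1) (fh 1)) (E 2) ∧
      D.SolvesW (ω ^ 2 * ε * μ)
        (D.source (-Complex.I * ω * ε) 1 (E 0) (-Complex.I * ω * ε) (fh 2))
        (D.source 1 2 (H 0) (-1) (fe 1)) (H 2) := by
  have r1 : ∀ φ : D.L2, (∫ x in D.Omega, (D.pd 1 (E 0) x * D.pd 0 φ x
      - Complex.I * ω * μ * D.pd 2 (H 0) x * φ x)) + D.FE₂ μ ω fh fe φ = _ := fun φ =>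
    D.integral_add_pd 1 2 (E 0) (H 0) (fh 2) (fe 1) φ 1
      (-Complex.I * ω * μ) (Complex.I * ω * μ) (fun x => by ring) (fun x => by ring)
  have r2 : ∀ ψ : D.L2, (∫ x in D.Omega, (D.pd 1 (H 0) x * D.pd 0 ψ x
      + Complex.I * ω * ε * D.pd 2 (E 0) x * ψ x)) + D.FH₂ ε ω fh fe ψ = _ := fun ψ =>
    D.integral_add_pd 1 2 (H 0) (E 0) (fe 2) (fh 1) ψ 1
      (Complex.I * ω * ε) (-Complex.I * ω * ε) (fun x => by ring) (fun x => by ring)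
  have r3 : ∀ φ : D.L2, (∫ x in D.Omega, (D.pd 2 (E 0) x * D.pd 0 φ x
      + Complex.I * ω * μ * D.pd 1 (H 0) x * φ x)) + D.FE₃ μ ω fh fe φ = _ := fun φ =>
    D.integral_add_pd 2 1 (E 0) (H 0) (fh 1) (fe 2) φ (-1)
      (Complex.I * ω * μ) (Complex.I * ω * μ) (fun x => by ring) (fun x => by ring)
  have r4 : ∀ ψ : D.L2, (∫ x in D.Omega, (D.pd 2 (H 0) x * D.pd 0 ψ x
      - Complex.I * ω * ε * D.pd 1 (E 0) x * ψ x)) + D.FH₃ ε ω fh fe ψ = _ := fun ψ =>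
    D.integral_add_pd 2 1 (H 0) (E 0) (fe 1) (fh 2) ψ (-1)
      (-Complex.I * ω * ε) (-Complex.I * ω * ε) (fun x => by ring) (fun x => by ring)
  simp only [SolvesHelmholtz, SolvesW, ← FE₁_eq, ← FH₁_eq, ← r1, ← r2, ← r3, ← r4,
    Complex.ofReal_mul, Complex.ofReal_pow]
  constructor
  · rintro ⟨hE, hH, e1, h1, e2, h2, e3, h3⟩
    -- Each equation sees one component of the test vector. The other two only have to lie in the
    -- right spaces, and components of the solution are at hand for this.
    exact ⟨⟨hE.1, fun φ hφ => e1 ![φ, E 1, E 2] ⟨hφ, hE.2.1, hE.2.2⟩⟩,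
      ⟨hH.1, fun ψ hψ => h1 ![ψ, H 1, H 2] ⟨hψ, hH.2.1, hH.2.2⟩⟩,
      ⟨hE.2.1, fun φ hφ => e2 ![E 0, φ, E 2] ⟨hE.1, hφ, hE.2.2⟩⟩,
      ⟨hH.2.1, fun ψ hψ => h2 ![H 0, ψ, H 2] ⟨hH.1, hψ, hH.2.2⟩⟩,
      ⟨hE.2.2, fun φ hφ => e3 ![E 0, E 1, φ] ⟨hE.1, hE.2.1, hφ⟩⟩,
      ⟨hH.2.2, fun ψ hψ => h3 ![H 0, H 1, ψ] ⟨hH.1, hH.2.1, hψ⟩⟩⟩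
  · rintro ⟨⟨hE0, e1⟩, ⟨hH0, h1⟩, ⟨hE1, e2⟩, ⟨hH1, h2⟩, ⟨hE2, e3⟩, hH2, h3⟩
    exact ⟨⟨hE0, hE1, hE2⟩, ⟨hH0, hH1, hH2⟩, fun φ hφ => e1 _ hφ.1, fun ψ hψ => h1 _ hψ.1,
      fun φ hφ => e2 _ hφ.2.1, fun ψ hψ => h2 _ hψ.2.1, fun φ hφ => e3 _ hφ.2.2,
      fun ψ hψ => h3 _ hψ.2.2⟩

/-- Forward substitution, with the sources of the last four problems as arbitrary functions of `E₁`
and `H₁`. For uniqueness, `E₁` and `H₁` are identified first; then the remaining problems have equal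
sources. -/
theorem existsUnique_system {κ : ℝ} {S T : Set (R3 → ℂ)}
    (hS : ∀ f G, ∃! u, D.SolvesHelmholtz S κ f G u) (hT : ∀ f G, ∃! u, D.SolvesHelmholtz T κ f G u)
    (hW : ∀ f G, ∃! u, D.SolvesW κ f G u) (f f' : D.L2) (G G' : Fin 3 → D.L2)
    (p q p' q' r s r' s' : D.L2 → D.L2 → D.L2) :
    ∃! EH : D.L2vec × D.L2vec, D.SolvesHelmholtz S κ f G (EH.1 0) ∧
      D.SolvesHelmholtz T κ f' G' (EH.2 0) ∧
      D.SolvesW κ (p (EH.1 0) (EH.2 0)) (q (EH.1 0) (EH.2 0)) (EH.1 1) ∧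
      D.SolvesW κ (p' (EH.1 0) (EH.2 0)) (q' (EH.1 0) (EH.2 0)) (EH.2 1) ∧
      D.SolvesW κ (r (EH.1 0) (EH.2 0)) (s (EH.1 0) (EH.2 0)) (EH.1 2) ∧
      D.SolvesW κ (r' (EH.1 0) (EH.2 0)) (s' (EH.1 0) (EH.2 0)) (EH.2 2) := by
  obtain ⟨E₀, hE₀, uE₀⟩ := hS f G
  obtain ⟨H₀, hH₀, uH₀⟩ := hT f' G'
  obtain ⟨E₁, hE₁, uE₁⟩ := hW (p E₀ H₀) (q E₀ H₀)
  obtain ⟨H₁, hH₁, uH₁⟩ := hW (p' E₀ H₀) (q' E₀ H₀)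
  obtain ⟨E₂, hE₂, uE₂⟩ := hW (r E₀ H₀) (s E₀ H₀)
  obtain ⟨H₂, hH₂, uH₂⟩ := hW (r' E₀ H₀) (s' E₀ H₀)
  refine ⟨(![E₀, E₁, E₂], ![H₀, H₁, H₂]), ⟨hE₀, hH₀, hE₁, hH₁, hE₂, hH₂⟩, ?_⟩
  rintro ⟨E, H⟩ ⟨e0, h0, e1, h1, e2, h2⟩
  have e0' := uE₀ _ e0
  have h0' := uH₀ _ h0
  simp only at e0' h0' e1 h1 e2 h2
  rw [e0', h0'] at e1 h1 e2 h2
  refine Prod.ext (funext fun i => ?_) (funext fun i => ?_) <;> fin_cases i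
  exacts [e0', uE₁ _ e1, uE₂ _ e2, h0', uH₁ _ h1, uH₂ _ h2]

end Cuboid

end System

end PolarizationInterface

end

theorem mainTheorem3 (D : PolarizationInterface.Cuboid) (ε μ ω : ℝ)
    (hε : 0 < ε) (hμ : 0 < μ) (hω : 0 < ω)
    (hσ : ω ^ 2 ∉ PolarizationInterface.sigmaM D ε μ) (fh fe : D.L2vec) :
    ∃! EH : D.L2vec × D.L2vec, D.IsWeakSolution ε μ ω fh fe EH.1 EH.2 := by
  simp only [PolarizationInterface.sigmaM, mem_union, not_or] at hσ
  obtain ⟨⟨hσ, hσp⟩, hσm⟩ := hσ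
  obtain ⟨c, hc, h⟩ := PolarizationInterface.exists_gap hε hμ D.l₁_pos D.l₂_pos D.l₃_pos hσ
  obtain ⟨cp, hcp, hp⟩ := PolarizationInterface.exists_gap hε hμ D.l₁_pos D.l₂_pos D.l₃p_pos hσp
  obtain ⟨cm, hcm, hm⟩ := PolarizationInterface.exists_gap hε hμ D.l₁_pos D.l₂_pos D.l₃m_pos hσm
  -- The Dirichlet frequencies start at index one, hence `j + 1`; the left summand of the index type
  -- belongs to the part below `Γ`.
  have hS := D.existsUnique_H1perZero (lt_min hcp hcm) (κ := ω ^ 2 * ε * μ) fun k n j => by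
    rcases j with j | j
    · exact (min_le_right _ _).trans (hm k n (j + 1))
    · exact (min_le_left _ _).trans (hp k n (j + 1))
  have hT := D.existsUnique_H1per hc (κ := ω ^ 2 * ε * μ) h
  -- The eigenvalues in `W` are the Neumann eigenvalues with vanishing second and third index, so
  -- the same gap applies.
  have hW := D.existsUnique_W hc (κ := ω ^ 2 * ε * μ) fun k => by
    simpa [PolarizationInterface.Cuboid.freq] using h k 0 0
  simp only [D.isWeakSolution_iff]
  exact D.existsUnique_system hS hT hW _ _ _ _ (fun _ u => D.source _ 2 u _ _)
    (fun u _ => D.source _ 1 u _ _) (fun u _ => D.source _ 2 u _ _)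
    (fun _ u => D.source _ 1 u _ _) (fun _ u => D.source _ 1 u _ _)
    (fun u _ => D.source _ 2 u _ _) (fun u _ => D.source _ 1 u _ _)
    (fun _ u => D.source _ 2 u _ _)
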